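/- Let $\mathcal M$ be a smooth finite-dimensional (boundaryless, Hausdorff) Riemannian manifold on which every geodesic is defined for all times, so that $\mathrm{Exp}_x:T_x\mathcal M\to\mathcal M$ is defined everywhere. Let $n\ge 1$, let $f_1,\dots,f_n:\mathcal M\to\mathbb R$ be continuously differentiable, $f=\frac1n\sum_{i=1}^n f_i$, and let $\omega^*$ be a global minimizer of $f$. For $I\subset\{1,\dots,n\}$ put $\operatorname{grad}f_I=\frac1{|I|}\sum_{i\in I}\operatorname{grad}f_i$. Let $\Omega\subset\mathcal M$ and $\rho\in(0,\infty]$ be such that, for every $x\in\Omega$, $\mathrm{Exp}_x$ is a diffeomorphism from the open ball $B_x(0,\rho)\subset T_x\mathcal M$ onto an open set containing $\Omega$. ($\Omega$ may be a compact neighbourhood of $\omega^*$; no smallness is required, and $\Omega=\mathcal M$, $\rho=\infty$ is allowed.) For $x,y\in\Omega$ let $\mathrm{Exp}_x^{-1}(y)$ be the inverse on $B_x(0,\rho)$ and let $\Gamma_x^y$ be the (Levi-Civita) parallel transport from $x$ to $y$ along $t\mapsto\mathrm{Exp}_x(t\,\mathrm{Exp}_x^{-1}(y))$. Suppose there are $M,L>0$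 and $N$ such that for all $x\in\Omega$, $\xi\in B_x(0,\rho)$ with $y=\mathrm{Exp}_x(\xi)\in\Omega$: $$\frac1n\sum_{i=1}^n\|\operatorname{grad}f_i(x)-\Gamma_y^x\operatorname{grad}f_i(y)\|^2\le M^2\|\xi\|^2,\qquad f(y)\le f(x)+\langle\operatorname{grad}f(x),\xi\rangle+\frac L2\|\xi\|^2,$$ and $\|\operatorname{grad}f_i(x)\|\le N$ for all $i$ and all $x\in\Omega$. Algorithm. Let $m\ge1$, $1\le b\le n$, $0<\mu<1$, let $\phi^s,\psi^s\ge0$ satisfy $\phi^s+\psi^s\le1$ for $s\ge1$, and let $C_\alpha>0$. Let the $I_t^s$ be independent random sets, uniformly distributed on the subsets of $\{1,\dots,n\}$ of cardinality $b$. Start from $\tilde\omega^0\in\mathcal M$. For $s=1,2,\dots$ put $\omega_0^s=\tilde\omega^{s-1}$, $V_0^s=\operatorname{grad}f(\omega_0^s)$, and $\omega_{t+1}^s=\mathrm{Exp}_{\omega_t^s}(-C_\alpha V_t^s)$ for $0\le t<m$, where for $1\le t<m$ $$V_t^s=\phi^s\big(\operatorname{grad}f_{I_t^s}(\omega_t^s)-\Gamma_{\omega_0^s}^{\omega_t^s}(\operatorname{grad}f_{I_t^s}(\omega_0^s)-\operatorname{grad}f(\omega_0^s))\big)+\tilde\psi_t^s\big(\operatorname{grad}f_{I_t^s}(\omega_t^s)-\Gamma_{\omega_{t-1}^s}^{\omega_t^s}(\operatorname{grad}f_{I_t^s}(\omega_{t-1}^s)-V_{t-1}^s)\big)+(1-\phi^s-\tilde\psi_t^s)\operatorname{grad}f_{I_t^s}(\omega_t^s),$$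 $\Gamma_{\omega_{t-1}^s}^{\omega_t^s}$ is taken along the geodesic step $\tau\mapsto\mathrm{Exp}_{\omega_{t-1}^s}(-\tau C_\alpha V_{t-1}^s)$, $0\le\tau\le1$, and, with $a_t^s=\langle\Gamma_{\omega_{t-1}^s}^{\omega_t^s}(V_{t-1}^s-\operatorname{grad}f(\omega_{t-1}^s)),\operatorname{grad}f(\omega_t^s)\rangle$, $\tilde\psi_t^s=\min\{\psi^s,\mu\|\operatorname{grad}f(\omega_t^s)\|^2/|a_t^s|\}$ if $a_t^s\ne0$ and $\tilde\psi_t^s=\psi^s$ otherwise. Put $\tilde\omega^s=\omega_m^s$. For $S\ge1$ the output $\omega_a$ is $\omega_t^s$ with $(s,t)$ uniformly distributed on $\{1,\dots,S\}\times\{0,\dots,m-1\}$, independently of the $I_t^s$. Suppose that almost surely $\mathrm{Exp}_{\omega_t^s}(-\tau C_\alpha V_t^s)\in\Omega$ for all $s\ge1$, $0\le t<m$, $\tau\in[0,1]$, that $\sum_{s\ge1}\big((1-\phi^s)^2+(\psi^s)^2\big)<\infty$, and that $C_\alpha\le\dfrac2{L+\sqrt{L^2+4\nu}}$ with $\nu=4m^3M^2$.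 Then for every $S\ge1$ the random variable $\|\operatorname{grad}f(\omega_a)\|^2$ is integrable and $$\mathbb E\|\operatorname{grad}f(\omega_a)\|^2\le\frac2{mSC_\alpha}\big(f(\tilde\omega^0)-f(\omega^*)\big)+\frac{4mN^2}{S}\sum_{s=1}^\infty\big((1-\phi^s)^2+(\psi^s)^2\big),$$ and in particular $\mathbb E\|\operatorname{grad}f(\omega_a)\|^2=\mathcal O(1/S)$ as $S\to\infty$. -/

import Mathlib

open Bundle Manifold MeasureTheory ProbabilityTheory Filter
open scoped ContDiff ENNReal

noncomputable section

namespace RSHG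

section Geometry

/- `X` is a (boundaryless) manifold modelled on the finite-dimensional space `E`, and the tangent
spaces carry a Riemannian metric. -/
variable {E : Type*} [NormedAddCommGroup E] [NormedSpace ℝ E]
  {X : Type*} [TopologicalSpace X] [ChartedSpace E X] [IsManifold 𝓘(ℝ, E) ∞ X]
  [RiemannianBundle (fun x : X ↦ TangentSpace 𝓘(ℝ, E) x)]

/-- The coefficients `g_z(v, w)` of the metric in the chart around `p`, at the point with
coordinates `z`. -/
def chartMetric (p : X) (z v w : E) : ℝ :=
  inner ℝ
    (mfderiv 𝓘(ℝ, E) 𝓘(ℝ, E) (extChartAt 𝓘(ℝ, E) p).symm z v :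
      TangentSpace 𝓘(ℝ, E) ((extChartAt 𝓘(ℝ, E) p).symm z))
    (mfderiv 𝓘(ℝ, E) 𝓘(ℝ, E) (extChartAt 𝓘(ℝ, E) p).symm z w)

/-- The derivative of `z ↦ g_z(v, w)` in the direction `u`. -/
def chartMetricDeriv (p : X) (z u v w : E) : ℝ :=
  fderiv ℝ (fun z' : E ↦ chartMetric p z' v w) z u

/-- The Christoffel symbols of the first kind of the Levi-Civita connection in the chart around
`p`: `Γ_{uv,w} = (∂_u g(v, w) + ∂_v g(u, w) - ∂_w g(u, v)) / 2`. -/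
def christoffel (p : X) (z u v w : E) : ℝ :=
  (chartMetricDeriv p z u v w + chartMetricDeriv p z v u w - chartMetricDeriv p z w u v) / 2

/-- The coordinates, in the chart around `p`, of a curve. -/
def curveCoord (p : X) (γ : ℝ → X) (t : ℝ) : E :=
  extChartAt 𝓘(ℝ, E) p (γ t)

/-- The coordinates, in the chart around `p`, of a vector field along a curve. -/
def fieldCoord (p : X) (γ : ℝ → X) (W : (t : ℝ) → TangentSpace 𝓘(ℝ, E) (γ t)) (t : ℝ) : E :=
  mfderiv 𝓘(ℝ, E) 𝓘(ℝ, E) (extChartAt 𝓘(ℝ, E) p) (γ t) (W t)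

/-- `W` is parallel along `γ`: in every chart it is differentiable and
`g(W', w) + Γ_{γ' W, w} = 0` for all `w`, that is, the Levi-Civita covariant derivative of `W`
along `γ` vanishes (with the index lowered by the metric). -/
def IsParallelAlong (γ : ℝ → X) (W : (t : ℝ) → TangentSpace 𝓘(ℝ, E) (γ t)) : Prop :=
  ∀ (t : ℝ) (p : X), γ t ∈ (extChartAt 𝓘(ℝ, E) p).source →
    DifferentiableAt ℝ (fieldCoord p γ W) t ∧
    ∀ w : E,
      chartMetric p (curveCoord p γ t) (deriv (fieldCoord p γ W) t) w +
        christoffel p (curveCoord p γ t) (deriv (curveCoord p γ) t) (fieldCoord p γ W t) w = 0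

/-- The velocity field of a curve. -/
def velocity (γ : ℝ → X) (t : ℝ) : TangentSpace 𝓘(ℝ, E) (γ t) :=
  mfderiv 𝓘(ℝ, ℝ) 𝓘(ℝ, E) γ t (1 : ℝ)

/-- `γ` is a geodesic, defined for all times: a smooth curve whose velocity is parallel. -/
def IsGeodesic (E : Type*) [NormedAddCommGroup E] [NormedSpace ℝ E] [ChartedSpace E X]
    [IsManifold 𝓘(ℝ, E) ∞ X] [RiemannianBundle (fun x : X ↦ TangentSpace 𝓘(ℝ, E) x)]
    (γ : ℝ → X) : Prop :=
  ContMDiff 𝓘(ℝ, ℝ) 𝓘(ℝ, E) ∞ γ ∧ IsParallelAlong γ (velocity (E := E) γ)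

/-- `γ` is the geodesic with `γ 0 = x` and `γ' 0 = ξ`. -/
def IsGeodesicFrom (x : X) (ξ : TangentSpace 𝓘(ℝ, E) x) (γ : ℝ → X) : Prop :=
  IsGeodesic E γ ∧ (⟨γ 0, velocity (E := E) γ 0⟩ : TangentBundle 𝓘(ℝ, E) X) = ⟨x, ξ⟩

/-- Every geodesic is defined for all times, i.e. the exponential map is defined on all of `TX`. -/
def GeodesicallyComplete (X : Type*) [TopologicalSpace X] [ChartedSpace E X]
    [IsManifold 𝓘(ℝ, E) ∞ X] [RiemannianBundle (fun x : X ↦ TangentSpace 𝓘(ℝ, E) x)] : Prop :=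
  ∀ (x : X) (ξ : TangentSpace 𝓘(ℝ, E) x), ∃ γ : ℝ → X, IsGeodesicFrom x ξ γ

open Classical in
/-- The exponential map: `Exp_x(ξ) = γ 1`, where `γ` is the geodesic with initial data `(x, ξ)`
(and the irrelevant value `x` if there is no such geodesic). -/
def expMap (x : X) (ξ : TangentSpace 𝓘(ℝ, E) x) : X :=
  if h : ∃ γ : ℝ → X, IsGeodesicFrom x ξ γ then h.choose 1 else x

/-- Parallel transport of `η` from `x` to `y` along the geodesic `t ↦ Exp_x(t ξ)`, `0 ≤ t ≤ 1`
(to be used with `y = Exp_x(ξ)`). -/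
def parallelTransport (x y : X) (ξ η : TangentSpace 𝓘(ℝ, E) x) : TangentSpace 𝓘(ℝ, E) y :=
  Classical.epsilon fun ζ : TangentSpace 𝓘(ℝ, E) y ↦
    ∃ (γ : ℝ → X) (W : (t : ℝ) → TangentSpace 𝓘(ℝ, E) (γ t)),
      IsGeodesicFrom x ξ γ ∧ IsParallelAlong γ W ∧
      (⟨γ 0, W 0⟩ : TangentBundle 𝓘(ℝ, E) X) = ⟨x, η⟩ ∧
      (⟨γ 1, W 1⟩ : TangentBundle 𝓘(ℝ, E) X) = ⟨y, ζ⟩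

/-- The inverse `Exp_x⁻¹(y)` of the exponential map on the open ball of radius `ρ` in `T_x X`. -/
def logMap (ρ : ℝ≥0∞) (x y : X) : TangentSpace 𝓘(ℝ, E) x :=
  Classical.epsilon fun ξ : TangentSpace 𝓘(ℝ, E) x ↦
    ξ ∈ Metric.eball (0 : TangentSpace 𝓘(ℝ, E) x) ρ ∧ expMap x ξ = y

/-- The parallel transport `Γ_x^y` from `x` to `y` along the geodesic `t ↦ Exp_x(t Exp_x⁻¹(y))`. -/
def transport (ρ : ℝ≥0∞) (x y : X) (η : TangentSpace 𝓘(ℝ, E) x) : TangentSpace 𝓘(ℝ, E) y :=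
  parallelTransport x y (logMap ρ x y) η

/-- `Ω` is `ρ`-totally retractive for `Exp`: for every `x ∈ Ω` the map `Exp_x` is a diffeomorphism
from the ball of radius `ρ` in `T_x X` onto an open set that contains `Ω`. -/
def IsTotallyRetractive (ρ : ℝ≥0∞) (Ω : Set X) : Prop :=
  ∀ x ∈ Ω,
    (∃ Φ : PartialDiffeomorph 𝓘(ℝ, TangentSpace 𝓘(ℝ, E) x) 𝓘(ℝ, E) (TangentSpace 𝓘(ℝ, E) x) X ∞,
      Φ.source = Metric.eball (0 : TangentSpace 𝓘(ℝ, E) x) ρ ∧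
      Set.EqOn Φ (expMap x) (Metric.eball (0 : TangentSpace 𝓘(ℝ, E) x) ρ)) ∧
    Ω ⊆ expMap x '' Metric.eball (0 : TangentSpace 𝓘(ℝ, E) x) ρ

variable [FiniteDimensional ℝ E]

/-- The Riemannian gradient: `Df(x)[ξ] = ⟨grad f(x), ξ⟩` for all `ξ ∈ T_x X`. -/
def grad (f : X → ℝ) (x : X) : TangentSpace 𝓘(ℝ, E) x :=
  haveI : FiniteDimensional ℝ (TangentSpace 𝓘(ℝ, E) x) := inferInstanceAs (FiniteDimensional ℝ E)
  haveI : CompleteSpace (TangentSpace 𝓘(ℝ, E) x) :=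
    FiniteDimensional.complete ℝ (TangentSpace 𝓘(ℝ, E) x)
  (InnerProductSpace.toDual ℝ (TangentSpace 𝓘(ℝ, E) x)).symm
    (show TangentSpace 𝓘(ℝ, E) x →L[ℝ] ℝ from mfderiv 𝓘(ℝ, E) 𝓘(ℝ, ℝ) f x)

/-- The finite-sum objective `f = (1/n) ∑ f_i`. -/
def objective {n : ℕ} (f : Fin n → X → ℝ) (x : X) : ℝ :=
  (1 / (n : ℝ)) * ∑ i, f i x

/-- The mini-batch gradient `grad f_I(x) = (1/|I|) ∑_{i ∈ I} grad f_i(x)`. -/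
def batchGrad {n : ℕ} (f : Fin n → X → ℝ) (I : Finset (Fin n)) (x : X) :
    TangentSpace 𝓘(ℝ, E) x :=
  (1 / (I.card : ℝ)) • ∑ i ∈ I, grad (f i) x

/-- `(1/n) ∑ ‖grad f_i(x) - Γ_y^x grad f_i(y)‖² ≤ M² ‖ξ‖²` for all `x, y = Exp_x(ξ) ∈ Ω`, with `ξ`
in the ball of radius `ρ`. -/
def IsMeanSquareLipschitz {n : ℕ} (f : Fin n → X → ℝ) (ρ : ℝ≥0∞) (Ω : Set X) (M : ℝ) : Prop :=
  ∀ x ∈ Ω, ∀ y ∈ Ω, ∀ ξ ∈ Metric.eball (0 : TangentSpace 𝓘(ℝ, E) x) ρ, expMap x ξ = y →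
    (1 / (n : ℝ)) * ∑ i, ‖grad (E := E) (f i) x - transport ρ y x (grad (f i) y)‖ ^ 2 ≤ M ^ 2 * ‖ξ‖ ^ 2

/-- `f(y) ≤ f(x) + ⟨grad f(x), ξ⟩ + (L/2) ‖ξ‖²` for all `x, y = Exp_x(ξ) ∈ Ω`, with `ξ` in the ball
of radius `ρ`. -/
def IsRetractionSmooth (f : X → ℝ) (ρ : ℝ≥0∞) (Ω : Set X) (L : ℝ) : Prop :=
  ∀ x ∈ Ω, ∀ y ∈ Ω, ∀ ξ ∈ Metric.eball (0 : TangentSpace 𝓘(ℝ, E) x) ρ, expMap x ξ = y →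
    f y ≤ f x + inner ℝ (grad (E := E) f x) ξ + L / 2 * ‖ξ‖ ^ 2

/-- The adaptive parameter `min {ψ, c ‖grad f(y)‖² / |a|}` if `a ≠ 0`, and `ψ` otherwise. -/
def adaptiveParam (ψ c gradSq a : ℝ) : ℝ :=
  open Classical in if a ≠ 0 then min ψ (c * gradSq / |a|) else ψ

/-- The new direction `V_t` at `y = ω_t`, from the batch `I = I_t`, the anchor `x₀ = ω_0` of the
epoch, the previous point `x = ω_{t-1}`, the previous direction `v = V_{t-1}` and the step
`ξ = -α v`, for which `y = Exp_x(ξ)`. -/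
def direction {n : ℕ} (f : Fin n → X → ℝ) (ρ : ℝ≥0∞) (c φ ψ : ℝ) (I : Finset (Fin n))
    (x₀ x y : X) (v ξ : TangentSpace 𝓘(ℝ, E) x) : TangentSpace 𝓘(ℝ, E) y :=
  let a : ℝ := inner ℝ (parallelTransport x y ξ (v - grad (objective f) x)) (grad (objective f) y)
  let ψ' : ℝ := adaptiveParam ψ c (‖grad (E := E) (objective f) y‖ ^ 2) a
  φ • (batchGrad f I y - transport ρ x₀ y (batchGrad f I x₀ - grad (objective f) x₀)) +
    ψ' • (batchGrad f I y - parallelTransport x y ξ (batchGrad f I x - v)) +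
    (1 - φ - ψ') • batchGrad f I y

/-- The inner loop of one epoch started at `x₀`: the pair `(ω_t, V_t)`, with
`ω_0 = x₀`, `V_0 = grad f(x₀)` and `ω_{t+1} = Exp_{ω_t}(-α_t V_t)`. -/
def innerLoop {n : ℕ} (f : Fin n → X → ℝ) (ρ : ℝ≥0∞) (c : ℝ) (α φ ψ : ℕ → ℝ)
    (I : ℕ → Finset (Fin n)) (x₀ : X) : ℕ → TangentBundle 𝓘(ℝ, E) X
  | 0 => ⟨x₀, grad (objective f) x₀⟩
  | t + 1 =>
    let q := innerLoop f ρ c α φ ψ I x₀ t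
    let ξ : TangentSpace 𝓘(ℝ, E) q.proj := -(α t • q.snd)
    ⟨expMap q.proj ξ,
      direction f ρ c (φ (t + 1)) (ψ (t + 1)) (I (t + 1)) x₀ q.proj (expMap q.proj ξ) q.snd ξ⟩

/-- The starting points of the epochs (`w₀` for the first one); the epochs are numbered from `0`,
and each has `m` inner steps. -/
def anchor {n : ℕ} (f : Fin n → X → ℝ) (ρ : ℝ≥0∞) (c : ℝ) (m : ℕ) (α φ ψ : ℕ → ℕ → ℝ)
    (I : ℕ → ℕ → Finset (Fin n)) (w₀ : X) : ℕ → X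
  | 0 => w₀
  | s + 1 =>
    (innerLoop (E := E) f ρ c (α s) (φ s) (ψ s) (I s) (anchor f ρ c m α φ ψ I w₀ s) m).proj

/-- The pair `(ω_t, V_t)` of the epoch `s` (numbered from `0`) of the Riemannian stochastic hybrid
gradient algorithm with adaptive parameters, run with the exponential map and parallel transport,
the step sizes `α`, the parameters `φ`, `ψ`, `c` and the batches `I`. -/
def iter {n : ℕ} (f : Fin n → X → ℝ) (ρ : ℝ≥0∞) (c : ℝ) (m : ℕ) (α φ ψ : ℕ → ℕ → ℝ)
    (I : ℕ → ℕ → Finset (Fin n)) (w₀ : X) (s t : ℕ) : TangentBundle 𝓘(ℝ, E) X :=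
  innerLoop (E := E) f ρ c (α s) (φ s) (ψ s) (I s) (anchor (E := E) f ρ c m α φ ψ I w₀ s) t

end Geometry

end RSHG

end

/-! Within one epoch let `e_t`, `v_t`, `G_t` be the expectations of `‖V_t - grad f(ω_t)‖²`,
`‖V_t‖²`, `‖grad f(ω_t)‖²`, and let `α` be the step size. Polarizing the inner product in the
smoothness inequality gives `E f(ω_{t+1}) ≤ E f(ω_t) - (α/2) G_t + (α/2) e_t - (α/2)(1 - Lα) v_t`
(`objective_step_le`), so everything rests on a bound for `e_t`.

The error of `V_{t+1}` is the transported error of `V_t`, times the adaptive parameter, plus a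
centred batch mean of vectors `u_i` (`batchAvg_direction_le`). Neither the parameter nor the `u_i`
involve the new batch, so averaging over that batch kills the cross term and leaves the old error
plus at most the mean of `‖u_i‖²`. Each `u_i` combines gradient differences relative to `ω_0` and
`ω_t` with a remainder of weight at most `1 - φ`, whence the bound `2M²D² + 2(1-φ)²N²`, where `D` is
the length of the path from `ω_0` to `ω_{t+1}`. By Cauchy-Schwarz, `D² ≤ α²(t+1) ∑_{i ≤ t} ‖V_i‖²`.
Unrolling from `e_0 = 0`, the sum of the `e_t` costs at most `2m³M²α² ∑ v_t`, which the term `-(1 -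
Lα) ∑ v_t` absorbs under the step-size condition (`sum_grad_le_of_descent`). The objective values
telescope over steps and epochs, the minimizer bounds them from below, and division by `mS` gives
the rate.

The geometry has to supply three facts. Parallel transport is a linear isometry
(`exists_parallelTransport_eq`): parallel fields exist, are unique and have constant inner products.
A geodesic step inside `Ω` is the radial one given by `logMap` (`mem_eball_of_segment`), by a
connectedness argument. Finally `‖Exp_y⁻¹(ω_0)‖` is at most the length of the path from `ω_0` to `y`
(`norm_logMap_le`); this follows from the Gauss lemma (`metricAt_dMap_radial`), since the radial
distance from `y` changes at most at the speed of the curve. As `expMap` and `parallelTransport` are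
defined by choice, uniqueness for the geodesic equation is needed to identify them.

On the probabilistic side each iterate depends on finitely many batches with finitely many values,
so functions of the iterates are integrable and independent of the next batch without any
measurability of the geometric objects. -/

noncomputable section

namespace RSHG

set_option linter.unusedSectionVars false

open Set Topology

/-! ### The metric in a chart, as a smooth field of bilinear forms. -/

section ChartMetric

variable {E : Type*} [NormedAddCommGroup E] [NormedSpace ℝ E]
  {X : Type*} [TopologicalSpace X] [ChartedSpace E X] [IsManifold 𝓘(ℝ, E) ∞ X]
  [RiemannianBundle (fun x : X ↦ TangentSpace 𝓘(ℝ, E) x)]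

/-- The inner product on `T_y X`, as a function on the model space. -/
def metricAt (y : X) (v w : E) : ℝ :=
  (inner ℝ : TangentSpace 𝓘(ℝ, E) y → TangentSpace 𝓘(ℝ, E) y → ℝ) v w

/-- The derivative of the chart at `p`, as an endomorphism of the model space. -/
def dChart (p y : X) : E →L[ℝ] E := mfderiv 𝓘(ℝ, E) 𝓘(ℝ, E) (extChartAt 𝓘(ℝ, E) p) y

/-- The derivative of the inverse of the chart at `p`, as an endomorphism of the model space. -/
def dChartSymm (p : X) (z : E) : E →L[ℝ] E :=
  mfderiv 𝓘(ℝ, E) 𝓘(ℝ, E) (extChartAt 𝓘(ℝ, E) p).symm z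

theorem isOpen_target (p : X) : IsOpen (extChartAt 𝓘(ℝ, E) p).target :=
  isOpen_extChartAt_target p

theorem isOpen_source (p : X) : IsOpen (extChartAt 𝓘(ℝ, E) p).source :=
  isOpen_extChartAt_source p

theorem isManifold_one : IsManifold 𝓘(ℝ, E) 1 X :=
  IsManifold.of_le (n := ∞) (by simp)

theorem dChart_dChartSymm {p y : X} (hy : y ∈ (extChartAt 𝓘(ℝ, E) p).source) (v : E) :
    dChart p y (dChartSymm p (extChartAt 𝓘(ℝ, E) p y) v) = v := by
  have : IsManifold 𝓘(ℝ, E) 1 X := isManifold_one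
  have := mfderiv_extChartAt_comp_mfderivWithin_extChartAt_symm' (I := 𝓘(ℝ, E)) hy
  rw [modelWithCornersSelf_coe, range_id, mfderivWithin_univ] at this
  exact congrArg (fun L : E →L[ℝ] E ↦ L v) this

theorem dChartSymm_dChart {p y : X} (hy : y ∈ (extChartAt 𝓘(ℝ, E) p).source) (v : E) :
    dChartSymm p (extChartAt 𝓘(ℝ, E) p y) (dChart p y v) = v := by
  have : IsManifold 𝓘(ℝ, E) 1 X := isManifold_one
  have := mfderivWithin_extChartAt_symm_comp_mfderiv_extChartAt' (I := 𝓘(ℝ, E)) hy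
  rw [modelWithCornersSelf_coe, range_id, mfderivWithin_univ] at this
  exact congrArg (fun L : E →L[ℝ] E ↦ L v) this

theorem chartMetric_eq (p : X) (z v w : E) :
    chartMetric p z v w =
      metricAt ((extChartAt 𝓘(ℝ, E) p).symm z) (dChartSymm p z v) (dChartSymm p z w) := rfl

theorem chartMetric_dChart {p y : X} (hy : y ∈ (extChartAt 𝓘(ℝ, E) p).source) (v w : E) :
    chartMetric p (extChartAt 𝓘(ℝ, E) p y) (dChart p y v) (dChart p y w) = metricAt y v w := by
  rw [chartMetric_eq, dChartSymm_dChart hy, dChartSymm_dChart hy,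
    (extChartAt 𝓘(ℝ, E) p).left_inv hy]

theorem metricAt_add_left (y : X) (u v w : E) :
    metricAt y (u + v) w = metricAt y u w + metricAt y v w :=
  inner_add_left (𝕜 := ℝ) (E := TangentSpace 𝓘(ℝ, E) y) u v w

theorem metricAt_smul_left (y : X) (c : ℝ) (v w : E) :
    metricAt y (c • v) w = c * metricAt y v w :=
  real_inner_smul_left (F := TangentSpace 𝓘(ℝ, E) y) v w c

theorem metricAt_comm (y : X) (v w : E) : metricAt y v w = metricAt y w v :=
  real_inner_comm (F := TangentSpace 𝓘(ℝ, E) y) w v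

theorem metricAt_self_eq_zero {y : X} {v : E} : metricAt y v v = 0 ↔ v = 0 :=
  inner_self_eq_zero (𝕜 := ℝ) (E := TangentSpace 𝓘(ℝ, E) y) (x := v)

theorem metricAt_add_right (y : X) (u v w : E) :
    metricAt y u (v + w) = metricAt y u v + metricAt y u w := by
  rw [metricAt_comm, metricAt_add_left, metricAt_comm y v, metricAt_comm y w]

theorem metricAt_smul_right (y : X) (c : ℝ) (v w : E) :
    metricAt y v (c • w) = c * metricAt y v w := by
  rw [metricAt_comm, metricAt_smul_left, metricAt_comm]

theorem chartMetric_comm (p : X) (z v w : E) : chartMetric p z v w = chartMetric p z w v := by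
  rw [chartMetric_eq, metricAt_comm, ← chartMetric_eq]

theorem chartMetric_self_eq_zero {p : X} {z : E} (hz : z ∈ (extChartAt 𝓘(ℝ, E) p).target) {v : E} :
    chartMetric p z v v = 0 ↔ v = 0 := by
  rw [chartMetric_eq, metricAt_self_eq_zero]
  refine ⟨fun h ↦ ?_, fun h ↦ by rw [h, map_zero]⟩
  have := dChart_dChartSymm (E := E) ((extChartAt 𝓘(ℝ, E) p).map_target hz) v
  rw [(extChartAt 𝓘(ℝ, E) p).right_inv hz, h, map_zero] at this
  exact this.symm

variable [FiniteDimensional ℝ E]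

/-- The metric in the chart at `p`, as a continuous bilinear form. -/
def metricForm (p : X) (z : E) : E →L[ℝ] E →L[ℝ] ℝ :=
  LinearMap.toContinuousLinearMap (LinearMap.comp
    (LinearMap.toContinuousLinearMap (𝕜 := ℝ) (E := E) (F' := ℝ)).toLinearMap
    (LinearMap.mk₂ ℝ (chartMetric p z)
      (fun u v w ↦ by simp only [chartMetric_eq, map_add, metricAt_add_left])
      (fun c v w ↦ by simp only [chartMetric_eq, map_smul, metricAt_smul_left, smul_eq_mul])
      (fun u v w ↦ by simp only [chartMetric_eq, map_add, metricAt_add_right])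
      (fun c v w ↦ by simp only [chartMetric_eq, map_smul, metricAt_smul_right, smul_eq_mul])))

theorem metricForm_apply (p : X) (z v w : E) : metricForm p z v w = chartMetric p z v w := rfl

variable [IsContMDiffRiemannianBundle 𝓘(ℝ, E) ∞ E (fun x : X ↦ TangentSpace 𝓘(ℝ, E) x)]

/-- The tangent map of the inverse chart, applied to a constant vector field: this is the bundle
form in which smoothness of the Riemannian metric can be used. -/
theorem contMDiffOn_dChartSymm (p : X) (v : E) :
    ContMDiffOn 𝓘(ℝ, E) (𝓘(ℝ, E).prod 𝓘(ℝ, E)) ∞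
      (fun z ↦ (⟨(extChartAt 𝓘(ℝ, E) p).symm z, dChartSymm p z v⟩ : TangentBundle 𝓘(ℝ, E) X))
      (extChartAt 𝓘(ℝ, E) p).target := by
  have h := (contMDiffOn_extChartAt_symm (I := 𝓘(ℝ, E)) (n := ∞) p)
  have h2 := h.contMDiffOn_tangentMapWithin (m := ∞) (by simp) (isOpen_target p).uniqueMDiffOn
  have h3 : ContMDiff 𝓘(ℝ, E) (𝓘(ℝ, E).prod 𝓘(ℝ, E)) ∞
      (fun z ↦ (⟨z, v⟩ : TangentBundle 𝓘(ℝ, E) E)) := by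
    intro z
    rw [contMDiffAt_totalSpace]
    refine ⟨contMDiffAt_id, ?_⟩
    simp only [trivializationAt_model_space_apply]
    exact contMDiffAt_const
  refine (h2.comp h3.contMDiffOn (fun z hz ↦ hz)).congr fun z hz ↦ ?_
  simp only [Function.comp, tangentMapWithin]
  rw [mfderivWithin_of_mem_nhds ((isOpen_target p).mem_nhds hz)]
  rfl

theorem contDiffOn_metricForm (p : X) :
    ContDiffOn ℝ ∞ (metricForm p) (extChartAt 𝓘(ℝ, E) p).target := by
  rw [contDiffOn_clm_apply]
  intro v
  rw [contDiffOn_clm_apply]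
  intro w
  rw [← contMDiffOn_iff_contDiffOn]
  exact ContMDiffOn.inner_bundle (F := E) (E := fun x : X ↦ TangentSpace 𝓘(ℝ, E) x)
    (b := (extChartAt 𝓘(ℝ, E) p).symm) (v := fun z ↦ dChartSymm p z v)
    (w := fun z ↦ dChartSymm p z w) (contMDiffOn_dChartSymm p v) (contMDiffOn_dChartSymm p w)

theorem contDiffAt_metricForm {p : X} {z : E} (hz : z ∈ (extChartAt 𝓘(ℝ, E) p).target) :
    ContDiffAt ℝ ∞ (metricForm p) z :=
  (contDiffOn_metricForm p).contDiffAt ((isOpen_target p).mem_nhds hz)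

end ChartMetric

/-! ### Christoffel symbols of a field of bilinear forms on a vector space. -/

section LocalForms

variable {E : Type*} [NormedAddCommGroup E] [NormedSpace ℝ E]

local instance : NormedAddCommGroup (E →L[ℝ] ℝ) := ContinuousLinearMap.toNormedAddCommGroup
local instance : NormedSpace ℝ (E →L[ℝ] ℝ) := ContinuousLinearMap.toNormedSpace
local instance : NormedAddCommGroup (E →L[ℝ] E →L[ℝ] ℝ) :=
  ContinuousLinearMap.toNormedAddCommGroup
local instance : NormedSpace ℝ (E →L[ℝ] E →L[ℝ] ℝ) := ContinuousLinearMap.toNormedSpace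

/-- The Christoffel symbols of the first kind of a field of bilinear forms. -/
def lowerChristoffel (G : E → E →L[ℝ] E →L[ℝ] ℝ) (z u v w : E) : ℝ :=
  (fderiv ℝ G z u v w + fderiv ℝ G z v u w - fderiv ℝ G z w u v) / 2

theorem hasDerivAt_form {G : E → E →L[ℝ] E →L[ℝ] ℝ} {x a b : ℝ → E} {x' a' b' : E} {t : ℝ}
    (hG : DifferentiableAt ℝ G (x t)) (hx : HasDerivAt x x' t) (ha : HasDerivAt a a' t)
    (hb : HasDerivAt b b' t) :
    HasDerivAt (fun s ↦ G (x s) (a s) (b s))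
      (fderiv ℝ G (x t) x' (a t) (b t) + G (x t) a' (b t) + G (x t) (a t) b') t := by
  have h1 := hG.hasFDerivAt.comp_hasDerivAt t hx
  have h2 := (h1.clm_apply ha).clm_apply hb
  simpa [add_assoc] using h2

/-- Both sides are derivatives of one and the same function `z ↦ G z v w`. -/
theorem fderiv_form_comm {G : E → E →L[ℝ] E →L[ℝ] ℝ} (hsymm : ∀ z v w, G z v w = G z w v) {z : E}
    (hG : DifferentiableAt ℝ G z) (u v w : E) : fderiv ℝ G z u v w = fderiv ℝ G z u w v := by
  have h (v w : E) := (hG.hasFDerivAt.clm_apply (hasFDerivAt_const v z)).clm_apply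
    (hasFDerivAt_const w z)
  have h2 := (h v w).unique (by simpa only [hsymm _ v w] using h w v)
  simpa using congrArg (fun L : E →L[ℝ] ℝ ↦ L u) h2

/-- Metric compatibility: the inner product of two parallel fields has zero derivative. -/
theorem hasDerivAt_form_of_parallel {G : E → E →L[ℝ] E →L[ℝ] ℝ}
    (hsymm : ∀ z v w, G z v w = G z w v) {x a b : ℝ → E} {x' a' b' : E} {t : ℝ}
    (hG : DifferentiableAt ℝ G (x t)) (hx : HasDerivAt x x' t) (ha : HasDerivAt a a' t)
    (hb : HasDerivAt b b' t)
    (hpa : ∀ w, G (x t) a' w + lowerChristoffel G (x t) x' (a t) w = 0)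
    (hpb : ∀ w, G (x t) b' w + lowerChristoffel G (x t) x' (b t) w = 0) :
    HasDerivAt (fun s ↦ G (x s) (a s) (b s)) 0 t := by
  convert hasDerivAt_form hG hx ha hb using 1
  have h1 := hpa (b t)
  have h2 := hpb (a t)
  rw [hsymm _ b' (a t)] at h2
  simp only [lowerChristoffel] at h1 h2
  have h3 := fderiv_form_comm hsymm hG x' (a t) (b t)
  have h4 := fderiv_form_comm hsymm hG (a t) x' (b t)
  have h5 := fderiv_form_comm hsymm hG (b t) x' (a t)
  linarith

/-- The transformation law of the Christoffel symbols. -/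
theorem lowerChristoffel_pullback {G₁ G₂ : E → E →L[ℝ] E →L[ℝ] ℝ} {F : E → E} {z : E}
    (hG₁ : DifferentiableAt ℝ G₁ z) (hG₂ : DifferentiableAt ℝ G₂ (F z))
    (hsymm : ∀ z v w, G₂ z v w = G₂ z w v)
    (hF : ContDiffAt ℝ 2 F z)
    (hpull : ∀ᶠ z' in 𝓝 z, ∀ v w, G₁ z' v w = G₂ (F z') (fderiv ℝ F z' v) (fderiv ℝ F z' w))
    (u v w : E) :
    lowerChristoffel G₁ z u v w =
      lowerChristoffel G₂ (F z) (fderiv ℝ F z u) (fderiv ℝ F z v) (fderiv ℝ F z w) +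
        G₂ (F z) (fderiv ℝ (fderiv ℝ F) z u v) (fderiv ℝ F z w) := by
  have hF1 : DifferentiableAt ℝ F z := hF.differentiableAt (by simp)
  have hF2 : DifferentiableAt ℝ (fderiv ℝ F) z :=
    (hF.fderiv_right (m := 1) (by norm_num)).differentiableAt (by simp)
  have hsec (u v : E) : fderiv ℝ (fderiv ℝ F) z u v = fderiv ℝ (fderiv ℝ F) z v u :=
    hF.isSymmSndFDerivAt (by simp) u v
  -- The pullback identity `hpull` is differentiated along the line `s ↦ z + s • u`.
  have key (u v w : E) : fderiv ℝ G₁ z u v w =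
      fderiv ℝ G₂ (F z) (fderiv ℝ F z u) (fderiv ℝ F z v) (fderiv ℝ F z w) +
        G₂ (F z) (fderiv ℝ (fderiv ℝ F) z u v) (fderiv ℝ F z w) +
        G₂ (F z) (fderiv ℝ F z v) (fderiv ℝ (fderiv ℝ F) z u w) := by
    have hl : HasDerivAt (fun s : ℝ ↦ z + s • u) u 0 := by
      simpa using ((hasDerivAt_id (0 : ℝ)).smul_const u).const_add z
    have e0 : z + (0 : ℝ) • u = z := by simp
    have h1 := hasDerivAt_form (G := G₁) (x := fun s : ℝ ↦ z + s • u) (by simpa using hG₁) hl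
      (hasDerivAt_const 0 v) (hasDerivAt_const 0 w)
    have hx : HasDerivAt (fun s : ℝ ↦ F (z + s • u)) (fderiv ℝ F z u) 0 := by
      have : HasFDerivAt F (fderiv ℝ F z) (z + (0 : ℝ) • u) := by rw [e0]; exact hF1.hasFDerivAt
      exact this.comp_hasDerivAt 0 hl
    have ha (v : E) : HasDerivAt (fun s : ℝ ↦ fderiv ℝ F (z + s • u) v)
        (fderiv ℝ (fderiv ℝ F) z u v) 0 := by
      have : HasFDerivAt (fderiv ℝ F) (fderiv ℝ (fderiv ℝ F) z) (z + (0 : ℝ) • u) := by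
        rw [e0]; exact hF2.hasFDerivAt
      simpa using (this.comp_hasDerivAt 0 hl).clm_apply (hasDerivAt_const 0 v)
    have h2 := hasDerivAt_form (G := G₂) (x := fun s : ℝ ↦ F (z + s • u)) (by simpa using hG₂) hx
      (ha v) (ha w)
    have hc : ContinuousAt (fun s : ℝ ↦ z + s • u) 0 := hl.continuousAt
    have hev : ∀ᶠ s in 𝓝 (0 : ℝ), G₁ (z + s • u) v w =
        G₂ (F (z + s • u)) (fderiv ℝ F (z + s • u) v) (fderiv ℝ F (z + s • u) w) := by
      have : Tendsto (fun s : ℝ ↦ z + s • u) (𝓝 0) (𝓝 z) := by simpa using hc.tendsto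
      filter_upwards [this.eventually hpull] with s hs using hs v w
    have h3 := h1.unique (h2.congr_of_eventuallyEq hev)
    simpa using h3
  -- In the signed sum of three such derivatives the terms with the second derivative of `F` cancel
  -- by symmetry, except for two equal ones, which the factor `1/2` merges.
  simp only [lowerChristoffel, key]
  rw [hsec w u, hsec w v, hsec v u, hsymm _ (fderiv ℝ F z u) (fderiv ℝ (fderiv ℝ F) z v w),
    hsymm _ (fderiv ℝ F z v) (fderiv ℝ (fderiv ℝ F) z u w)]
  ring

end LocalForms

/-! ### Parallel fields: metric compatibility and independence of the chart. -/

section Parallel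

variable {E : Type*} [NormedAddCommGroup E] [NormedSpace ℝ E]
  {X : Type*} [TopologicalSpace X] [ChartedSpace E X] [IsManifold 𝓘(ℝ, E) ∞ X]
  [RiemannianBundle (fun x : X ↦ TangentSpace 𝓘(ℝ, E) x)]

/-- `W` is parallel along `γ` at the time `t`. -/
def IsParallelAt (γ : ℝ → X) (W : ℝ → E) (t : ℝ) : Prop :=
  ∀ p : X, γ t ∈ (extChartAt 𝓘(ℝ, E) p).source →
    DifferentiableAt ℝ (fieldCoord p γ W) t ∧
    ∀ w : E,
      chartMetric p (curveCoord p γ t) (deriv (fieldCoord p γ W) t) w +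
        christoffel p (curveCoord p γ t) (deriv (curveCoord p γ) t) (fieldCoord p γ W t) w = 0

theorem fieldCoord_eq (p : X) (γ : ℝ → X) (W : ℝ → E) (t : ℝ) :
    fieldCoord p γ W t = dChart p (γ t) (W t) := rfl

theorem eventually_mem_source {γ : ℝ → X} {t : ℝ} (hγ : ContinuousAt γ t) {p : X}
    (hp : γ t ∈ (extChartAt 𝓘(ℝ, E) p).source) :
    ∀ᶠ s in 𝓝 t, γ s ∈ (extChartAt 𝓘(ℝ, E) p).source :=
  hγ.eventually ((isOpen_source p).mem_nhds hp)

theorem contMDiffAt_chart {p y : X} (hy : y ∈ (extChartAt 𝓘(ℝ, E) p).source) :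
    ContMDiffAt 𝓘(ℝ, E) 𝓘(ℝ, E) ∞ (extChartAt 𝓘(ℝ, E) p) y :=
  (contMDiffOn_extChartAt (I := 𝓘(ℝ, E)) (n := ∞) (x := p)).contMDiffAt
    ((chartAt E p).open_source.mem_nhds (by simpa using hy))

theorem contMDiffAt_chartSymm {p : X} {z : E} (hz : z ∈ (extChartAt 𝓘(ℝ, E) p).target) :
    ContMDiffAt 𝓘(ℝ, E) 𝓘(ℝ, E) ∞ (extChartAt 𝓘(ℝ, E) p).symm z :=
  (contMDiffOn_extChartAt_symm (I := 𝓘(ℝ, E)) (n := ∞) p).contMDiffAt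
    ((isOpen_target p).mem_nhds hz)

theorem contDiffAt_curveCoord {γ : ℝ → X} {t : ℝ} (hγ : ContMDiffAt 𝓘(ℝ, ℝ) 𝓘(ℝ, E) ∞ γ t) {p : X}
    (hp : γ t ∈ (extChartAt 𝓘(ℝ, E) p).source) : ContDiffAt ℝ ∞ (curveCoord (E := E) p γ) t :=
  contMDiffAt_iff_contDiffAt.1 ((contMDiffAt_chart hp).comp t hγ)

theorem deriv_curveCoord {γ : ℝ → X} {t : ℝ} (hγ : ContMDiffAt 𝓘(ℝ, ℝ) 𝓘(ℝ, E) ∞ γ t) {p : X}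
    (hp : γ t ∈ (extChartAt 𝓘(ℝ, E) p).source) :
    deriv (curveCoord p γ) t = fieldCoord p γ (velocity (E := E) γ) t := by
  have h := mfderiv_comp (I := 𝓘(ℝ, ℝ)) t
    ((contMDiffAt_chart hp).mdifferentiableAt (by simp)) (hγ.mdifferentiableAt (by simp))
  rw [← fderiv_apply_one_eq_deriv]
  rw [mfderiv_eq_fderiv] at h
  exact congrArg (fun L : ℝ →L[ℝ] E ↦ L 1) h

theorem contDiffAt_transition {p q y : X} (hp : y ∈ (extChartAt 𝓘(ℝ, E) p).source)
    (hq : y ∈ (extChartAt 𝓘(ℝ, E) q).source) :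
    ContDiffAt ℝ ∞ (extChartAt 𝓘(ℝ, E) q ∘ (extChartAt 𝓘(ℝ, E) p).symm)
      (extChartAt 𝓘(ℝ, E) p y) := by
  refine contMDiffAt_iff_contDiffAt.1 (ContMDiffAt.comp _ ?_
    (contMDiffAt_chartSymm ((extChartAt 𝓘(ℝ, E) p).map_source hp)))
  rw [(extChartAt 𝓘(ℝ, E) p).left_inv hp]
  exact contMDiffAt_chart hq

theorem fderiv_transition {p q y : X} (hp : y ∈ (extChartAt 𝓘(ℝ, E) p).source)
    (hq : y ∈ (extChartAt 𝓘(ℝ, E) q).source) (v : E) :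
    fderiv ℝ (extChartAt 𝓘(ℝ, E) q ∘ (extChartAt 𝓘(ℝ, E) p).symm) (extChartAt 𝓘(ℝ, E) p y) v =
      dChart q y (dChartSymm p (extChartAt 𝓘(ℝ, E) p y) v) := by
  have e := (extChartAt 𝓘(ℝ, E) p).left_inv hp
  have h := mfderiv_comp (I := 𝓘(ℝ, E)) (I' := 𝓘(ℝ, E)) (I'' := 𝓘(ℝ, E))
    (f := (extChartAt 𝓘(ℝ, E) p).symm) (g := extChartAt 𝓘(ℝ, E) q) (extChartAt 𝓘(ℝ, E) p y)
    ((contMDiffAt_chart (by rwa [e])).mdifferentiableAt (by simp))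
    ((contMDiffAt_chartSymm ((extChartAt 𝓘(ℝ, E) p).map_source hp)).mdifferentiableAt (by simp))
  rw [mfderiv_eq_fderiv] at h
  refine (congrArg (fun L : E →L[ℝ] E ↦ L v) h).trans ?_
  change dChart q ((extChartAt 𝓘(ℝ, E) p).symm (extChartAt 𝓘(ℝ, E) p y))
    (dChartSymm p (extChartAt 𝓘(ℝ, E) p y) v) = _
  rw [e]

variable [FiniteDimensional ℝ E]
  [IsContMDiffRiemannianBundle 𝓘(ℝ, E) ∞ E (fun x : X ↦ TangentSpace 𝓘(ℝ, E) x)]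

theorem metricForm_comm (p : X) (z v w : E) : metricForm p z v w = metricForm p z w v :=
  chartMetric_comm p z v w

theorem differentiableAt_metricForm {p : X} {z : E} (hz : z ∈ (extChartAt 𝓘(ℝ, E) p).target) :
    DifferentiableAt ℝ (metricForm p) z :=
  (contDiffAt_metricForm hz).differentiableAt (by simp)

theorem chartMetricDeriv_eq {p : X} {z : E} (hz : z ∈ (extChartAt 𝓘(ℝ, E) p).target) (u v w : E) :
    chartMetricDeriv p z u v w = fderiv ℝ (metricForm p) z u v w := by
  have h := ((differentiableAt_metricForm hz).hasFDerivAt.clm_apply (hasFDerivAt_const v z)).clm_apply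
    (hasFDerivAt_const w z)
  have h2 := congrArg (fun L : E →L[ℝ] ℝ ↦ L u) h.fderiv
  refine h2.trans ?_
  simp

theorem christoffel_eq {p : X} {z : E} (hz : z ∈ (extChartAt 𝓘(ℝ, E) p).target) (u v w : E) :
    christoffel p z u v w = lowerChristoffel (metricForm p) z u v w := by
  simp only [christoffel, lowerChristoffel, chartMetricDeriv_eq hz]

theorem metricForm_transition {p q y : X} (hp : y ∈ (extChartAt 𝓘(ℝ, E) p).source)
    (hq : y ∈ (extChartAt 𝓘(ℝ, E) q).source) (v w : E) :
    metricForm p (extChartAt 𝓘(ℝ, E) p y) v w = metricForm q (extChartAt 𝓘(ℝ, E) q y)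
      (fderiv ℝ (extChartAt 𝓘(ℝ, E) q ∘ (extChartAt 𝓘(ℝ, E) p).symm) (extChartAt 𝓘(ℝ, E) p y) v)
      (fderiv ℝ (extChartAt 𝓘(ℝ, E) q ∘ (extChartAt 𝓘(ℝ, E) p).symm) (extChartAt 𝓘(ℝ, E) p y) w) := by
  rw [fderiv_transition hp hq, fderiv_transition hp hq, metricForm_apply, metricForm_apply,
    chartMetric_dChart hq, chartMetric_eq, (extChartAt 𝓘(ℝ, E) p).left_inv hp]

/-- The inner product of two fields along `γ` in a chart. -/
theorem metricAt_eq_metricForm {γ : ℝ → X} {t : ℝ} {p : X}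
    (hp : γ t ∈ (extChartAt 𝓘(ℝ, E) p).source) (V W : ℝ → E) :
    metricAt (γ t) (V t) (W t) =
      metricForm p (curveCoord p γ t) (fieldCoord p γ V t) (fieldCoord p γ W t) :=
  (chartMetric_dChart hp _ _).symm

theorem curveCoord_mem_target {γ : ℝ → X} {t : ℝ} {p : X}
    (hp : γ t ∈ (extChartAt 𝓘(ℝ, E) p).source) :
    curveCoord p γ t ∈ (extChartAt 𝓘(ℝ, E) p).target :=
  (extChartAt 𝓘(ℝ, E) p).map_source hp

theorem hasDerivAt_metricAt_of_isParallelAt {γ : ℝ → X} {V W : ℝ → E} {t : ℝ}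
    (hγ : ContMDiffAt 𝓘(ℝ, ℝ) 𝓘(ℝ, E) ∞ γ t) (hV : IsParallelAt γ V t) (hW : IsParallelAt γ W t) :
    HasDerivAt (fun s ↦ metricAt (γ s) (V s) (W s)) 0 t := by
  have hp : γ t ∈ (extChartAt 𝓘(ℝ, E) (γ t)).source := mem_extChartAt_source _
  obtain ⟨hV1, hV2⟩ := hV _ hp
  obtain ⟨hW1, hW2⟩ := hW _ hp
  have ht := curveCoord_mem_target hp
  simp only [christoffel_eq ht] at hV2 hW2
  refine (hasDerivAt_form_of_parallel (metricForm_comm (γ t)) (differentiableAt_metricForm ht)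
    ((contDiffAt_curveCoord hγ hp).differentiableAt (by simp)).hasDerivAt hV1.hasDerivAt
    hW1.hasDerivAt hV2 hW2).congr_of_eventuallyEq ?_
  filter_upwards [eventually_mem_source hγ.continuousAt hp] with s hs
  exact metricAt_eq_metricForm hs V W

/-- A field that satisfies the equation of parallel fields in one chart satisfies it in all. -/
theorem isParallelAt_of_chart {γ : ℝ → X} {W : ℝ → E} {t : ℝ}
    (hγ : ContMDiffAt 𝓘(ℝ, ℝ) 𝓘(ℝ, E) ∞ γ t) {p : X} (hp : γ t ∈ (extChartAt 𝓘(ℝ, E) p).source)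
    {a : E} (hW : HasDerivAt (fieldCoord p γ W) a t)
    (heq : ∀ w, metricForm p (curveCoord p γ t) a w +
      lowerChristoffel (metricForm p) (curveCoord p γ t) (deriv (curveCoord p γ) t)
        (fieldCoord p γ W t) w = 0) :
    IsParallelAt γ W t := by
  intro q hq
  set F := extChartAt 𝓘(ℝ, E) q ∘ (extChartAt 𝓘(ℝ, E) p).symm with hF
  have hFs : ContDiffAt ℝ ∞ F (curveCoord p γ t) := contDiffAt_transition hp hq
  have hF2 : ContDiffAt ℝ 2 F (curveCoord p γ t) := hFs.of_le ENat.LEInfty.out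
  have hFd : HasFDerivAt F (fderiv ℝ F (curveCoord p γ t)) (curveCoord p γ t) :=
    (hF2.differentiableAt (by simp)).hasFDerivAt
  have hFd2 : HasFDerivAt (fderiv ℝ F) (fderiv ℝ (fderiv ℝ F) (curveCoord p γ t))
      (curveCoord p γ t) :=
    ((hF2.fderiv_right (m := 1) (by norm_num)).differentiableAt (by simp)).hasFDerivAt
  have hFp : F (curveCoord p γ t) = curveCoord q γ t := by
    simp only [hF, Function.comp, curveCoord, (extChartAt 𝓘(ℝ, E) p).left_inv hp]
  have hx : HasDerivAt (curveCoord p γ) (deriv (curveCoord p γ) t) t :=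
    ((contDiffAt_curveCoord hγ hp).differentiableAt (by simp)).hasDerivAt
  have hev : ∀ᶠ s in 𝓝 t, γ s ∈ (extChartAt 𝓘(ℝ, E) p).source ∧
      γ s ∈ (extChartAt 𝓘(ℝ, E) q).source :=
    (eventually_mem_source hγ.continuousAt hp).and (eventually_mem_source hγ.continuousAt hq)
  have hcurve : curveCoord q γ =ᶠ[𝓝 t] F ∘ curveCoord p γ := by
    filter_upwards [hev] with s hs
    simp only [hF, Function.comp, curveCoord, (extChartAt 𝓘(ℝ, E) p).left_inv hs.1]
  have hfield : fieldCoord q γ W =ᶠ[𝓝 t]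
      fun s ↦ fderiv ℝ F (curveCoord p γ s) (fieldCoord p γ W s) := by
    filter_upwards [hev] with s hs
    simp only [hF, curveCoord]
    rw [fderiv_transition hs.1 hs.2, fieldCoord_eq, fieldCoord_eq, dChartSymm_dChart hs.1]
  have hcd : deriv (curveCoord q γ) t =
      fderiv ℝ F (curveCoord p γ t) (deriv (curveCoord p γ) t) := by
    rw [hcurve.deriv_eq]
    exact (hFd.comp_hasDerivAt t hx).deriv
  have hfd : HasDerivAt (fieldCoord q γ W)
      (fderiv ℝ (fderiv ℝ F) (curveCoord p γ t) (deriv (curveCoord p γ) t) (fieldCoord p γ W t) +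
        fderiv ℝ F (curveCoord p γ t) a) t :=
    ((hFd2.comp_hasDerivAt t hx).clm_apply hW).congr_of_eventuallyEq hfield
  refine ⟨hfd.differentiableAt, fun w ↦ ?_⟩
  have htp := curveCoord_mem_target hp
  have htq := curveCoord_mem_target hq
  -- The derivative of the transition map is onto, so it suffices to test against its values.
  obtain ⟨w', rfl⟩ : ∃ w', w = fderiv ℝ F (curveCoord p γ t) w' := by
    refine ⟨dChart p (γ t) (dChartSymm q (curveCoord q γ t) w), ?_⟩
    simp only [hF, curveCoord]
    rw [fderiv_transition hp hq, dChartSymm_dChart hp, dChart_dChartSymm hq]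
  have hpull : ∀ᶠ z in 𝓝 (curveCoord p γ t), ∀ v w, metricForm p z v w =
      metricForm q (F z) (fderiv ℝ F z v) (fderiv ℝ F z w) := by
    have hc : ContinuousAt (extChartAt 𝓘(ℝ, E) p).symm (curveCoord p γ t) :=
      (contMDiffAt_chartSymm htp).continuousAt
    have hq' : (extChartAt 𝓘(ℝ, E) p).symm (curveCoord p γ t) ∈ (extChartAt 𝓘(ℝ, E) q).source := by
      simpa only [curveCoord, (extChartAt 𝓘(ℝ, E) p).left_inv hp] using hq
    filter_upwards [hc.eventually ((isOpen_source q).mem_nhds hq'),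
      (isOpen_target p).mem_nhds htp] with z hz hzt v w
    have := metricForm_transition ((extChartAt 𝓘(ℝ, E) p).map_target hzt) hz v w
    rwa [(extChartAt 𝓘(ℝ, E) p).right_inv hzt] at this
  -- The inhomogeneous term in the transformation law is exactly the second-derivative term that
  -- `hfd` produces, so the two cancel.
  have h1 := lowerChristoffel_pullback (differentiableAt_metricForm htp)
    (by rw [hFp]; exact differentiableAt_metricForm htq) (metricForm_comm q) hF2 hpull
    (deriv (curveCoord p γ) t) (fieldCoord p γ W t) w'
  have h2 := hpull.self_of_nhds a w'
  have h3 := heq w'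
  rw [hFp] at h1 h2
  rw [hfd.deriv, christoffel_eq htq, hcd, hfield.self_of_nhds, ← metricForm_apply, map_add,
    add_apply]
  linarith

end Parallel

/-! ### From local to global solutions on the real line, for an abstract local condition. -/

section Gluing

variable {E : Type*} {P : (ℝ → E) → ℝ → Prop}

/-- The endpoints `T` of solutions on `(-δ, T)` cannot have a finite supremum: near it a solution
can be restarted and continued by the uniform length `ε`. By uniqueness the solutions on growing
intervals then fit together. -/
theorem exists_right_of_local
    (hcongr : ∀ {V W : ℝ → E} {t : ℝ}, V =ᶠ[𝓝 t] W → P V t → P W t)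
    (huniq : ∀ {V W : ℝ → E} {a b t : ℝ}, t ∈ Ioo a b → (∀ s ∈ Ioo a b, P V s) →
      (∀ s ∈ Ioo a b, P W s) → V t = W t → EqOn V W (Ioo a b))
    (hloc : ∀ t₀ : ℝ, ∃ ε > 0, ∀ t, |t - t₀| < ε → ∀ η : E, ∃ W : ℝ → E, W t = η ∧
      ∀ s, |s - t| < ε → P W s) (η : E) :
    ∃ δ > 0, ∃ W : ℝ → E, W 0 = η ∧ ∀ t > -δ, P W t := by
  obtain ⟨δ, hδ, h0⟩ := hloc 0
  refine ⟨δ, hδ, ?_⟩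
  set S : Set ℝ := {T | 0 < T ∧ ∃ W : ℝ → E, W 0 = η ∧ ∀ t ∈ Ioo (-δ) T, P W t} with hS
  have hSne : δ ∈ S := by
    obtain ⟨W, hW0, hW⟩ := h0 0 (by simpa using hδ) η
    exact ⟨hδ, W, hW0, fun t ht ↦ hW t (by simpa [abs_lt] using ht)⟩
  have hunb : ¬ BddAbove S := by
    intro hb
    set T := sSup S
    obtain ⟨ε, hε, hT⟩ := hloc T
    have hTδ : δ ≤ T := le_csSup hb hSne
    -- The restarting time `t` will lie between this maximum and `T'`: it is within `ε` of `T`, so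
    -- the continuation passes `T`, and it is positive, so the value at `0` is kept.
    obtain ⟨T', hT'S, hT'⟩ := exists_lt_of_lt_csSup ⟨δ, hSne⟩
      (show max (T - ε) (T / 2) < sSup S from max_lt (by linarith) (by linarith))
    have hT'T : T' ≤ T := le_csSup hb hT'S
    obtain ⟨hT'0, W, hW0, hW⟩ := hT'S
    set t₁ := max (T - ε / 2) (T / 2)
    obtain ⟨t, ht1, ht2⟩ := exists_between hT'
    have htε : T - ε < t := (le_max_left _ _).trans_lt ht1
    have ht0 : 0 < t := by
      have := (le_max_right _ _).trans_lt ht1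
      linarith
    obtain ⟨V, hVt, hV⟩ := hT t (by rw [abs_lt]; constructor <;> linarith) (W t)
    have hVW : EqOn V W (Ioo (max (-δ) (t - ε)) (min T' (t + ε))) := by
      refine huniq (t := t) ⟨max_lt (by linarith) (by linarith), lt_min ht2 (by linarith)⟩
        (fun s hs ↦ hV s ?_) (fun s hs ↦ hW s ?_) hVt
      · rw [abs_lt]
        constructor <;> linarith [(le_max_right _ _).trans_lt hs.1, hs.2.trans_le (min_le_right _ _)]
      · exact ⟨(le_max_left _ _).trans_lt hs.1, hs.2.trans_le (min_le_left _ _)⟩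
    have : t + ε ∈ S := by
      refine ⟨by linarith, fun s ↦ if s < t then W s else V s, by simp [ht0, hW0], fun s hs ↦ ?_⟩
      rcases lt_trichotomy s t with h | h | h
      · refine hcongr ?_ (hW s ⟨hs.1, h.trans ht2⟩)
        filter_upwards [gt_mem_nhds h] with r hr
        simp [hr]
      · refine hcongr ?_ (hW s ⟨hs.1, h ▸ ht2⟩)
        have hmem : s ∈ Ioo (max (-δ) (t - ε)) (min T' (t + ε)) :=
          ⟨max_lt (by linarith) (by linarith), lt_min (by linarith) (by linarith)⟩
        filter_upwards [Ioo_mem_nhds hmem.1 hmem.2] with r hr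
        split_ifs
        · rfl
        · exact (hVW hr).symm
      · refine hcongr ?_ (hV s (by rw [abs_lt]; constructor <;> linarith [hs.2]))
        filter_upwards [lt_mem_nhds h] with r hr
        simp [hr.not_gt]
    linarith [le_csSup hb this]
  have hex (n : ℕ) : ∃ W : ℝ → E, W 0 = η ∧ ∀ t ∈ Ioo (-δ) ((n : ℝ) + 1), P W t := by
    rw [not_bddAbove_iff] at hunb
    obtain ⟨T, ⟨_, W, hW0, hW⟩, hT⟩ := hunb (n + 1)
    exact ⟨W, hW0, fun t ht ↦ hW t ⟨ht.1, ht.2.trans hT⟩⟩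
  choose W hW0 hW using hex
  have hagree (i j : ℕ) (s : ℝ) (h1 : -δ < s) (hi : s < i + 1) (hj : s < j + 1) :
      W i s = W j s := by
    refine huniq (V := W i) (W := W j) (a := -δ) (b := min ((i : ℝ) + 1) (j + 1)) (t := 0)
      ⟨by linarith, by positivity⟩
      (fun r hr ↦ hW i r ⟨hr.1, hr.2.trans_le (min_le_left _ _)⟩)
      (fun r hr ↦ hW j r ⟨hr.1, hr.2.trans_le (min_le_right _ _)⟩) (by rw [hW0, hW0])
      ⟨h1, lt_min hi hj⟩
  -- The solution with index `⌈t⌉₊` lives up to `⌈t⌉₊ + 1`, hence on a neighbourhood of `t`, where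
  -- by `hagree` it coincides with the diagonal choice.
  refine ⟨fun t ↦ W ⌈t⌉₊ t, hW0 _, fun t ht ↦ ?_⟩
  have hb : t < (⌈t⌉₊ : ℝ) + 1 := (Nat.le_ceil t).trans_lt (by linarith)
  refine hcongr ?_ (hW ⌈t⌉₊ t ⟨ht, hb⟩)
  filter_upwards [Ioo_mem_nhds ht hb] with s hs
  exact hagree _ _ s hs.1 hs.2 ((Nat.le_ceil s).trans_lt (by linarith))

/-- Local solvability and uniqueness give a solution on the whole line. -/
theorem exists_global_of_local
    (hcongr : ∀ {V W : ℝ → E} {t : ℝ}, V =ᶠ[𝓝 t] W → P V t → P W t)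
    (huniq : ∀ {V W : ℝ → E} {a b t : ℝ}, t ∈ Ioo a b → (∀ s ∈ Ioo a b, P V s) →
      (∀ s ∈ Ioo a b, P W s) → V t = W t → EqOn V W (Ioo a b))
    (hloc : ∀ t₀ : ℝ, ∃ ε > 0, ∀ t, |t - t₀| < ε → ∀ η : E, ∃ W : ℝ → E, W t = η ∧
      ∀ s, |s - t| < ε → P W s) (η : E) :
    ∃ W : ℝ → E, W 0 = η ∧ ∀ t, P W t := by
  obtain ⟨δ, hδ, V, hV0, hV⟩ := exists_right_of_local hcongr huniq hloc η
  have hneg {V W : ℝ → E} {t : ℝ} (h : V =ᶠ[𝓝 t] W) :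
      (fun s ↦ V (-s)) =ᶠ[𝓝 (-t)] fun s ↦ W (-s) := by
    have : Tendsto (fun s : ℝ ↦ -s) (𝓝 (-t)) (𝓝 t) := by
      simpa using (continuous_neg (G := ℝ)).tendsto (-t)
    exact this.eventually h
  -- Negative times are reached by solving the time-reversed condition to the right.
  obtain ⟨δ', hδ', U, hU0, hU⟩ := exists_right_of_local
    (P := fun W t ↦ P (fun s ↦ W (-s)) (-t)) (fun h hP ↦ hcongr (hneg h) hP)
    (fun {V W a b t} ht hV hW h s hs ↦ by
      have := huniq (V := fun s ↦ V (-s)) (W := fun s ↦ W (-s)) (a := -b) (b := -a) (t := -t)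
        ⟨by linarith [ht.2], by linarith [ht.1]⟩
        (fun r hr ↦ by simpa using hV (-r) ⟨by linarith [hr.2], by linarith [hr.1]⟩)
        (fun r hr ↦ by simpa using hW (-r) ⟨by linarith [hr.2], by linarith [hr.1]⟩)
        (by simpa using h) (x := -s) ⟨by linarith [hs.2], by linarith [hs.1]⟩
      simpa using this)
    (fun t₀ ↦ by
      obtain ⟨ε, hε, h⟩ := hloc (-t₀)
      refine ⟨ε, hε, fun t ht η ↦ ?_⟩
      obtain ⟨W, hW, hP⟩ := h (-t) (by rw [← abs_neg]; convert ht using 2; ring) η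
      refine ⟨fun s ↦ W (-s), hW, fun s hs ↦ ?_⟩
      simp only [neg_neg]
      exact hP (-s) (by rw [← abs_neg]; convert hs using 2; ring)) η
  refine ⟨fun t ↦ if t < 0 then U (-t) else V t, by simp [hV0], fun t ↦ ?_⟩
  rcases lt_trichotomy t 0 with h | h | h
  · have := hU (-t) (by linarith)
    rw [neg_neg] at this
    refine hcongr ?_ this
    filter_upwards [gt_mem_nhds h] with r hr
    simp [hr]
  · subst h
    refine hcongr ?_ (hV 0 (by linarith))
    have := huniq (V := V) (W := fun s ↦ U (-s)) (a := -δ) (b := δ') (t := 0) ⟨by linarith, hδ'⟩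
      (fun s hs ↦ hV s hs.1) (fun s hs ↦ by simpa using hU (-s) (by linarith [hs.2]))
      (by simp [hV0, hU0])
    filter_upwards [Ioo_mem_nhds (neg_lt_zero.2 hδ) hδ'] with r hr
    split_ifs
    · exact this hr
    · rfl
  · refine hcongr ?_ (hV t (by linarith))
    filter_upwards [lt_mem_nhds h] with r hr
    simp [hr.not_gt]

end Gluing

/-! ### Raising the index: the equation of parallel fields in explicit form. -/

section Spray

variable {E : Type*} [NormedAddCommGroup E] [NormedSpace ℝ E]

local instance : NormedAddCommGroup (E →L[ℝ] ℝ) := ContinuousLinearMap.toNormedAddCommGroup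
local instance : NormedSpace ℝ (E →L[ℝ] ℝ) := ContinuousLinearMap.toNormedSpace
local instance : NormedAddCommGroup (E →L[ℝ] E →L[ℝ] ℝ) :=
  ContinuousLinearMap.toNormedAddCommGroup
local instance : NormedSpace ℝ (E →L[ℝ] E →L[ℝ] ℝ) := ContinuousLinearMap.toNormedSpace
local instance : NormedAddCommGroup (E →L[ℝ] E →L[ℝ] E →L[ℝ] ℝ) :=
  ContinuousLinearMap.toNormedAddCommGroup
local instance : NormedSpace ℝ (E →L[ℝ] E →L[ℝ] E →L[ℝ] ℝ) := ContinuousLinearMap.toNormedSpace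

/-- The Christoffel symbols of the first kind, as linear forms in the last argument. -/
def christoffelForm (G : E → E →L[ℝ] E →L[ℝ] ℝ) (z u v : E) : E →L[ℝ] ℝ :=
  (2⁻¹ : ℝ) • (fderiv ℝ G z u v + fderiv ℝ G z v u -
    ContinuousLinearMap.flip (ContinuousLinearMap.flip (fderiv ℝ G z) u) v)

theorem christoffelForm_apply (G : E → E →L[ℝ] E →L[ℝ] ℝ) (z u v w : E) :
    christoffelForm G z u v w = lowerChristoffel G z u v w := by
  simp only [christoffelForm, lowerChristoffel, smul_apply, add_apply, sub_apply,
    ContinuousLinearMap.flip_apply, smul_eq_mul]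
  ring

/-- The Christoffel symbols of the second kind, with the sign of the equation of parallel
fields. -/
def spray (G : E → E →L[ℝ] E →L[ℝ] ℝ) (z u v : E) : E :=
  -(ContinuousLinearMap.inverse (G z) (christoffelForm G z u v))

theorem spray_add (G : E → E →L[ℝ] E →L[ℝ] ℝ) (z u v w : E) :
    spray G z u (v + w) = spray G z u v + spray G z u w := by
  have : christoffelForm G z u (v + w) = christoffelForm G z u v + christoffelForm G z u w := by
    ext y
    simp only [christoffelForm_apply, add_apply, lowerChristoffel, map_add]
    ring
  simp only [spray, this, map_add, neg_add]

theorem spray_smul (G : E → E →L[ℝ] E →L[ℝ] ℝ) (z u v : E) (c : ℝ) :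
    spray G z u (c • v) = c • spray G z u v := by
  have : christoffelForm G z u (c • v) = c • christoffelForm G z u v := by
    ext y
    simp only [christoffelForm_apply, smul_apply, lowerChristoffel, map_smul, smul_eq_mul]
    ring
  simp only [spray, this, map_smul, smul_neg]

theorem spray_smul_left (G : E → E →L[ℝ] E →L[ℝ] ℝ) (z u v : E) (c : ℝ) :
    spray G z (c • u) v = c • spray G z u v := by
  have : christoffelForm G z (c • u) v = c • christoffelForm G z u v := by
    ext y
    simp only [christoffelForm_apply, smul_apply, lowerChristoffel, map_smul, smul_eq_mul]
    ring
  simp only [spray, this, map_smul, smul_neg]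

theorem contDiffAt_christoffelForm {V : Type*} [NormedAddCommGroup V] [NormedSpace ℝ V]
    {G : E → E →L[ℝ] E →L[ℝ] ℝ} {x a b : V → E} {y : V} {n : ℕ}
    (hG : ContDiffAt ℝ (n + 1) G (x y)) (hx : ContDiffAt ℝ n x y) (ha : ContDiffAt ℝ n a y)
    (hb : ContDiffAt ℝ n b y) :
    ContDiffAt ℝ n (fun s ↦ christoffelForm G (x s) (a s) (b s)) y := by
  have hD : ContDiffAt ℝ n (fun s ↦ fderiv ℝ G (x s)) y :=
    (hG.fderiv_right (m := n) (by norm_cast)).comp y hx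
  have hf1 : ContDiffAt ℝ n (fun s ↦ ContinuousLinearMap.flip (fderiv ℝ G (x s))) y :=
    (ContinuousLinearMap.flipₗᵢ ℝ E E (E →L[ℝ] ℝ)).contDiff.contDiffAt.comp y hD
  have hf2 : ContDiffAt ℝ n (fun s ↦ ContinuousLinearMap.flip
      (ContinuousLinearMap.flip (fderiv ℝ G (x s)) (a s))) y :=
    (ContinuousLinearMap.flipₗᵢ ℝ E E ℝ).contDiff.contDiffAt.comp y (hf1.clm_apply ha)
  exact (((hD.clm_apply ha).clm_apply hb).add ((hD.clm_apply hb).clm_apply ha)).sub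
    (hf2.clm_apply hb) |>.const_smul _

variable [FiniteDimensional ℝ E]

/-- Definiteness makes `B` injective as a map to the dual, which has the same finite dimension. -/
theorem isInvertible_of_definite {B : E →L[ℝ] E →L[ℝ] ℝ} (hB : ∀ v, B v v = 0 → v = 0) :
    B.IsInvertible := by
  have hinj : Function.Injective (B : E →ₗ[ℝ] E →L[ℝ] ℝ) := by
    rw [← LinearMap.ker_eq_bot, LinearMap.ker_eq_bot']
    intro v hv
    refine hB v ?_
    have := congrArg (fun L : E →L[ℝ] ℝ ↦ L v) hv
    simpa using this
  have hdim : Module.finrank ℝ E = Module.finrank ℝ (E →L[ℝ] ℝ) := by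
    rw [← LinearEquiv.finrank_eq (LinearMap.toContinuousLinearMap (𝕜 := ℝ) (E := E) (F' := ℝ))]
    exact (Subspace.dual_finrank_eq (K := ℝ) (V := E)).symm
  have : FiniteDimensional ℝ (E →L[ℝ] ℝ) :=
    Module.Finite.equiv (LinearMap.toContinuousLinearMap (𝕜 := ℝ) (E := E) (F' := ℝ))
  exact ⟨(LinearEquiv.ofInjectiveOfFinrankEq (B : E →ₗ[ℝ] E →L[ℝ] ℝ) hinj
    hdim).toContinuousLinearEquiv, by ext; rfl⟩

/-- Inversion of linear maps is smooth at an invertible one; a single derivative of `G` is lost in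
the Christoffel symbols. This regularity feeds the existence and uniqueness theorems for
differential equations. -/
theorem contDiffAt_spray {V : Type*} [NormedAddCommGroup V] [NormedSpace ℝ V]
    {G : E → E →L[ℝ] E →L[ℝ] ℝ} {x a b : V → E} {y : V} {n : ℕ}
    (hG : ContDiffAt ℝ (n + 1) G (x y)) (hB : ∀ v, G (x y) v v = 0 → v = 0)
    (hx : ContDiffAt ℝ n x y) (ha : ContDiffAt ℝ n a y) (hb : ContDiffAt ℝ n b y) :
    ContDiffAt ℝ n (fun s ↦ spray G (x s) (a s) (b s)) y := by
  have : CompleteSpace E := FiniteDimensional.complete ℝ E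
  obtain ⟨e, he⟩ := isInvertible_of_definite hB
  have h1 : ContDiffAt ℝ n (ContinuousLinearMap.inverse : (E →L[ℝ] E →L[ℝ] ℝ) → _) (G (x y)) := by
    rw [← he]; exact contDiffAt_map_inverse e
  have hG' : ContDiffAt ℝ n (fun s ↦ G (x s)) y :=
    (hG.of_le (by norm_cast; omega)).comp y hx
  exact ((h1.comp y hG').clm_apply (contDiffAt_christoffelForm hG hx ha hb)).neg

theorem form_spray {G : E → E →L[ℝ] E →L[ℝ] ℝ} {z : E} (hB : ∀ v, G z v v = 0 → v = 0)
    (u v w : E) : G z (spray G z u v) w + lowerChristoffel G z u v w = 0 := by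
  rw [spray, map_neg, (isInvertible_of_definite hB).self_apply_inverse, neg_apply, christoffelForm_apply]
  ring

/-- The difference of two solutions is orthogonal to every vector, in particular to itself. -/
theorem eq_spray {G : E → E →L[ℝ] E →L[ℝ] ℝ} {z : E} (hB : ∀ v, G z v v = 0 → v = 0)
    {u v a : E} (h : ∀ w, G z a w + lowerChristoffel G z u v w = 0) : a = spray G z u v := by
  rw [← sub_eq_zero]
  refine hB _ ?_
  have h1 := h (a - spray G z u v)
  have h2 := form_spray hB u v (a - spray G z u v)
  have h3 : G z (a - spray G z u v) = G z a - G z (spray G z u v) := map_sub _ _ _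
  rw [h3, sub_apply]
  linarith

end Spray

/-! ### Existence and uniqueness of parallel fields. -/

section ParallelExistence

variable {E : Type*} [NormedAddCommGroup E] [NormedSpace ℝ E]
  {X : Type*} [TopologicalSpace X] [ChartedSpace E X] [IsManifold 𝓘(ℝ, E) ∞ X]
  [RiemannianBundle (fun x : X ↦ TangentSpace 𝓘(ℝ, E) x)]
  [FiniteDimensional ℝ E]
  [IsContMDiffRiemannianBundle 𝓘(ℝ, E) ∞ E (fun x : X ↦ TangentSpace 𝓘(ℝ, E) x)]

theorem metricForm_definite {p : X} {z : E} (hz : z ∈ (extChartAt 𝓘(ℝ, E) p).target) (v : E)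
    (h : metricForm p z v v = 0) : v = 0 :=
  (chartMetric_self_eq_zero hz).1 h

theorem IsParallelAt.hasDerivAt {γ : ℝ → X} {W : ℝ → E} {t : ℝ} (h : IsParallelAt γ W t) {p : X}
    (hp : γ t ∈ (extChartAt 𝓘(ℝ, E) p).source) :
    HasDerivAt (fieldCoord p γ W) (spray (metricForm p) (curveCoord p γ t)
      (deriv (curveCoord p γ) t) (fieldCoord p γ W t)) t := by
  obtain ⟨h1, h2⟩ := h p hp
  have ht := curveCoord_mem_target (E := E) hp
  simp only [christoffel_eq ht] at h2
  convert h1.hasDerivAt using 1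
  exact (eq_spray (metricForm_definite ht) h2).symm

theorem isParallelAt_of_hasDerivAt {γ : ℝ → X} {W : ℝ → E} {t : ℝ}
    (hγ : ContMDiffAt 𝓘(ℝ, ℝ) 𝓘(ℝ, E) ∞ γ t) {p : X} (hp : γ t ∈ (extChartAt 𝓘(ℝ, E) p).source)
    (h : HasDerivAt (fieldCoord p γ W) (spray (metricForm p) (curveCoord p γ t)
      (deriv (curveCoord p γ) t) (fieldCoord p γ W t)) t) : IsParallelAt γ W t :=
  isParallelAt_of_chart hγ hp h (form_spray (metricForm_definite (curveCoord_mem_target hp)) _ _)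

theorem IsParallelAt.add {γ : ℝ → X} {V W : ℝ → E} {t : ℝ}
    (hγ : ContMDiffAt 𝓘(ℝ, ℝ) 𝓘(ℝ, E) ∞ γ t)
    (hV : IsParallelAt γ V t) (hW : IsParallelAt γ W t) :
    IsParallelAt γ (fun s ↦ V s + W s) t := by
  have hp : γ t ∈ (extChartAt 𝓘(ℝ, E) (γ t)).source := mem_extChartAt_source _
  have e (s : ℝ) : fieldCoord (γ t) γ (fun s ↦ V s + W s) s =
    fieldCoord (γ t) γ V s + fieldCoord (γ t) γ W s := map_add (dChart (γ t) (γ s)) _ _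
  refine isParallelAt_of_hasDerivAt hγ hp ?_
  rw [e, spray_add]
  exact ((hV.hasDerivAt hp).add (hW.hasDerivAt hp)).congr_of_eventuallyEq (.of_forall e)

theorem IsParallelAt.smul {γ : ℝ → X} {V : ℝ → E} {t : ℝ}
    (hγ : ContMDiffAt 𝓘(ℝ, ℝ) 𝓘(ℝ, E) ∞ γ t) (hV : IsParallelAt γ V t) (c : ℝ) :
    IsParallelAt γ (fun s ↦ c • V s) t := by
  have hp : γ t ∈ (extChartAt 𝓘(ℝ, E) (γ t)).source := mem_extChartAt_source _
  have e (s : ℝ) : fieldCoord (γ t) γ (fun s ↦ c • V s) s =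
    c • fieldCoord (γ t) γ V s := map_smul (dChart (γ t) (γ s)) _ _
  refine isParallelAt_of_hasDerivAt hγ hp ?_
  rw [e, spray_smul]
  exact ((hV.hasDerivAt hp).const_smul c).congr_of_eventuallyEq (.of_forall e)

theorem IsParallelAt.congr {γ : ℝ → X} {V W : ℝ → E} {t : ℝ}
    (h : V =ᶠ[𝓝 t] W) (hV : IsParallelAt γ V t) : IsParallelAt γ W t := by
  intro p hp
  have e : fieldCoord p γ V =ᶠ[𝓝 t] fieldCoord p γ W := by
    filter_upwards [h] with s hs
    rw [fieldCoord_eq, fieldCoord_eq, hs]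
  obtain ⟨h1, h2⟩ := hV p hp
  refine ⟨h1.congr_of_eventuallyEq e.symm, ?_⟩
  rwa [e.deriv_eq, e.self_of_nhds] at h2

/-- The inner product of two parallel fields is constant. -/
theorem metricAt_eq_of_isParallelAt {γ : ℝ → X} (hγ : ContMDiff 𝓘(ℝ, ℝ) 𝓘(ℝ, E) ∞ γ)
    {V W : ℝ → E} {a b s t : ℝ} (hs : s ∈ Ioo a b) (ht : t ∈ Ioo a b)
    (hV : ∀ r ∈ Ioo a b, IsParallelAt γ V r) (hW : ∀ r ∈ Ioo a b, IsParallelAt γ W r) :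
    metricAt (γ s) (V s) (W s) = metricAt (γ t) (V t) (W t) := by
  have := (convex_Ioo a b).norm_image_sub_le_of_norm_hasDerivWithin_le (C := 0)
    (f := fun r ↦ metricAt (γ r) (V r) (W r)) (f' := fun _ ↦ 0) (fun r hr ↦
      (hasDerivAt_metricAt_of_isParallelAt (hγ r) (hV r hr) (hW r hr)).hasDerivWithinAt)
    (by simp) ht hs
  rw [zero_mul, norm_le_zero_iff, sub_eq_zero] at this
  exact this

/-- The difference is parallel, so its length is constant, and it vanishes at `t`. No uniqueness
theorem for differential equations is needed. -/
theorem eqOn_of_isParallelAt {γ : ℝ → X} (hγ : ContMDiff 𝓘(ℝ, ℝ) 𝓘(ℝ, E) ∞ γ)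
    {V W : ℝ → E} {a b t : ℝ} (ht : t ∈ Ioo a b)
    (hV : ∀ r ∈ Ioo a b, IsParallelAt γ V r) (hW : ∀ r ∈ Ioo a b, IsParallelAt γ W r)
    (h : V t = W t) : EqOn V W (Ioo a b) := by
  intro s hs
  have hD (r : ℝ) (hr : r ∈ Ioo a b) : IsParallelAt γ (fun s ↦ V s + (-1 : ℝ) • W s) r :=
    (hV r hr).add (hγ r) ((hW r hr).smul (hγ r) (-1))
  have := metricAt_eq_of_isParallelAt hγ hs ht hD hD
  rw [h, neg_one_smul, neg_one_smul, add_neg_cancel, metricAt_self_eq_zero.2 rfl,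
    metricAt_self_eq_zero, ← sub_eq_add_neg, sub_eq_zero] at this
  exact this

/-- Local existence of parallel fields, uniform in the initial data. -/
theorem exists_isParallelAt_local {γ : ℝ → X} (hγ : ContMDiff 𝓘(ℝ, ℝ) 𝓘(ℝ, E) ∞ γ) (t₀ : ℝ) :
    ∃ ε > 0, ∀ t, |t - t₀| < ε → ∀ η : E, ∃ W : ℝ → E, W t = η ∧
      ∀ s, |s - t| < ε → IsParallelAt γ W s := by
  have : CompleteSpace E := FiniteDimensional.complete ℝ E
  set p := γ t₀
  have hp : γ t₀ ∈ (extChartAt 𝓘(ℝ, E) p).source := mem_extChartAt_source _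
  have hx : ContDiffAt ℝ ∞ (curveCoord (E := E) p γ) t₀ := contDiffAt_curveCoord (hγ t₀) hp
  have hx' : ContDiffAt ℝ ((1 : ℕ) : WithTop ℕ∞) (deriv (curveCoord (E := E) p γ)) t₀ := by
    have := hx.fderiv_right (m := ((1 : ℕ) : WithTop ℕ∞)) (by norm_cast)
    exact this.clm_apply contDiffAt_const
  have htar := curveCoord_mem_target (E := E) hp
  -- Time is added as a coordinate of speed `1`, which makes the equation autonomous.
  let f : ℝ × E → ℝ × E := fun q ↦ (1, spray (metricForm p) (curveCoord p γ q.1)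
    (deriv (curveCoord p γ) q.1) q.2)
  have hf : ContDiffAt ℝ 1 f (t₀, 0) := by
    refine contDiffAt_const.prodMk ?_
    refine contDiffAt_spray (n := 1) (y := ((t₀, 0) : ℝ × E))
      ((contDiffAt_metricForm htar).of_le (by norm_cast))
      (metricForm_definite htar) ?_ ?_ contDiffAt_snd
    · exact ContDiffAt.comp (g := curveCoord (E := E) p γ) ((t₀, 0) : ℝ × E) (hx.of_le (by norm_cast))
        contDiffAt_fst
    · exact ContDiffAt.comp (g := deriv (curveCoord (E := E) p γ)) ((t₀, 0) : ℝ × E) hx'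
        contDiffAt_fst
  obtain ⟨r, hr, ε₁, hε₁, hsol⟩ :=
    hf.exists_forall_mem_closedBall_exists_eq_forall_mem_Ioo_hasDerivAt t₀
  obtain ⟨ε₂, hε₂, hsrc⟩ := Metric.eventually_nhds_iff.1
    (eventually_mem_source (hγ t₀).continuousAt hp)
  -- `ε₁` is the lifetime of the solutions, `ε₂ / 2` keeps `s` in the chart when `s` is near `t` and
  -- `t` near `t₀`, and `r` keeps the initial time in the ball of admissible initial data.
  refine ⟨min (min ε₁ (ε₂ / 2)) r, by positivity, fun t ht η ↦ ?_⟩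
  obtain ⟨ht12, htr⟩ := lt_min_iff.1 ht
  obtain ⟨ht1, ht2⟩ := lt_min_iff.1 ht12
  set ξ : E := dChart p (γ t) η
  -- The equation is linear in the field, so a large initial value is shrunk into the ball and the
  -- solution is multiplied by `c⁻¹` at the end. This makes the lifetime independent of `η`.
  obtain ⟨c, hc, hcη⟩ : ∃ c : ℝ, 0 < c ∧ ‖c • ξ‖ ≤ r := by
    refine ⟨r / (‖ξ‖ + 1), by positivity, ?_⟩
    rw [norm_smul, Real.norm_of_nonneg (by positivity), div_mul_eq_mul_div, div_le_iff₀ (by positivity)]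
    nlinarith [norm_nonneg ξ]
  obtain ⟨α, hα0, hα⟩ := hsol (t, c • ξ) (by
    rw [mem_closedBall_iff_norm, Prod.mk_sub_mk, sub_zero, Prod.norm_mk]
    exact max_le htr.le hcη)
  -- The parameter of `α` starts at `t₀` but its time coordinate starts at `t`; the shift in `β`
  -- realigns them.
  have htime (s : ℝ) (hs : s ∈ Ioo (t₀ - ε₁) (t₀ + ε₁)) : (α s).1 = t + (s - t₀) := by
    have h1 (s : ℝ) (hs : s ∈ Ioo (t₀ - ε₁) (t₀ + ε₁)) :
        HasDerivAt (fun s ↦ (α s).1 - s) 0 s := by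
      have := ((ContinuousLinearMap.fst ℝ ℝ E).hasFDerivAt.comp_hasDerivAt s (hα s hs)).sub
        (hasDerivAt_id s)
      exact this.congr_deriv (sub_self (1 : ℝ))
    have := (convex_Ioo (t₀ - ε₁) (t₀ + ε₁)).norm_image_sub_le_of_norm_hasDerivWithin_le (C := 0)
      (fun r hr ↦ (h1 r hr).hasDerivWithinAt) (by simp)
      (show t₀ ∈ Ioo (t₀ - ε₁) (t₀ + ε₁) from ⟨by linarith, by linarith⟩) hs
    rw [zero_mul, norm_le_zero_iff, hα0] at this
    simp only at this
    linarith
  set β : ℝ → E := fun s ↦ (α (t₀ + (s - t))).2 with hβ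
  have hβd (s : ℝ) (hs : |s - t| < ε₁) : HasDerivAt β (spray (metricForm p) (curveCoord p γ s)
      (deriv (curveCoord p γ) s) (β s)) s := by
    rw [abs_lt] at hs
    have hmem : t₀ + (s - t) ∈ Ioo (t₀ - ε₁) (t₀ + ε₁) := ⟨by linarith, by linarith⟩
    have h1 : HasDerivAt (fun s ↦ (α s).2) (f (α (t₀ + (s - t)))).2 (t₀ + (s - t)) :=
      (ContinuousLinearMap.snd ℝ ℝ E).hasFDerivAt.comp_hasDerivAt _ (hα _ hmem)
    have h2 : HasDerivAt (fun s : ℝ ↦ t₀ + (s - t)) 1 s :=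
      ((hasDerivAt_id s).sub_const t).const_add t₀
    have h3 := h1.scomp s h2
    have h4 : t + (t₀ + (s - t) - t₀) = s := by ring
    simp only [f, htime _ hmem, h4, one_smul] at h3
    exact h3
  refine ⟨fun s ↦ c⁻¹ • dChartSymm p (curveCoord p γ s) (β s), ?_, fun s hs ↦ ?_⟩
  · have ht : γ t ∈ (extChartAt 𝓘(ℝ, E) p).source :=
      hsrc (by rw [Real.dist_eq]; linarith)
    simp only [hβ, sub_self, add_zero, hα0, map_smul, smul_smul, inv_mul_cancel₀ hc.ne', one_smul]
    exact dChartSymm_dChart ht η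
  · obtain ⟨hs12, hsr⟩ := lt_min_iff.1 hs
    obtain ⟨hs1, hs2⟩ := lt_min_iff.1 hs12
    have hs0 : dist s t₀ < ε₂ := by
      rw [Real.dist_eq]
      calc |s - t₀| ≤ |s - t| + |t - t₀| := abs_sub_le _ _ _
        _ < ε₂ := by linarith
    have hfield : fieldCoord p γ (fun s ↦ c⁻¹ • dChartSymm p (curveCoord p γ s) (β s)) =ᶠ[𝓝 s]
        fun s ↦ c⁻¹ • β s := by
      filter_upwards [Metric.isOpen_ball.mem_nhds (Metric.mem_ball.2 hs0)] with q hq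
      rw [fieldCoord_eq, map_smul]
      simp only [curveCoord]
      rw [dChart_dChartSymm (hsrc hq)]
    refine isParallelAt_of_hasDerivAt (hγ s) (hsrc hs0) ?_
    rw [hfield.self_of_nhds, spray_smul]
    exact ((hβd s hs1).const_smul c⁻¹).congr_of_eventuallyEq hfield

/-- Parallel fields with arbitrary initial value exist along every smooth curve. -/
theorem exists_isParallelAlong {γ : ℝ → X} (hγ : ContMDiff 𝓘(ℝ, ℝ) 𝓘(ℝ, E) ∞ γ) (η : E) :
    ∃ W : ℝ → E, W 0 = η ∧ ∀ t, IsParallelAt γ W t :=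
  exists_global_of_local (P := IsParallelAt γ) IsParallelAt.congr
    (fun ht hV hW h ↦ eqOn_of_isParallelAt hγ ht hV hW h) (exists_isParallelAt_local hγ) η

end ParallelExistence

/-! ### Uniqueness and homogeneity of geodesics; parallel transport is an isometry. -/

section Geodesics

variable {E : Type*} [NormedAddCommGroup E] [NormedSpace ℝ E]
  {X : Type*} [TopologicalSpace X] [ChartedSpace E X] [IsManifold 𝓘(ℝ, E) ∞ X]
  [RiemannianBundle (fun x : X ↦ TangentSpace 𝓘(ℝ, E) x)]
  [FiniteDimensional ℝ E]
  [IsContMDiffRiemannianBundle 𝓘(ℝ, E) ∞ E (fun x : X ↦ TangentSpace 𝓘(ℝ, E) x)]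

theorem metricAt_self (y : X) (v : TangentSpace 𝓘(ℝ, E) y) :
    metricAt (E := E) y v v = ‖v‖ ^ 2 :=
  real_inner_self_eq_norm_sq v

/-- The velocity of a curve, as a map to the model space. -/
def vel (E : Type*) [NormedAddCommGroup E] [NormedSpace ℝ E] [ChartedSpace E X]
    (γ : ℝ → X) (t : ℝ) : E :=
  mfderiv 𝓘(ℝ, ℝ) 𝓘(ℝ, E) γ t (1 : ℝ)

theorem mk_eq_mk_iff {x y : X} {v w : E} :
    (⟨x, v⟩ : TangentBundle 𝓘(ℝ, E) X) = ⟨y, w⟩ ↔ x = y ∧ v = w := by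
  constructor
  · intro h
    exact ⟨congrArg (fun q : TangentBundle 𝓘(ℝ, E) X ↦ q.proj) h,
      congrArg (fun q : TangentBundle 𝓘(ℝ, E) X ↦ (q.snd : E)) h⟩
  · rintro ⟨rfl, rfl⟩
    rfl

theorem isGeodesicFrom_iff {x : X} {ξ : E} {γ : ℝ → X} :
    IsGeodesicFrom x ξ γ ↔ IsGeodesic E γ ∧ γ 0 = x ∧ vel E γ 0 = ξ :=
  and_congr_right fun _ ↦ mk_eq_mk_iff

theorem IsGeodesic.isParallelAt {γ : ℝ → X} (h : IsGeodesic E γ) (t : ℝ) :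
    IsParallelAt γ (vel E γ) t := h.2 t

theorem eventually_deriv_curveCoord {γ : ℝ → X} (hγ : ContMDiff 𝓘(ℝ, ℝ) 𝓘(ℝ, E) ∞ γ) {t : ℝ} {p : X}
    (hp : γ t ∈ (extChartAt 𝓘(ℝ, E) p).source) :
    deriv (curveCoord p γ) =ᶠ[𝓝 t] fieldCoord p γ (vel E γ) := by
  filter_upwards [eventually_mem_source (hγ t).continuousAt hp] with s hs
  exact deriv_curveCoord (hγ s) hs

/-- The geodesic equation, as a first-order system. -/
theorem IsGeodesic.hasDerivAt {γ : ℝ → X} (h : IsGeodesic E γ) {t : ℝ} {p : X}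
    (hp : γ t ∈ (extChartAt 𝓘(ℝ, E) p).source) :
    HasDerivAt (fun s ↦ (curveCoord (E := E) p γ s, deriv (curveCoord (E := E) p γ) s))
      (deriv (curveCoord p γ) t, spray (metricForm p) (curveCoord p γ t)
        (deriv (curveCoord p γ) t) (deriv (curveCoord p γ) t)) t := by
  have h1 : HasDerivAt (curveCoord p γ) (deriv (curveCoord (E := E) p γ) t) t :=
    ((contDiffAt_curveCoord (h.1 t) hp).differentiableAt (by simp)).hasDerivAt
  have h2 := (h.isParallelAt t).hasDerivAt hp
  have e := eventually_deriv_curveCoord h.1 hp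
  rw [← e.self_of_nhds] at h2
  exact h1.prodMk (h2.congr_of_eventuallyEq e)

/-- In the chart both curves, paired with their velocities, solve the same first-order system with a
locally Lipschitz right-hand side. -/
theorem IsGeodesic.eventuallyEq {γ₁ γ₂ : ℝ → X} (h₁ : IsGeodesic E γ₁) (h₂ : IsGeodesic E γ₂) {t : ℝ}
    (h : γ₁ t = γ₂ t)
    (h' : deriv (curveCoord (E := E) (γ₁ t) γ₁) t = deriv (curveCoord (E := E) (γ₁ t) γ₂) t) :
    γ₁ =ᶠ[𝓝 t] γ₂ := by
  set p := γ₁ t with hpdef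
  have hp : γ₁ t ∈ (extChartAt 𝓘(ℝ, E) p).source := mem_extChartAt_source _
  have hp2 : γ₂ t ∈ (extChartAt 𝓘(ℝ, E) p).source := by rw [← h]; exact hp
  let f : E × E → E × E := fun q ↦ (q.2, spray (metricForm p) q.1 q.2 q.2)
  have htar := curveCoord_mem_target (E := E) hp
  have hf : ContDiffAt ℝ 1 f (curveCoord p γ₁ t, deriv (curveCoord p γ₁) t) :=
    contDiffAt_snd.prodMk (contDiffAt_spray (n := 1)
      (y := (curveCoord (E := E) p γ₁ t, deriv (curveCoord (E := E) p γ₁) t))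
      ((contDiffAt_metricForm htar).of_le (by norm_cast)) (metricForm_definite htar)
      contDiffAt_fst contDiffAt_snd contDiffAt_snd)
  obtain ⟨K, s, hs, hK⟩ := hf.exists_lipschitzOnWith
  have hev {γ : ℝ → X} (hγ : IsGeodesic E γ) (hp : γ t ∈ (extChartAt 𝓘(ℝ, E) p).source)
      (hs : s ∈ 𝓝 (curveCoord p γ t, deriv (curveCoord p γ) t)) : ∀ᶠ r in 𝓝 t,
      HasDerivAt (fun s ↦ (curveCoord (E := E) p γ s, deriv (curveCoord (E := E) p γ) s))
        (f (curveCoord p γ r, deriv (curveCoord p γ) r)) r ∧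
      (curveCoord p γ r, deriv (curveCoord p γ) r) ∈ s := by
    filter_upwards [eventually_mem_source (hγ.1 t).continuousAt hp,
      (hγ.hasDerivAt hp).continuousAt.eventually hs] with r hr hrs
    exact ⟨hγ.hasDerivAt hr, hrs⟩
  have hc : curveCoord (E := E) p γ₁ t = curveCoord p γ₂ t := by
    rw [curveCoord, curveCoord, ← h]
  have key := ODE_solution_unique_of_eventually (v := fun _ ↦ f) (s := fun _ ↦ s) (K := K)
    (.of_forall fun _ ↦ hK) (hev h₁ hp hs) (hev h₂ hp2 (by rwa [← hc, ← h']))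
    (by rw [hc, h'])
  filter_upwards [key, eventually_mem_source (h₁.1 t).continuousAt hp,
    eventually_mem_source (h₂.1 t).continuousAt hp2] with r hr hr1 hr2
  exact (extChartAt 𝓘(ℝ, E) p).injOn hr1 hr2 (congrArg Prod.fst hr)

/-- The times at which the germs agree form an open, closed and nonempty set; the Hausdorff property
makes the positions agree at limit times. -/
theorem IsGeodesic.eq [T2Space X] {γ₁ γ₂ : ℝ → X} (h₁ : IsGeodesic E γ₁) (h₂ : IsGeodesic E γ₂)
    (h : γ₁ 0 = γ₂ 0) (h' : vel E γ₁ 0 = vel E γ₂ 0) : γ₁ = γ₂ := by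
  set A : Set ℝ := {t | γ₁ =ᶠ[𝓝 t] γ₂} with hA
  have hopen : IsOpen A := isOpen_iff_mem_nhds.2 fun t ht ↦ eventually_eventually_nhds.2 ht
  have hclosed : IsClosed A := by
    refine isClosed_of_closure_subset fun t ht ↦ ?_
    have heq : γ₁ t = γ₂ t := by
      have hc : IsClosed {t | γ₁ t = γ₂ t} := isClosed_eq h₁.1.continuous h₂.1.continuous
      exact closure_minimal (fun s (hs : γ₁ =ᶠ[𝓝 s] γ₂) ↦ hs.self_of_nhds) hc ht
    have hp : γ₁ t ∈ (extChartAt 𝓘(ℝ, E) (γ₁ t)).source := mem_extChartAt_source _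
    have hp2 : γ₂ t ∈ (extChartAt 𝓘(ℝ, E) (γ₁ t)).source := by rw [← heq]; exact hp
    refine h₁.eventuallyEq h₂ heq ?_
    have c1 := (h₁.hasDerivAt hp).continuousAt.snd
    have c2 := (h₂.hasDerivAt hp2).continuousAt.snd
    -- The coordinate velocities are continuous and agree at times arbitrarily close to `t`, hence
    -- at `t`.
    refine tendsto_nhds_unique_of_frequently_eq c1 c2 ?_
    refine (mem_closure_iff_frequently.1 ht).mono fun s (hs : γ₁ =ᶠ[𝓝 s] γ₂) ↦ ?_
    refine Filter.EventuallyEq.deriv_eq ?_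
    filter_upwards [hs] with r hr
    simp only [curveCoord, hr]
  have h0 : (0 : ℝ) ∈ A := by
    have hp : γ₁ 0 ∈ (extChartAt 𝓘(ℝ, E) (γ₁ 0)).source := mem_extChartAt_source _
    have hp2 : γ₂ 0 ∈ (extChartAt 𝓘(ℝ, E) (γ₁ 0)).source := by rw [← h]; exact hp
    refine h₁.eventuallyEq h₂ h ?_
    rw [(eventually_deriv_curveCoord h₁.1 hp).self_of_nhds,
      (eventually_deriv_curveCoord h₂.1 hp2).self_of_nhds, fieldCoord_eq, fieldCoord_eq, ← h, h']
  have hA' : A = univ := IsClopen.eq_univ ⟨hclosed, hopen⟩ ⟨0, h0⟩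
  funext t
  have ht : t ∈ A := hA' ▸ mem_univ t
  exact (show γ₁ =ᶠ[𝓝 t] γ₂ from ht).self_of_nhds

theorem IsGeodesicFrom.eq [T2Space X] {x : X} {ξ : E} {γ₁ γ₂ : ℝ → X}
    (h₁ : IsGeodesicFrom x ξ γ₁) (h₂ : IsGeodesicFrom x ξ γ₂) : γ₁ = γ₂ := by
  rw [isGeodesicFrom_iff] at h₁ h₂
  exact h₁.1.eq h₂.1 (h₁.2.1.trans h₂.2.1.symm) (h₁.2.2.trans h₂.2.2.symm)

theorem IsGeodesicFrom.expMap_eq [T2Space X] {x : X} {ξ : TangentSpace 𝓘(ℝ, E) x} {γ : ℝ → X}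
    (h : IsGeodesicFrom x ξ γ) : expMap x ξ = γ 1 := by
  have hex : ∃ γ : ℝ → X, IsGeodesicFrom x ξ γ := ⟨γ, h⟩
  rw [expMap, dif_pos hex]
  exact congrFun (hex.choose_spec.eq h) 1

theorem vel_comp_mul {γ : ℝ → X} (hγ : ContMDiff 𝓘(ℝ, ℝ) 𝓘(ℝ, E) ∞ γ) (c t : ℝ) :
    vel E (fun s ↦ γ (c * s)) t = c • vel E γ (c * t) := by
  have hm : HasFDerivAt (fun s : ℝ ↦ c * s) (c • ContinuousLinearMap.id ℝ ℝ) t :=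
    (hasFDerivAt_id t).const_mul c
  have h := ((hγ (c * t)).mdifferentiableAt (by simp)).hasMFDerivAt.comp t hm.hasMFDerivAt
  have h2 := congrArg (fun L : ℝ →L[ℝ] E ↦ L 1) h.mfderiv
  exact h2.trans (map_smul (mfderiv 𝓘(ℝ, ℝ) 𝓘(ℝ, E) γ (c * t) : ℝ →L[ℝ] E) c (1 : ℝ))

/-- Velocity scales by `c` and acceleration by `c²`, and the spray is homogeneous in each of its two
vector arguments. -/
theorem IsGeodesic.comp_mul {γ : ℝ → X} (h : IsGeodesic E γ) (c : ℝ) :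
    IsGeodesic E (fun s ↦ γ (c * s)) := by
  have hsm : ContMDiff 𝓘(ℝ, ℝ) 𝓘(ℝ, E) ∞ (fun s ↦ γ (c * s)) :=
    h.1.comp (contMDiff_iff_contDiff.2 (contDiff_const.mul contDiff_id))
  refine ⟨hsm, fun t ↦ ?_⟩
  change IsParallelAt (fun s ↦ γ (c * s)) (vel E (fun s ↦ γ (c * s))) t
  set p := γ (c * t)
  have hp : γ (c * t) ∈ (extChartAt 𝓘(ℝ, E) p).source := mem_extChartAt_source _
  have hW : HasDerivAt (fieldCoord p γ (vel E γ)) _ (c * t) := (h.isParallelAt (c * t)).hasDerivAt hp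
  have hf (s : ℝ) : fieldCoord p (fun s ↦ γ (c * s)) (vel E (fun s ↦ γ (c * s))) s =
      c • fieldCoord p γ (vel E γ) (c * s) := by
    rw [fieldCoord_eq, fieldCoord_eq, vel_comp_mul h.1, map_smul]
  refine isParallelAt_of_hasDerivAt (hsm t) (p := p) hp ?_
  have hmul : HasDerivAt (fun s : ℝ ↦ c * s) c t := by
    simpa using (hasDerivAt_id t).const_mul c
  refine (((hW.scomp t hmul).const_smul c).congr_of_eventuallyEq (.of_forall hf)).congr_deriv ?_
  rw [(eventually_deriv_curveCoord hsm (t := t) (p := p) hp).self_of_nhds, hf,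
    (eventually_deriv_curveCoord h.1 hp).self_of_nhds, spray_smul, spray_smul_left]
  rfl

theorem IsGeodesicFrom.smul {x : X} {ξ : TangentSpace 𝓘(ℝ, E) x} {γ : ℝ → X}
    (h : IsGeodesicFrom x ξ γ) (c : ℝ) :
    IsGeodesicFrom x (c • ξ) (fun s ↦ γ (c * s)) := by
  obtain ⟨hg, h0, h1⟩ := isGeodesicFrom_iff.1 h
  refine isGeodesicFrom_iff.2 ⟨hg.comp_mul c, by rw [mul_zero]; exact h0, ?_⟩
  rw [vel_comp_mul hg.1, mul_zero, h1]
  rfl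

theorem IsGeodesicFrom.expMap_smul [T2Space X] {x : X} {ξ : TangentSpace 𝓘(ℝ, E) x} {γ : ℝ → X}
    (h : IsGeodesicFrom x ξ γ) (c : ℝ) :
    expMap x (c • ξ) = γ c := by
  rw [(h.smul c).expMap_eq, mul_one]

/-- Geodesics have constant speed. -/
theorem IsGeodesic.metricAt_vel {γ : ℝ → X} (h : IsGeodesic E γ) (s t : ℝ) :
    metricAt (γ s) (vel E γ s) (vel E γ s) = metricAt (γ t) (vel E γ t) (vel E γ t) := by
  refine metricAt_eq_of_isParallelAt h.1 (a := min s t - 1) (b := max s t + 1)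
    ⟨by linarith [min_le_left s t], by linarith [le_max_left s t]⟩
    ⟨by linarith [min_le_right s t], by linarith [le_max_right s t]⟩
    (fun r _ ↦ h.isParallelAt r) (fun r _ ↦ h.isParallelAt r)

theorem expMap_zero [T2Space X] (hX : GeodesicallyComplete (E := E) X) (x : X) :
    expMap x (0 : TangentSpace 𝓘(ℝ, E) x) = x := by
  obtain ⟨γ, hγ⟩ := hX x 0
  have := hγ.expMap_smul 0
  rw [zero_smul] at this
  exact this.trans (isGeodesicFrom_iff.1 hγ).2.1

/-- Parallel transport is a linear isometry. -/
theorem exists_parallelTransport_eq [T2Space X] (hX : GeodesicallyComplete (E := E) X) {x y : X}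
    {ξ : TangentSpace 𝓘(ℝ, E) x} (h : expMap x ξ = y) :
    ∃ T : TangentSpace 𝓘(ℝ, E) x →ₗᵢ[ℝ] TangentSpace 𝓘(ℝ, E) y,
      ∀ η, parallelTransport x y ξ η = T η := by
  obtain ⟨γ, hγ⟩ := hX x ξ
  have hγ' := hγ
  obtain ⟨hg, h0, h1⟩ := isGeodesicFrom_iff.1 hγ
  have hy : γ 1 = y := hγ.expMap_eq.symm.trans h
  choose W hW0 hW using exists_isParallelAlong (E := E) hg.1
  have key (η : TangentSpace 𝓘(ℝ, E) x) : parallelTransport x y ξ η = W η 1 := by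
    have hex : ∃ ζ : TangentSpace 𝓘(ℝ, E) y,
        ∃ (γ : ℝ → X) (W : (t : ℝ) → TangentSpace 𝓘(ℝ, E) (γ t)),
        IsGeodesicFrom x ξ γ ∧ IsParallelAlong γ W ∧
        (⟨γ 0, W 0⟩ : TangentBundle 𝓘(ℝ, E) X) = ⟨x, η⟩ ∧
        (⟨γ 1, W 1⟩ : TangentBundle 𝓘(ℝ, E) X) = ⟨y, ζ⟩ :=
      ⟨W η 1, γ, W η, hγ, hW η, mk_eq_mk_iff.2 ⟨h0, hW0 η⟩, mk_eq_mk_iff.2 ⟨hy, rfl⟩⟩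
    -- Whatever geodesic and field the choice provides, uniqueness of both forces the value `W η 1`.
    obtain ⟨γ', W', hγ2, hW', e0, e1⟩ := Classical.epsilon_spec hex
    obtain rfl : γ' = γ := hγ2.eq hγ
    have e0' := (mk_eq_mk_iff.1 e0).2
    have e1' := (mk_eq_mk_iff.1 e1).2
    refine e1'.symm.trans ?_
    exact eqOn_of_isParallelAt hg.1 (V := W') (W := W η) (a := -1) (b := 2) (t := 0) (by norm_num)
      (fun r _ ↦ hW' r) (fun r _ ↦ hW η r) (e0'.trans (hW0 η).symm) (by norm_num)
  have hadd (η ζ : E) : W (η + ζ) 1 = W η 1 + W ζ 1 :=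
    eqOn_of_isParallelAt hg.1 (V := W (η + ζ)) (W := fun s ↦ W η s + W ζ s) (a := -1) (b := 2)
      (t := 0) (by norm_num) (fun r _ ↦ hW _ r) (fun r _ ↦ (hW η r).add (hg.1 r) (hW ζ r))
      (by simp only [hW0]) (by norm_num)
  have hsmul (c : ℝ) (η : E) : W (c • η) 1 = c • W η 1 :=
    eqOn_of_isParallelAt hg.1 (V := W (c • η)) (W := fun s ↦ c • W η s) (a := -1) (b := 2)
      (t := 0) (by norm_num) (fun r _ ↦ hW _ r) (fun r _ ↦ (hW η r).smul (hg.1 r) c)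
      (by simp only [hW0]) (by norm_num)
  have hnorm (η : E) : metricAt y (W η 1) (W η 1) = metricAt x η η := by
    have := metricAt_eq_of_isParallelAt hg.1 (V := W η) (W := W η) (a := -1) (b := 2) (s := 1)
      (t := 0) (by norm_num) (by norm_num) (fun r _ ↦ hW _ r) (fun r _ ↦ hW _ r)
    rwa [hW0, h0, hy] at this
  refine ⟨{ toFun := fun η ↦ W η 1, map_add' := hadd, map_smul' := hsmul, norm_map' := fun η ↦ ?_ },
    key⟩
  refine (sq_eq_sq₀ (norm_nonneg _) (norm_nonneg _)).1 ?_
  exact (metricAt_self y _).symm.trans ((hnorm η).trans (metricAt_self x η))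

end Geodesics

/-! ### The Gauss lemma in coordinates. -/

section GaussChart

variable {E : Type*} [NormedAddCommGroup E] [NormedSpace ℝ E]
  {F : Type*} [NormedAddCommGroup F] [InnerProductSpace ℝ F]

local instance : NormedAddCommGroup (F →L[ℝ] E) := ContinuousLinearMap.toNormedAddCommGroup
local instance : NormedSpace ℝ (F →L[ℝ] E) := ContinuousLinearMap.toNormedSpace

/-- The function pairs the variation field `s ↦ DΨ(s v)(s w)` of the rays with their velocity.
Unlike the Gauss lemma proper, this formula includes `t = 0`, where it yields continuity. -/
theorem hasDerivAt_radial {G : E → E →L[ℝ] E →L[ℝ] ℝ} {Ψ : F → E} {v w : F} {t : ℝ}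
    (hG : DifferentiableAt ℝ G (Ψ (t • v))) (hΨ : ContDiffAt ℝ 2 Ψ (t • v)) :
    HasDerivAt (fun s : ℝ ↦ G (Ψ (s • v)) (fderiv ℝ Ψ (s • v) (s • w)) (fderiv ℝ Ψ (s • v) v))
      (fderiv ℝ G (Ψ (t • v)) (fderiv ℝ Ψ (t • v) v) (fderiv ℝ Ψ (t • v) (t • w))
        (fderiv ℝ Ψ (t • v) v) +
      G (Ψ (t • v)) (fderiv ℝ (fderiv ℝ Ψ) (t • v) v (t • w) + fderiv ℝ Ψ (t • v) w)
        (fderiv ℝ Ψ (t • v) v) +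
      G (Ψ (t • v)) (fderiv ℝ Ψ (t • v) (t • w)) (fderiv ℝ (fderiv ℝ Ψ) (t • v) v v)) t := by
  have h1 : HasFDerivAt Ψ (fderiv ℝ Ψ (t • v)) (t • v) :=
    (hΨ.differentiableAt (by simp)).hasFDerivAt
  have h2 : HasFDerivAt (fderiv ℝ Ψ) (fderiv ℝ (fderiv ℝ Ψ) (t • v)) (t • v) :=
    ((hΨ.fderiv_right (m := 1) (by norm_num)).differentiableAt (by simp)).hasFDerivAt
  have hl (v : F) : HasDerivAt (fun s : ℝ ↦ s • v) v t := by
    simpa using (hasDerivAt_id t).smul_const v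
  have h3 := h1.comp_hasDerivAt t (hl v)
  have h4 := h2.comp_hasDerivAt t (hl v)
  have h5 := h4.clm_apply (hasDerivAt_const t v)
  rw [map_zero, add_zero] at h5
  exact hasDerivAt_form hG h3 (h4.clm_apply (hl w)) h5

/-- The Gauss lemma in a chart. -/
theorem hasDerivAt_radial_inner {G : E → E →L[ℝ] E →L[ℝ] ℝ} (hsymm : ∀ z v w, G z v w = G z w v)
    {Ψ : F → E} {v w : F} {t : ℝ} (ht : t ≠ 0)
    (hG : DifferentiableAt ℝ G (Ψ (t • v))) (hΨ : ContDiffAt ℝ 2 Ψ (t • v))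
    (henergy : ∀ᶠ z in 𝓝 (t • v), G (Ψ z) (fderiv ℝ Ψ z z) (fderiv ℝ Ψ z z) = ‖z‖ ^ 2)
    (hgeod : ∀ y, G (Ψ (t • v)) (fderiv ℝ (fderiv ℝ Ψ) (t • v) v v) y +
      lowerChristoffel G (Ψ (t • v)) (fderiv ℝ Ψ (t • v) v) (fderiv ℝ Ψ (t • v) v) y = 0) :
    HasDerivAt (fun s : ℝ ↦ G (Ψ (s • v)) (fderiv ℝ Ψ (s • v) (s • w)) (fderiv ℝ Ψ (s • v) v))
      (inner ℝ v w) t := by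
  refine (hasDerivAt_radial hG hΨ).congr_deriv ?_
  have h1 : HasFDerivAt Ψ (fderiv ℝ Ψ (t • v)) (t • v) :=
    (hΨ.differentiableAt (by simp)).hasFDerivAt
  have h2 : HasFDerivAt (fderiv ℝ Ψ) (fderiv ℝ (fderiv ℝ Ψ) (t • v)) (t • v) :=
    ((hΨ.fderiv_right (m := 1) (by norm_num)).differentiableAt (by simp)).hasFDerivAt
  have hsec : fderiv ℝ (fderiv ℝ Ψ) (t • v) w v = fderiv ℝ (fderiv ℝ Ψ) (t • v) v w :=
    hΨ.isSymmSndFDerivAt (by simp) w v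
  have hl : HasDerivAt (fun r : ℝ ↦ t • v + r • w) w 0 := by
    simpa using ((hasDerivAt_id (0 : ℝ)).smul_const w).const_add (t • v)
  have e0 : t • v + (0 : ℝ) • w = t • v := by simp
  have h3 : HasDerivAt (fun r : ℝ ↦ Ψ (t • v + r • w)) (fderiv ℝ Ψ (t • v) w) 0 := by
    rw [← e0] at h1
    exact (h1.comp_hasDerivAt 0 hl).congr_deriv (by rw [e0])
  have h4 : HasDerivAt (fun r : ℝ ↦ fderiv ℝ Ψ (t • v + r • w))
      (fderiv ℝ (fderiv ℝ Ψ) (t • v) w) 0 := by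
    rw [← e0] at h2
    exact (h2.comp_hasDerivAt 0 hl).congr_deriv (by rw [e0])
  have h5 := h4.clm_apply hl
  have h6 := hasDerivAt_form (G := G) (x := fun r : ℝ ↦ Ψ (t • v + r • w)) (by rwa [e0]) h3 h5 h5
  have h7 : HasDerivAt (fun r : ℝ ↦ ‖t • v + r • w‖ ^ 2) (2 * inner ℝ (t • v) w) 0 := by
    have := hl.norm_sq
    rwa [e0] at this
  have hev : (fun r : ℝ ↦ ‖t • v + r • w‖ ^ 2) =ᶠ[𝓝 0] fun r : ℝ ↦ G (Ψ (t • v + r • w))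
      (fderiv ℝ Ψ (t • v + r • w) (t • v + r • w)) (fderiv ℝ Ψ (t • v + r • w) (t • v + r • w)) := by
    have : Tendsto (fun r : ℝ ↦ t • v + r • w) (𝓝 0) (𝓝 (t • v)) := by
      simpa using hl.continuousAt.tendsto
    filter_upwards [this.eventually henergy] with r hr using hr.symm
  -- The energy identity, differentiated at `t • v` in the direction `w`.
  have h8 := h6.unique (h7.congr_of_eventuallyEq hev.symm)
  rw [e0, real_inner_smul_left] at h8
  have h9 := hgeod (fderiv ℝ Ψ (t • v) w)
  simp only [lowerChristoffel] at h9
  simp only [map_smul, map_add, smul_apply, add_apply, smul_eq_mul, hsec] at h8 ⊢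
  rw [hsymm _ (fderiv ℝ Ψ (t • v) v) (fderiv ℝ (fderiv ℝ Ψ) (t • v) v w),
    hsymm _ (fderiv ℝ Ψ (t • v) v) (fderiv ℝ Ψ (t • v) w)] at h8
  rw [hsymm _ _ (fderiv ℝ Ψ (t • v) w)] at h9
  have h10 := fderiv_form_comm hsymm hG (fderiv ℝ Ψ (t • v) v) (fderiv ℝ Ψ (t • v) v)
    (fderiv ℝ Ψ (t • v) w)
  -- The radial derivative is half the variation of the energy, corrected by the geodesic equation
  -- tested against `DΨ w`; since `h8` is taken at `t • v`, the identity appears multiplied by `t`.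
  refine mul_left_cancel₀ ht ?_
  linear_combination (1 / 2) * h8 + t ^ 2 * h9 - t ^ 2 * h10

end GaussChart

/-! ### The Gauss lemma on the manifold and the length estimate. -/

section Gauss

variable {E : Type*} [NormedAddCommGroup E] [NormedSpace ℝ E]
  {X : Type*} [TopologicalSpace X] [ChartedSpace E X] [IsManifold 𝓘(ℝ, E) ∞ X]
  [RiemannianBundle (fun x : X ↦ TangentSpace 𝓘(ℝ, E) x)]
  {F : Type*} [NormedAddCommGroup F] [InnerProductSpace ℝ F]

local instance : NormedAddCommGroup (F →L[ℝ] E) := ContinuousLinearMap.toNormedAddCommGroup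
local instance : NormedSpace ℝ (F →L[ℝ] E) := ContinuousLinearMap.toNormedSpace

/-- The derivative of a map from a normed space to a manifold, as a map to the model space. -/
def dMap (E : Type*) [NormedAddCommGroup E] [NormedSpace ℝ E] [ChartedSpace E X]
    (Φ : F → X) (z : F) : F →L[ℝ] E :=
  mfderiv 𝓘(ℝ, F) 𝓘(ℝ, E) Φ z

/-- `Φ` is smooth on the open star-shaped set `U` and maps the rays `t ↦ t • v` to geodesics with
speed `‖v‖`. -/
structure IsRadial (E : Type*) [NormedAddCommGroup E] [NormedSpace ℝ E] [ChartedSpace E X]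
    [IsManifold 𝓘(ℝ, E) ∞ X] [RiemannianBundle (fun x : X ↦ TangentSpace 𝓘(ℝ, E) x)]
    (Φ : F → X) (U : Set F) : Prop where
  isOpen : IsOpen U
  star : ∀ v ∈ U, ∀ t ∈ Icc (0 : ℝ) 1, t • v ∈ U
  smooth : ContMDiffOn 𝓘(ℝ, F) 𝓘(ℝ, E) ∞ Φ U
  geodesic : ∀ v : F, ∃ γ : ℝ → X, IsGeodesic E γ ∧
    metricAt (γ 0) (vel E γ 0) (vel E γ 0) = ‖v‖ ^ 2 ∧ ∀ t : ℝ, t • v ∈ U → Φ (t • v) = γ t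

theorem vel_comp {Φ : F → X} {c : ℝ → F} {c' : F} {t : ℝ}
    (hΦ : MDifferentiableAt 𝓘(ℝ, F) 𝓘(ℝ, E) Φ (c t)) (hc : HasDerivAt c c' t) :
    vel E (Φ ∘ c) t = dMap E Φ (c t) c' := by
  have h := hΦ.hasMFDerivAt.comp t hc.hasFDerivAt.hasMFDerivAt
  refine (congrArg (fun L : ℝ →L[ℝ] E ↦ L 1) h.mfderiv).trans ?_
  exact congrArg (dMap E Φ (c t)) (one_smul ℝ c')

theorem vel_congr {γ₁ γ₂ : ℝ → X} {t : ℝ} (h : γ₁ =ᶠ[𝓝 t] γ₂) : vel E γ₁ t = vel E γ₂ t :=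
  congrArg (fun L : ℝ →L[ℝ] E ↦ L 1) h.mfderiv_eq

theorem fderiv_chart_comp {Φ : F → X} {z : F} (hΦ : MDifferentiableAt 𝓘(ℝ, F) 𝓘(ℝ, E) Φ z) {p : X}
    (hp : Φ z ∈ (extChartAt 𝓘(ℝ, E) p).source) (v : F) :
    fderiv ℝ (extChartAt 𝓘(ℝ, E) p ∘ Φ) z v = dChart p (Φ z) (dMap E Φ z v) := by
  have h := ((contMDiffAt_chart hp).mdifferentiableAt (by simp)).hasMFDerivAt.comp z hΦ.hasMFDerivAt
  rw [← mfderiv_eq_fderiv]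
  exact congrArg (fun L : F →L[ℝ] E ↦ L v) h.mfderiv

namespace IsRadial

theorem contMDiffAt {Φ : F → X} {U : Set F} (h : IsRadial E Φ U) {z : F} (hz : z ∈ U) :
    ContMDiffAt 𝓘(ℝ, F) 𝓘(ℝ, E) ∞ Φ z :=
  h.smooth.contMDiffAt (h.isOpen.mem_nhds hz)

theorem mdifferentiableAt {Φ : F → X} {U : Set F} (h : IsRadial E Φ U) {z : F} (hz : z ∈ U) :
    MDifferentiableAt 𝓘(ℝ, F) 𝓘(ℝ, E) Φ z :=
  (h.contMDiffAt hz).mdifferentiableAt (by simp)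

theorem eventually_mem {Φ : F → X} {U : Set F} (h : IsRadial E Φ U) {v : F} {t : ℝ}
    (ht : t • v ∈ U) : ∀ᶠ s in 𝓝 t, s • v ∈ U := by
  have hc : ContinuousAt (fun s : ℝ ↦ s • v) t := by fun_prop
  exact hc.eventually (h.isOpen.mem_nhds ht)

theorem vel_eq {Φ : F → X} {U : Set F} (h : IsRadial E Φ U) {v : F} {γ : ℝ → X}
    (hγ : ∀ t : ℝ, t • v ∈ U → Φ (t • v) = γ t) {t : ℝ} (ht : t • v ∈ U) :
    vel E γ t = dMap E Φ (t • v) v := by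
  rw [← vel_comp (c := fun s : ℝ ↦ s • v) (h.mdifferentiableAt ht)
    (by simpa using (hasDerivAt_id t).smul_const v)]
  refine vel_congr ?_
  filter_upwards [h.eventually_mem ht] with s hs using (hγ s hs).symm

variable [FiniteDimensional ℝ E]
  [IsContMDiffRiemannianBundle 𝓘(ℝ, E) ∞ E (fun x : X ↦ TangentSpace 𝓘(ℝ, E) x)]

theorem metricAt_dMap_self {Φ : F → X} {U : Set F} (h : IsRadial E Φ U) {v : F} (hv : v ∈ U) :
    metricAt (Φ v) (dMap E Φ v v) (dMap E Φ v v) = ‖v‖ ^ 2 := by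
  obtain ⟨γ, hg, h0, hγ⟩ := h.geodesic v
  have h1 : (1 : ℝ) • v ∈ U := by rwa [one_smul]
  have h2 := h.vel_eq hγ h1
  have h3 := hγ 1 h1
  rw [one_smul] at h2 h3
  rw [h3, ← h2, hg.metricAt_vel 1 0, h0]

theorem metricAt_dMap {Φ : F → X} {U : Set F} (h : IsRadial E Φ U) {p : X} {z : F} (hz : z ∈ U)
    (hp : Φ z ∈ (extChartAt 𝓘(ℝ, E) p).source) (v w : F) :
    metricAt (Φ z) (dMap E Φ z v) (dMap E Φ z w) = metricForm p ((extChartAt 𝓘(ℝ, E) p ∘ Φ) z)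
      (fderiv ℝ (extChartAt 𝓘(ℝ, E) p ∘ Φ) z v) (fderiv ℝ (extChartAt 𝓘(ℝ, E) p ∘ Φ) z w) := by
  rw [fderiv_chart_comp (h.mdifferentiableAt hz) hp, fderiv_chart_comp (h.mdifferentiableAt hz) hp]
  exact (chartMetric_dChart hp _ _).symm

theorem contDiffAt_chart {Φ : F → X} {U : Set F} (h : IsRadial E Φ U) {p : X} {z : F} (hz : z ∈ U)
    (hp : Φ z ∈ (extChartAt 𝓘(ℝ, E) p).source) :
    ContDiffAt ℝ 2 (extChartAt 𝓘(ℝ, E) p ∘ Φ) z :=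
  (contMDiffAt_iff_contDiffAt.1 ((contMDiffAt_chart hp).comp z (h.contMDiffAt hz))).of_le
    ENat.LEInfty.out

theorem eventually_metricAt {Φ : F → X} {U : Set F} (h : IsRadial E Φ U) {v : F} {t : ℝ}
    (ht : t • v ∈ U) (w : F) {p : X} (hp : Φ (t • v) ∈ (extChartAt 𝓘(ℝ, E) p).source) :
    (fun s : ℝ ↦ metricAt (Φ (s • v)) (dMap E Φ (s • v) (s • w)) (dMap E Φ (s • v) v)) =ᶠ[𝓝 t]
    fun s : ℝ ↦ metricForm p ((extChartAt 𝓘(ℝ, E) p ∘ Φ) (s • v))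
      (fderiv ℝ (extChartAt 𝓘(ℝ, E) p ∘ Φ) (s • v) (s • w))
      (fderiv ℝ (extChartAt 𝓘(ℝ, E) p ∘ Φ) (s • v) v) := by
  have hc : ContinuousAt (fun s : ℝ ↦ Φ (s • v)) t :=
    ContinuousAt.comp (f := fun s : ℝ ↦ s • v) (g := Φ) (h.contMDiffAt ht).continuousAt (by fun_prop)
  filter_upwards [h.eventually_mem ht, hc.eventually ((isOpen_source p).mem_nhds hp)] with s hs hsp
  exact h.metricAt_dMap hs hsp _ _

theorem continuousAt_radial {Φ : F → X} {U : Set F} (h : IsRadial E Φ U) {v : F} {t : ℝ}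
    (ht : t • v ∈ U) (w : F) : ContinuousAt (fun s : ℝ ↦
      metricAt (Φ (s • v)) (dMap E Φ (s • v) (s • w)) (dMap E Φ (s • v) v)) t := by
  have hp : Φ (t • v) ∈ (extChartAt 𝓘(ℝ, E) (Φ (t • v))).source := mem_extChartAt_source _
  have hG : DifferentiableAt ℝ (metricForm (E := E) (Φ (t • v)))
      ((extChartAt 𝓘(ℝ, E) (Φ (t • v)) ∘ Φ) (t • v)) :=
    differentiableAt_metricForm ((extChartAt 𝓘(ℝ, E) (Φ (t • v))).map_source hp)
  have h1 := hasDerivAt_radial (w := w) hG (h.contDiffAt_chart ht hp)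
  exact (h1.congr_of_eventuallyEq (h.eventually_metricAt ht w hp)).continuousAt

/-- The hypotheses of `hasDerivAt_radial_inner` come from the constant speed of the rays and from
the geodesic equation, read off the second derivative of `s ↦ Φ(s v)` in a chart. -/
theorem hasDerivAt_metricAt {Φ : F → X} {U : Set F} (h : IsRadial E Φ U) {v : F} {t : ℝ}
    (ht : t • v ∈ U) (ht0 : t ≠ 0) (w : F) : HasDerivAt (fun s : ℝ ↦
      metricAt (Φ (s • v)) (dMap E Φ (s • v) (s • w)) (dMap E Φ (s • v) v)) (inner ℝ v w) t := by
  set p := Φ (t • v) with hpdef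
  have hp : Φ (t • v) ∈ (extChartAt 𝓘(ℝ, E) p).source := mem_extChartAt_source _
  have htar : (extChartAt 𝓘(ℝ, E) p ∘ Φ) (t • v) ∈ (extChartAt 𝓘(ℝ, E) p).target :=
    (extChartAt 𝓘(ℝ, E) p).map_source hp
  have hΨ := h.contDiffAt_chart ht hp
  refine (hasDerivAt_radial_inner (metricForm_comm p) ht0 (differentiableAt_metricForm htar)
    hΨ ?_ ?_).congr_of_eventuallyEq (h.eventually_metricAt ht w hp)
  · filter_upwards [h.isOpen.mem_nhds ht, (h.contMDiffAt ht).continuousAt.eventually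
      ((isOpen_source p).mem_nhds hp)] with z hz hzp
    rw [← h.metricAt_dMap hz hzp, h.metricAt_dMap_self hz]
  · obtain ⟨γ, hg, -, hγ⟩ := h.geodesic v
    have hγp : γ t ∈ (extChartAt 𝓘(ℝ, E) p).source := by rw [← hγ t ht]; exact hp
    have hc : curveCoord p γ =ᶠ[𝓝 t] fun s ↦ (extChartAt 𝓘(ℝ, E) p ∘ Φ) (s • v) := by
      filter_upwards [h.eventually_mem ht] with s hs
      simp only [curveCoord, Function.comp, hγ s hs]
    have hl (s : ℝ) : HasDerivAt (fun s : ℝ ↦ s • v) v s := by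
      simpa using (hasDerivAt_id s).smul_const v
    have hd : deriv (curveCoord p γ) =ᶠ[𝓝 t]
        fun s ↦ fderiv ℝ (extChartAt 𝓘(ℝ, E) p ∘ Φ) (s • v) v := by
      have hcont : ContinuousAt (fun s : ℝ ↦ s • v) t := (hl t).continuousAt
      filter_upwards [hc.eventuallyEq_nhds,
        hcont.eventually (hΨ.eventually (by simp))] with s hs hs2
      rw [hs.deriv_eq]
      have hs3 : HasFDerivAt (extChartAt 𝓘(ℝ, E) p ∘ Φ)
          (fderiv ℝ (extChartAt 𝓘(ℝ, E) p ∘ Φ) (s • v)) (s • v) :=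
        (hs2.differentiableAt (by simp)).hasFDerivAt
      exact (hs3.comp_hasDerivAt s (hl s)).deriv
    have h2 : HasFDerivAt (fderiv ℝ (extChartAt 𝓘(ℝ, E) p ∘ Φ))
        (fderiv ℝ (fderiv ℝ (extChartAt 𝓘(ℝ, E) p ∘ Φ)) (t • v)) (t • v) :=
      ((hΨ.fderiv_right (m := 1) (by norm_num)).differentiableAt (by simp)).hasFDerivAt
    have h3 := (h2.comp_hasDerivAt t (hl t)).clm_apply (hasDerivAt_const t v)
    rw [map_zero, add_zero] at h3
    have h4 : HasDerivAt (deriv (curveCoord p γ)) _ t := (hg.hasDerivAt hγp).snd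
    have h5 := (h3.congr_of_eventuallyEq hd).unique h4
    have hd0 : fderiv ℝ (extChartAt 𝓘(ℝ, E) p ∘ Φ) (t • v) v = deriv (curveCoord p γ) t :=
      hd.self_of_nhds.symm
    have hc0 : (extChartAt 𝓘(ℝ, E) p ∘ Φ) (t • v) = curveCoord p γ t := hc.self_of_nhds.symm
    intro y
    rw [h5, hd0, hc0]
    exact form_spray (metricForm_definite (curveCoord_mem_target hγp)) _ _ _

/-- The Gauss lemma. -/
theorem metricAt_dMap_radial {Φ : F → X} {U : Set F} (h : IsRadial E Φ U) {v : F} (hv : v ∈ U)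
    (w : F) : metricAt (Φ v) (dMap E Φ v w) (dMap E Φ v v) = inner ℝ v w := by
  -- The pairing has constant derivative `⟨v, w⟩` on `(0, 1)` and vanishes at `0`, where the field
  -- `s • w` is zero; its value at `1` is the claim.
  obtain ⟨t, ht, hslope⟩ := exists_hasDerivAt_eq_slope
    (fun s : ℝ ↦ metricAt (Φ (s • v)) (dMap E Φ (s • v) (s • w)) (dMap E Φ (s • v) v))
    (fun _ ↦ inner ℝ v w) zero_lt_one
    (fun s hs ↦ (h.continuousAt_radial (h.star v hv s hs) w).continuousWithinAt)
    (fun s hs ↦ h.hasDerivAt_metricAt (h.star v hv s ⟨hs.1.le, hs.2.le⟩) hs.1.ne' w)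
  have e : metricAt (Φ ((0 : ℝ) • v)) (dMap E Φ ((0 : ℝ) • v) ((0 : ℝ) • w))
      (dMap E Φ ((0 : ℝ) • v) v) = 0 := by
    rw [zero_smul ℝ w, map_zero, ← zero_smul ℝ (0 : E), metricAt_smul_left, zero_mul]
  rw [e] at hslope
  simpa using hslope.symm

/-- By the Gauss lemma `⟨v, w⟩` is an inner product at `Φ v`, where Cauchy-Schwarz applies, and the
radial vector keeps its length `‖v‖`. -/
theorem abs_inner_le {Φ : F → X} {U : Set F} (h : IsRadial E Φ U) {v : F} (hv : v ∈ U)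
    {w : F} {l : ℝ} (hl : 0 ≤ l)
    (hw : metricAt (Φ v) (dMap E Φ v w) (dMap E Φ v w) ≤ l ^ 2) : |inner ℝ v w| ≤ ‖v‖ * l := by
  rw [← h.metricAt_dMap_radial hv]
  have h1 := h.metricAt_dMap_self hv
  replace h1 := (metricAt_self (E := E) (Φ v) (dMap E Φ v v)).symm.trans h1
  replace hw := (metricAt_self (E := E) (Φ v) (dMap E Φ v w)).symm.trans_le hw
  have h2 := abs_real_inner_le_norm (F := TangentSpace 𝓘(ℝ, E) (Φ v)) (dMap E Φ v w) (dMap E Φ v v)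
  refine h2.trans ?_
  rw [mul_comm]
  exact mul_le_mul ((sq_eq_sq₀ (norm_nonneg _) (norm_nonneg _)).1 h1).le
    ((sq_le_sq₀ (norm_nonneg _) hl).1 hw) (norm_nonneg _) (norm_nonneg _)

/-- The radial distance changes at most by the length of a curve. -/
theorem norm_le_norm_add {Φ : F → X} {U : Set F} (h : IsRadial E Φ U) {c : ℝ → F} {σ : ℝ → X}
    {l : ℝ} (hl : 0 ≤ l)
    (hc : ∀ t ∈ Icc (0 : ℝ) 1, DifferentiableAt ℝ c t)
    (hU : ∀ t ∈ Icc (0 : ℝ) 1, c t ∈ U)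
    (hσ : ∀ t ∈ Icc (0 : ℝ) 1, Φ ∘ c =ᶠ[𝓝 t] σ)
    (hspeed : ∀ t ∈ Icc (0 : ℝ) 1, metricAt (σ t) (vel E σ t) (vel E σ t) ≤ l ^ 2) :
    ‖c 0‖ ≤ ‖c 1‖ + l := by
  have hin (t : ℝ) (ht : t ∈ Icc (0 : ℝ) 1) : |inner ℝ (c t) (deriv c t)| ≤ ‖c t‖ * l := by
    refine h.abs_inner_le (hU t ht) hl ?_
    have h1 := hspeed t ht
    rwa [← vel_congr (hσ t ht), vel_comp (h.mdifferentiableAt (hU t ht)) (hc t ht).hasDerivAt,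
      ← (hσ t ht).self_of_nhds] at h1
  -- The norm is not differentiable at `0`, so it is replaced by `√(δ² + ‖c‖²)`, whose derivative is
  -- still at most `l`.
  refine le_of_forall_pos_le_add fun δ hδ ↦ ?_
  have hpos (t : ℝ) : 0 < δ ^ 2 + ‖c t‖ ^ 2 := by positivity
  have hd (t : ℝ) (ht : t ∈ Icc (0 : ℝ) 1) : HasDerivAt (fun s ↦ √(δ ^ 2 + ‖c s‖ ^ 2))
      (2 * inner ℝ (c t) (deriv c t) / (2 * √(δ ^ 2 + ‖c t‖ ^ 2))) t :=
    (((hc t ht).hasDerivAt.norm_sq).const_add _).sqrt (hpos t).ne'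
  have hbound (t : ℝ) (ht : t ∈ Icc (0 : ℝ) 1) :
      ‖2 * inner ℝ (c t) (deriv c t) / (2 * √(δ ^ 2 + ‖c t‖ ^ 2))‖ ≤ l := by
    rw [mul_div_mul_left _ _ two_ne_zero, norm_div, Real.norm_eq_abs,
      Real.norm_of_nonneg (Real.sqrt_nonneg _), div_le_iff₀ (Real.sqrt_pos.2 (hpos t))]
    refine (hin t ht).trans ?_
    rw [mul_comm]
    refine mul_le_mul_of_nonneg_left (Real.le_sqrt_of_sq_le ?_) hl
    nlinarith
  have := (convex_Icc (0 : ℝ) 1).norm_image_sub_le_of_norm_hasDerivWithin_le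
    (fun t ht ↦ (hd t ht).hasDerivWithinAt) hbound (right_mem_Icc.2 zero_le_one)
    (left_mem_Icc.2 zero_le_one)
  rw [Real.norm_eq_abs, Real.norm_eq_abs, zero_sub, abs_neg, abs_one, mul_one] at this
  have h1 := (abs_le.1 this).2
  have h2 : ‖c 0‖ ≤ √(δ ^ 2 + ‖c 0‖ ^ 2) := Real.le_sqrt_of_sq_le (by nlinarith)
  have h3 : √(δ ^ 2 + ‖c 1‖ ^ 2) ≤ δ + ‖c 1‖ := by
    refine Real.sqrt_le_iff.2 ⟨by positivity, ?_⟩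
    nlinarith [mul_nonneg hδ.le (norm_nonneg (c 1))]
  linarith

end IsRadial

end Gauss

/-! ### Exponential map and logarithm on a totally retractive set. -/

section Retractive

variable {E : Type*} [NormedAddCommGroup E] [NormedSpace ℝ E]
  {X : Type*} [TopologicalSpace X] [T2Space X] [ChartedSpace E X] [IsManifold 𝓘(ℝ, E) ∞ X]
  [RiemannianBundle (fun x : X ↦ TangentSpace 𝓘(ℝ, E) x)]
  [FiniteDimensional ℝ E]
  [IsContMDiffRiemannianBundle 𝓘(ℝ, E) ∞ E (fun x : X ↦ TangentSpace 𝓘(ℝ, E) x)]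
  {ρ : ℝ≥0∞} {Ω : Set X}

theorem IsTotallyRetractive.isRadial (hX : GeodesicallyComplete (E := E) X)
    (hΩ : IsTotallyRetractive (E := E) ρ Ω) {x : X} (hx : x ∈ Ω) :
    IsRadial E (expMap (E := E) x) (Metric.eball (0 : TangentSpace 𝓘(ℝ, E) x) ρ) := by
  obtain ⟨⟨Φ, hs, hΦ⟩, -⟩ := hΩ x hx
  refine ⟨Metric.isOpen_eball, fun v hv t ht ↦ ?_, ?_, fun v ↦ ?_⟩
  · rw [Metric.mem_eball, edist_zero_right] at hv ⊢
    refine lt_of_le_of_lt ?_ hv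
    rw [enorm_smul]
    refine mul_le_of_le_one_left' ?_
    rw [← ofReal_norm, Real.norm_of_nonneg ht.1]
    exact ENNReal.ofReal_le_one.2 ht.2
  · have := Φ.contMDiffOn_toFun
    rw [hs] at this
    exact this.congr fun z hz ↦ (hΦ hz).symm
  · obtain ⟨γ, hγ⟩ := hX x v
    obtain ⟨hg, h0, h1⟩ := isGeodesicFrom_iff.1 hγ
    refine ⟨γ, hg, ?_, fun t _ ↦ hγ.expMap_smul t⟩
    rw [h1, h0]
    exact metricAt_self x v

theorem IsTotallyRetractive.logMap_spec (hΩ : IsTotallyRetractive (E := E) ρ Ω) {x y : X}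
    (hx : x ∈ Ω) (hy : y ∈ Ω) :
    logMap (E := E) ρ x y ∈ Metric.eball (0 : TangentSpace 𝓘(ℝ, E) x) ρ ∧
      expMap x (logMap (E := E) ρ x y) = y := by
  obtain ⟨ξ, hξ, hy'⟩ := (hΩ x hx).2 hy
  exact Classical.epsilon_spec (p := fun ξ : TangentSpace 𝓘(ℝ, E) x ↦
    ξ ∈ Metric.eball (0 : TangentSpace 𝓘(ℝ, E) x) ρ ∧ expMap x ξ = y) ⟨ξ, hξ, hy'⟩

theorem IsTotallyRetractive.logMap_eq (hΩ : IsTotallyRetractive (E := E) ρ Ω) {x y : X}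
    (hx : x ∈ Ω) (hy : y ∈ Ω) {ξ : TangentSpace 𝓘(ℝ, E) x}
    (hξ : ξ ∈ Metric.eball (0 : TangentSpace 𝓘(ℝ, E) x) ρ) (h : expMap x ξ = y) :
    logMap (E := E) ρ x y = ξ := by
  obtain ⟨h1, h2⟩ := hΩ.logMap_spec hx hy
  obtain ⟨⟨Φ, hs, hΦ⟩, -⟩ := hΩ x hx
  refine Φ.injOn (hs ▸ h1) (hs ▸ hξ) ?_
  exact (hΦ h1).trans ((h2.trans h.symm).trans (hΦ hξ).symm)

/-- A smooth local inverse of the exponential map, defined near all points of `Ω`. -/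
theorem IsTotallyRetractive.exists_inverse (hΩ : IsTotallyRetractive (E := E) ρ Ω) {x : X}
    (hx : x ∈ Ω) : ∃ (ℓ : X → TangentSpace 𝓘(ℝ, E) x) (O : Set X), IsOpen O ∧ Ω ⊆ O ∧
      ContMDiffOn 𝓘(ℝ, E) 𝓘(ℝ, TangentSpace 𝓘(ℝ, E) x) ∞ ℓ O ∧
      (∀ y ∈ O, ℓ y ∈ Metric.eball (0 : TangentSpace 𝓘(ℝ, E) x) ρ ∧ expMap x (ℓ y) = y) ∧
      ∀ ξ ∈ Metric.eball (0 : TangentSpace 𝓘(ℝ, E) x) ρ, ℓ (expMap x ξ) = ξ := by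
  obtain ⟨⟨Φ, hs, hΦ⟩, hsub⟩ := hΩ x hx
  refine ⟨Φ.invFun, Φ.target, Φ.open_target, fun y hy ↦ ?_, Φ.contMDiffOn_invFun,
    fun y hy ↦ ?_, fun ξ hξ ↦ ?_⟩
  · obtain ⟨ξ, hξ, rfl⟩ := hsub hy
    rw [← hΦ hξ]
    exact Φ.map_source (hs ▸ hξ)
  · have h1 : Φ.invFun y ∈ Φ.source := Φ.map_target hy
    rw [hs] at h1
    exact ⟨h1, (hΦ h1).symm.trans (Φ.right_inv hy)⟩
  · rw [← hΦ hξ]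
    exact Φ.left_inv (hs ▸ hξ)

/-- If the geodesic segment with initial velocity `ξ` stays in `Ω`, then `ξ` is in the ball. -/
theorem IsTotallyRetractive.mem_eball_of_segment (hX : GeodesicallyComplete (E := E) X)
    (hΩ : IsTotallyRetractive (E := E) ρ Ω) {x : X} (hx : x ∈ Ω) {ξ : TangentSpace 𝓘(ℝ, E) x}
    (hseg : ∀ τ ∈ Icc (0 : ℝ) 1, expMap x (τ • ξ) ∈ Ω) :
    ξ ∈ Metric.eball (0 : TangentSpace 𝓘(ℝ, E) x) ρ := by
  obtain ⟨ℓ, O, hO, hΩO, hℓ, hℓ1, hℓ2⟩ := hΩ.exists_inverse hx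
  obtain ⟨γ, hγ⟩ := hX x ξ
  have hexp (τ : ℝ) : expMap x (τ • ξ) = γ τ := hγ.expMap_smul τ
  simp only [hexp] at hseg
  have hγc : Continuous γ := hγ.1.1.continuous
  have hlin : Continuous fun τ : ℝ ↦ τ • ξ := by fun_prop
  set u : Set ℝ := {τ | τ • ξ ∈ Metric.eball (0 : TangentSpace 𝓘(ℝ, E) x) ρ} with hu
  have huo : IsOpen u := Metric.isOpen_eball.preimage hlin
  have h0 : (0 : ℝ) ∈ u := by
    have h1 := (hℓ1 x (hΩO hx)).1
    rw [hu, mem_ofPred_eq, zero_smul]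
    exact Metric.mem_eball_self (pos_of_gt (Metric.mem_eball.1 h1))
  have hsub : Icc (0 : ℝ) 1 ⊆ u := by
    -- The times with `τ • ξ` in the ball form an open set. At a limit time `ℓ (γ τ) = τ • ξ` by
    -- continuity, and `ℓ` takes values in the open ball, so the set is also relatively closed in
    -- `[0, 1]`.
    refine isPreconnected_Icc.subset_of_closure_inter_subset huo
      ⟨0, left_mem_Icc.2 zero_le_one, h0⟩ fun τ hτ ↦ ?_
    have hτO := hΩO (hseg τ hτ.2)
    have hc : ContinuousAt (fun s ↦ ℓ (γ s)) τ :=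
      ContinuousAt.comp (g := ℓ) (hℓ.continuousOn.continuousAt (hO.mem_nhds hτO)) hγc.continuousAt
    have heq : ℓ (γ τ) = τ • ξ := by
      refine tendsto_nhds_unique_of_frequently_eq hc hlin.continuousAt
        ((mem_closure_iff_frequently.1 hτ.1).mono fun s hs ↦ ?_)
      rw [← hexp s, hℓ2 _ hs]
    rw [hu, mem_ofPred_eq, ← heq]
    exact (hℓ1 _ hτO).1
  have := hsub (right_mem_Icc.2 zero_le_one)
  rwa [hu, mem_ofPred_eq, one_smul] at this

/-- Along a geodesic segment in `Ω`, the distance to a point `x` of `Ω`, measured by the inverse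
exponential map, decreases at most by the length of the segment. -/
theorem IsTotallyRetractive.norm_logMap_le (hX : GeodesicallyComplete (E := E) X)
    (hΩ : IsTotallyRetractive (E := E) ρ Ω) {x y y' : X} (hx : x ∈ Ω) {ξ : TangentSpace 𝓘(ℝ, E) y}
    (hseg : ∀ τ ∈ Icc (0 : ℝ) 1, expMap y (τ • ξ) ∈ Ω) (hy' : expMap y ξ = y') :
    ‖logMap (E := E) ρ x y‖ ≤ ‖logMap (E := E) ρ x y'‖ + ‖ξ‖ := by
  obtain ⟨ℓ, O, hO, hΩO, hℓ, hℓ1, hℓ2⟩ := hΩ.exists_inverse hx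
  obtain ⟨γ, hγ⟩ := hX y ξ
  have hexp (τ : ℝ) : expMap y (τ • ξ) = γ τ := hγ.expMap_smul τ
  simp only [hexp] at hseg
  obtain ⟨hg, h0, h1⟩ := isGeodesicFrom_iff.1 hγ
  have h1' : γ 1 = y' := by rw [← hexp, one_smul, hy']
  have hlog {z : X} (hz : z ∈ Ω) : logMap (E := E) ρ x z = ℓ z :=
    hΩ.logMap_eq hx hz (hℓ1 z (hΩO hz)).1 (hℓ1 z (hΩO hz)).2
  have hyΩ : y ∈ Ω := by
    rw [← h0]; exact hseg 0 (left_mem_Icc.2 zero_le_one)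
  have hy'Ω : y' ∈ Ω := by
    rw [← h1']; exact hseg 1 (right_mem_Icc.2 zero_le_one)
  rw [hlog hyΩ, hlog hy'Ω]
  suffices key : ‖ℓ (γ 0)‖ ≤ ‖ℓ (γ 1)‖ + ‖ξ‖ by rwa [h0, h1'] at key
  -- The geodesic, which stays in the image of the ball, is lifted to the tangent space at `x`.
  refine (hΩ.isRadial hX hx).norm_le_norm_add (c := fun s ↦ ℓ (γ s)) (σ := γ) (norm_nonneg ξ)
    (fun t ht ↦ ?_) (fun t ht ↦ (hℓ1 _ (hΩO (hseg t ht))).1) (fun t ht ↦ ?_) (fun t ht ↦ ?_)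
  · have h2 : ContMDiffAt 𝓘(ℝ, ℝ) 𝓘(ℝ, TangentSpace 𝓘(ℝ, E) x) ∞ (ℓ ∘ γ) t :=
      (hℓ.contMDiffAt (hO.mem_nhds (hΩO (hseg t ht)))).comp t (hg.1 t)
    exact (contMDiffAt_iff_contDiffAt.1 h2).differentiableAt (by simp)
  · filter_upwards [hg.1.continuous.continuousAt.eventually
      (hO.mem_nhds (hΩO (hseg t ht)))] with s hs
    exact (hℓ1 _ hs).2
  · rw [hg.metricAt_vel t 0, h1, h0]
    exact (metricAt_self y ξ).le

theorem IsTotallyRetractive.logMap_self (hX : GeodesicallyComplete (E := E) X)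
    (hΩ : IsTotallyRetractive (E := E) ρ Ω) {x : X} (hx : x ∈ Ω) : logMap (E := E) ρ x x = 0 := by
  refine hΩ.logMap_eq hx hx ?_ (expMap_zero hX x)
  exact Metric.mem_eball_self (pos_of_gt (Metric.mem_eball.1 (hΩ.logMap_spec hx hx).1))

/-- The transport `Γ_x^y` between points of `Ω` is a linear isometry. -/
theorem IsTotallyRetractive.exists_transport_eq (hX : GeodesicallyComplete (E := E) X)
    (hΩ : IsTotallyRetractive (E := E) ρ Ω) {x y : X} (hx : x ∈ Ω) (hy : y ∈ Ω) :
    ∃ T : TangentSpace 𝓘(ℝ, E) x →ₗᵢ[ℝ] TangentSpace 𝓘(ℝ, E) y, ∀ η, transport ρ x y η = T η :=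
  exists_parallelTransport_eq hX (hΩ.logMap_spec hx hy).2

/-- The parallel transport along a geodesic segment in `Ω` is the transport `Γ_x^y`. -/
theorem IsTotallyRetractive.parallelTransport_eq (hX : GeodesicallyComplete (E := E) X)
    (hΩ : IsTotallyRetractive (E := E) ρ Ω) {x y : X} (hx : x ∈ Ω) {ξ : TangentSpace 𝓘(ℝ, E) x}
    (hseg : ∀ τ ∈ Icc (0 : ℝ) 1, expMap x (τ • ξ) ∈ Ω) (h : expMap x ξ = y)
    (η : TangentSpace 𝓘(ℝ, E) x) : parallelTransport x y ξ η = transport ρ x y η := by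
  have hy : y ∈ Ω := by
    rw [← h]; simpa using hseg 1 (right_mem_Icc.2 zero_le_one)
  rw [transport, hΩ.logMap_eq hx hy (hΩ.mem_eball_of_segment hX hx hseg) h]

end Retractive

/-! ### Mean and variance over uniformly random batches. -/

section Batches

variable {n : ℕ} {H : Type*} [NormedAddCommGroup H] [InnerProductSpace ℝ H]

/-- The average over the batches of cardinality `b`. -/
def batchAvg {V : Type*} [AddCommMonoid V] [Module ℝ V] (n b : ℕ) (F : Finset (Fin n) → V) : V :=
  (1 / (n.choose b : ℝ)) • ∑ B ∈ Finset.powersetCard b Finset.univ, F B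

/-- The mean of a family over a batch. -/
def batchMean (u : Fin n → H) (B : Finset (Fin n)) : H := (1 / (B.card : ℝ)) • ∑ i ∈ B, u i

/-- Double counting: every index lies in `(n-1).choose (b-1)` batches, and `b * n.choose b = n *
(n-1).choose (b-1)`. -/
theorem batchAvg_batchMean {b : ℕ} (hb : 0 < b) (hbn : b ≤ n) (u : Fin n → H) :
    batchAvg n b (batchMean u) = (1 / (n : ℝ)) • ∑ i, u i := by
  have hn : 0 < n := hb.trans_le hbn
  have hC : 0 < n.choose b := Nat.choose_pos hbn
  have h1 : ∑ B ∈ Finset.powersetCard b Finset.univ, batchMean u B =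
      (1 / (b : ℝ)) • ∑ B ∈ Finset.powersetCard b Finset.univ, ∑ i ∈ B, u i := by
    rw [Finset.smul_sum]
    refine Finset.sum_congr rfl fun B hB ↦ ?_
    rw [batchMean, (Finset.mem_powersetCard.1 hB).2]
  have h2 : ∑ B ∈ Finset.powersetCard b Finset.univ, ∑ i ∈ B, u i =
      ((n - 1).choose (b - 1) : ℝ) • ∑ i, u i := by
    rw [Finset.sum_comm' (t' := Finset.univ)
      (s' := fun i ↦ (Finset.powersetCard b Finset.univ).filter ({i} ⊆ ·))
      (by intro B i; simp), Finset.smul_sum]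
    refine Finset.sum_congr rfl fun i _ ↦ ?_
    rw [Finset.sum_const, Finset.card_filter_powersetCard_subset _ _ _
      (Finset.subset_univ _) (by rw [Finset.card_singleton]; exact hb)]
    simp [Nat.cast_smul_eq_nsmul]
  have h3 : (b : ℝ) * n.choose b = n * (n - 1).choose (b - 1) := by
    have := Nat.add_one_mul_choose_eq (n - 1) (b - 1)
    rw [Nat.sub_add_cancel hn, Nat.sub_add_cancel hb] at this
    rw [mul_comm]
    exact_mod_cast this.symm
  rw [batchAvg, h1, h2, smul_smul, smul_smul]
  congr 1
  have hn' : (n : ℝ) ≠ 0 := by positivity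
  have hb' : (b : ℝ) ≠ 0 := by positivity
  have hC' : (n.choose b : ℝ) ≠ 0 := by positivity
  field_simp
  linarith

theorem batchAvg_const {b : ℕ} (hbn : b ≤ n) (c : H) : batchAvg n b (fun _ ↦ c) = c := by
  have hC : (n.choose b : ℝ) ≠ 0 := by
    have := Nat.choose_pos hbn
    positivity
  rw [batchAvg, Finset.sum_const, Finset.card_powersetCard, Finset.card_univ, Fintype.card_fin,
    ← Nat.cast_smul_eq_nsmul ℝ, smul_smul, one_div_mul_cancel hC, one_smul]

theorem batchAvg_add {V : Type*} [AddCommMonoid V] [Module ℝ V] (b : ℕ) (F G : Finset (Fin n) → V) :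
    batchAvg n b (fun B ↦ F B + G B) = batchAvg n b F + batchAvg n b G := by
  simp only [batchAvg, Finset.sum_add_distrib, smul_add]

theorem batchAvg_mono {b : ℕ} {F G : Finset (Fin n) → ℝ} (h : ∀ B, B.card = b → F B ≤ G B) :
    batchAvg n b F ≤ batchAvg n b G := by
  rw [batchAvg, batchAvg, smul_eq_mul, smul_eq_mul]
  exact mul_le_mul_of_nonneg_left (Finset.sum_le_sum fun B hB ↦ h B (Finset.mem_powersetCard.1 hB).2)
    (by positivity)

theorem batchAvg_inner (b : ℕ) (c : H) (F : Finset (Fin n) → H) :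
    batchAvg n b (fun B ↦ inner ℝ c (F B)) = inner ℝ c (batchAvg n b F) := by
  simp only [batchAvg, inner_smul_right, inner_sum, smul_eq_mul]

theorem norm_batchMean_sq_le (u : Fin n → H) (B : Finset (Fin n)) :
    ‖batchMean u B‖ ^ 2 ≤ batchMean (fun i ↦ ‖u i‖ ^ 2) B := by
  rcases B.eq_empty_or_nonempty with rfl | hB
  · simp [batchMean]
  have hc : 0 < (B.card : ℝ) := by exact_mod_cast hB.card_pos
  rw [batchMean, batchMean, norm_smul, mul_pow, Real.norm_of_nonneg (by positivity), smul_eq_mul]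
  have h1 : ‖∑ i ∈ B, u i‖ ^ 2 ≤ B.card * ∑ i ∈ B, ‖u i‖ ^ 2 :=
    (pow_le_pow_left₀ (norm_nonneg _) (norm_sum_le _ _) 2).trans sq_sum_le_card_mul_sum_sq
  calc (1 / (B.card : ℝ)) ^ 2 * ‖∑ i ∈ B, u i‖ ^ 2
      ≤ (1 / (B.card : ℝ)) ^ 2 * (B.card * ∑ i ∈ B, ‖u i‖ ^ 2) := by gcongr
    _ = 1 / (B.card : ℝ) * ∑ i ∈ B, ‖u i‖ ^ 2 := by field_simp

/-- The mean square of a vector plus the centred mean over a random batch. -/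
theorem batchAvg_norm_sq_le {b : ℕ} (hb : 0 < b) (hbn : b ≤ n) (u : Fin n → H) (c : H) :
    batchAvg n b (fun B ↦ ‖c + (batchMean u B - (1 / (n : ℝ)) • ∑ i, u i)‖ ^ 2) ≤
      ‖c‖ ^ 2 + 1 / (n : ℝ) * ∑ i, ‖u i‖ ^ 2 := by
  set a := (1 / (n : ℝ)) • ∑ i, u i
  have hexp (B : Finset (Fin n)) : ‖c + (batchMean u B - a)‖ ^ 2 =
      (‖c - a‖ ^ 2 + inner ℝ ((2 : ℝ) • (c - a)) (batchMean u B)) + ‖batchMean u B‖ ^ 2 := by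
    rw [show c + (batchMean u B - a) = (c - a) + batchMean u B by abel, norm_add_sq_real,
      real_inner_smul_left]
  simp only [hexp]
  rw [batchAvg_add, batchAvg_add, batchAvg_const hbn, batchAvg_inner, batchAvg_batchMean hb hbn]
  have h1 : batchAvg n b (fun B ↦ ‖batchMean u B‖ ^ 2) ≤ 1 / (n : ℝ) * ∑ i, ‖u i‖ ^ 2 := by
    refine (batchAvg_mono fun B _ ↦ norm_batchMean_sq_le u B).trans_eq ?_
    exact batchAvg_batchMean hb hbn _
  -- These two terms amount to `‖c‖² - ‖a‖²`, and the negative square is dropped.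
  change ‖c - a‖ ^ 2 + inner ℝ ((2 : ℝ) • (c - a)) a + _ ≤ _
  rw [real_inner_smul_left, inner_sub_left, norm_sub_sq_real, real_inner_self_eq_norm_sq]
  nlinarith [sq_nonneg ‖a‖]

/-- Second-moment bound for the vectors entering the new direction. Convexity lets the two Lipschitz
terms share one bound `M²D²`, the weight of `g` is at most `1 - φ`, and the factors `2` come from
`(p + q)² ≤ 2p² + 2q²`. -/
theorem mean_norm_sq_le {φ ψ M D N : ℝ} (hφ : 0 ≤ φ) (hψ : 0 ≤ ψ) (hφψ : φ + ψ ≤ 1)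
    (hn : 0 < n) (x y g : Fin n → H)
    (hx : 1 / (n : ℝ) * ∑ i, ‖x i‖ ^ 2 ≤ M ^ 2 * D ^ 2)
    (hy : 1 / (n : ℝ) * ∑ i, ‖y i‖ ^ 2 ≤ M ^ 2 * D ^ 2) (hg : ∀ i, ‖g i‖ ≤ N) :
    1 / (n : ℝ) * ∑ i, ‖φ • x i + ψ • y i + (1 - φ - ψ) • g i‖ ^ 2 ≤
      2 * M ^ 2 * D ^ 2 + 2 * (1 - φ) ^ 2 * N ^ 2 := by
  have hpt (i : Fin n) : ‖φ • x i + ψ • y i + (1 - φ - ψ) • g i‖ ^ 2 ≤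
      2 * (φ * ‖x i‖ ^ 2 + ψ * ‖y i‖ ^ 2) + 2 * (1 - φ) ^ 2 * N ^ 2 := by
    have h1 : ‖φ • x i + ψ • y i + (1 - φ - ψ) • g i‖ ≤
        (φ * ‖x i‖ + ψ * ‖y i‖) + (1 - φ) * N := by
      refine (norm_add₃_le).trans ?_
      rw [norm_smul, norm_smul, norm_smul, Real.norm_of_nonneg hφ, Real.norm_of_nonneg hψ,
        Real.norm_of_nonneg (by linarith : 0 ≤ 1 - φ - ψ)]
      have : (1 - φ - ψ) * ‖g i‖ ≤ (1 - φ) * N :=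
        mul_le_mul (by linarith) (hg i) (norm_nonneg _) (by linarith)
      linarith
    have h2 : (φ * ‖x i‖ + ψ * ‖y i‖) ^ 2 ≤ φ * ‖x i‖ ^ 2 + ψ * ‖y i‖ ^ 2 := by
      have e : φ * ‖x i‖ ^ 2 + ψ * ‖y i‖ ^ 2 - (φ * ‖x i‖ + ψ * ‖y i‖) ^ 2 =
          φ * (1 - φ - ψ) * ‖x i‖ ^ 2 + ψ * (1 - φ - ψ) * ‖y i‖ ^ 2 +
            φ * ψ * (‖x i‖ - ‖y i‖) ^ 2 := by ring
      have h3 : 0 ≤ 1 - φ - ψ := by linarith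
      have : 0 ≤ φ * (1 - φ - ψ) * ‖x i‖ ^ 2 + ψ * (1 - φ - ψ) * ‖y i‖ ^ 2 +
            φ * ψ * (‖x i‖ - ‖y i‖) ^ 2 := by positivity
      linarith
    calc _ ≤ ((φ * ‖x i‖ + ψ * ‖y i‖) + (1 - φ) * N) ^ 2 := pow_le_pow_left₀ (norm_nonneg _) h1 2
      _ ≤ 2 * (φ * ‖x i‖ + ψ * ‖y i‖) ^ 2 + 2 * ((1 - φ) * N) ^ 2 := by
        nlinarith [sq_nonneg (φ * ‖x i‖ + ψ * ‖y i‖ - (1 - φ) * N)]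
      _ ≤ _ := by nlinarith
  have hn' : (0 : ℝ) < n := by exact_mod_cast hn
  calc 1 / (n : ℝ) * ∑ i, ‖φ • x i + ψ • y i + (1 - φ - ψ) • g i‖ ^ 2
      ≤ 1 / (n : ℝ) * ∑ i : Fin n,
        (2 * (φ * ‖x i‖ ^ 2 + ψ * ‖y i‖ ^ 2) + 2 * (1 - φ) ^ 2 * N ^ 2) := by
        gcongr with i
        exact hpt i
    _ = 2 * (φ * (1 / (n : ℝ) * ∑ i, ‖x i‖ ^ 2) + ψ * (1 / (n : ℝ) * ∑ i, ‖y i‖ ^ 2)) +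
        2 * (1 - φ) ^ 2 * N ^ 2 := by
      rw [Finset.sum_add_distrib, Finset.sum_const, Finset.card_univ, Fintype.card_fin,
        ← Finset.mul_sum, Finset.sum_add_distrib, ← Finset.mul_sum, ← Finset.mul_sum,
        nsmul_eq_mul]
      field_simp
    _ ≤ _ := by
      have h1 := mul_le_mul_of_nonneg_left hx hφ
      have h2 := mul_le_mul_of_nonneg_left hy hψ
      have h3 : (φ + ψ) * (M ^ 2 * D ^ 2) ≤ 1 * (M ^ 2 * D ^ 2) := by gcongr
      linarith

end Batches

/-! ### The error of the new direction. -/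

section Direction

variable {E : Type*} [NormedAddCommGroup E] [NormedSpace ℝ E]
  {X : Type*} [TopologicalSpace X] [T2Space X] [ChartedSpace E X] [IsManifold 𝓘(ℝ, E) ∞ X]
  [RiemannianBundle (fun x : X ↦ TangentSpace 𝓘(ℝ, E) x)]
  [FiniteDimensional ℝ E]
  {n : ℕ} {f : Fin n → X → ℝ}

theorem inner_grad (g : X → ℝ) (x : X) (ξ : TangentSpace 𝓘(ℝ, E) x) :
    inner ℝ (grad g x) ξ = mfderiv 𝓘(ℝ, E) 𝓘(ℝ, ℝ) g x ξ := by
  have : FiniteDimensional ℝ (TangentSpace 𝓘(ℝ, E) x) := inferInstanceAs (FiniteDimensional ℝ E)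
  have : CompleteSpace (TangentSpace 𝓘(ℝ, E) x) :=
    FiniteDimensional.complete ℝ (TangentSpace 𝓘(ℝ, E) x)
  exact InnerProductSpace.toDual_symm_apply

theorem grad_objective (hf : ∀ i, ContMDiff 𝓘(ℝ, E) 𝓘(ℝ, ℝ) 1 (f i)) (x : X) :
    grad (E := E) (objective f) x = (1 / (n : ℝ)) • ∑ i, grad (E := E) (f i) x := by
  refine ext_inner_right ℝ fun ξ ↦ ?_
  rw [inner_grad, real_inner_smul_left, sum_inner]
  simp only [inner_grad]
  let L : Fin n → (TangentSpace 𝓘(ℝ, E) x →L[ℝ] ℝ) := fun i ↦ mfderiv 𝓘(ℝ, E) 𝓘(ℝ, ℝ) (f i) x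
  have h1 : HasMFDerivAt 𝓘(ℝ, E) 𝓘(ℝ, ℝ) (∑ i, f i) x (∑ i, L i) :=
    HasMFDerivAt.sum fun i _ ↦ ((hf i x).mdifferentiableAt (by simp)).hasMFDerivAt
  have h3 : objective f = (1 / (n : ℝ)) • ∑ i, f i := by
    ext y
    simp [objective, Finset.sum_apply]
  rw [h3, (h1.const_smul (1 / (n : ℝ))).mfderiv]
  change (1 / (n : ℝ)) • (∑ i, L i) ξ = 1 / (n : ℝ) * ∑ i, L i ξ
  rw [sum_apply, smul_eq_mul]

theorem adaptiveParam_mem {ψ c r a : ℝ} (hψ : 0 ≤ ψ) (hc : 0 ≤ c) (hr : 0 ≤ r) :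
    0 ≤ adaptiveParam ψ c r a ∧ adaptiveParam ψ c r a ≤ ψ := by
  rw [adaptiveParam]
  split_ifs
  · exact ⟨le_min hψ (by positivity), min_le_left _ _⟩
  · exact ⟨hψ, le_rfl⟩

variable [IsContMDiffRiemannianBundle 𝓘(ℝ, E) ∞ E (fun x : X ↦ TangentSpace 𝓘(ℝ, E) x)]
  {ρ : ℝ≥0∞} {Ω : Set X}

/-- The mean square error of the new direction, over the batches. -/
theorem batchAvg_direction_le (hX : GeodesicallyComplete (E := E) X)
    (hf : ∀ i, ContMDiff 𝓘(ℝ, E) 𝓘(ℝ, ℝ) 1 (f i))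
    (hΩ : IsTotallyRetractive (E := E) ρ Ω) {M N : ℝ}
    (hLip : IsMeanSquareLipschitz (E := E) f ρ Ω M)
    (hN : ∀ x ∈ Ω, ∀ i, ‖grad (E := E) (f i) x‖ ≤ N)
    {b : ℕ} (hb : 0 < b) (hbn : b ≤ n) {c φ ψ : ℝ} (hc : 0 ≤ c) (hφ : 0 ≤ φ) (hψ : 0 ≤ ψ)
    (hφψ : φ + ψ ≤ 1) {x₀ x y : X} (hx₀ : x₀ ∈ Ω) (hx : x ∈ Ω) (hy : y ∈ Ω)
    {v ξ : TangentSpace 𝓘(ℝ, E) x} (hseg : ∀ τ ∈ Icc (0 : ℝ) 1, expMap x (τ • ξ) ∈ Ω)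
    (hexp : expMap x ξ = y) {D : ℝ} (hD₀ : ‖logMap (E := E) ρ y x₀‖ ≤ D)
    (hD : ‖logMap (E := E) ρ y x‖ ≤ D) :
    batchAvg n b (fun B ↦ ‖direction f ρ c φ ψ B x₀ x y v ξ - grad (objective f) y‖ ^ 2) ≤
      ‖v - grad (objective f) x‖ ^ 2 + 2 * M ^ 2 * D ^ 2 + 2 * (1 - φ) ^ 2 * N ^ 2 := by
  obtain ⟨T₀, hT₀⟩ := hΩ.exists_transport_eq hX hx₀ hy
  obtain ⟨T, hT⟩ := hΩ.exists_transport_eq hX hx hy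
  have hpar (η : TangentSpace 𝓘(ℝ, E) x) : parallelTransport x y ξ η = T η :=
    (hΩ.parallelTransport_eq hX hx hseg hexp η).trans (hT η)
  -- This parameter is computed from the past and the full gradient, so it is constant in the
  -- average over the batches `B`.
  set ψ' : ℝ := adaptiveParam ψ c (‖grad (E := E) (objective f) y‖ ^ 2)
    (inner ℝ (parallelTransport x y ξ (v - grad (objective f) x)) (grad (objective f) y)) with hψ'
  obtain ⟨hψ0, hψle⟩ : 0 ≤ ψ' ∧ ψ' ≤ ψ := adaptiveParam_mem hψ hc (sq_nonneg _)
  let u : Fin n → TangentSpace 𝓘(ℝ, E) y := fun i ↦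
    φ • (grad (f i) y - T₀ (grad (f i) x₀)) + ψ' • (grad (f i) y - T (grad (f i) x)) +
      (1 - φ - ψ') • grad (f i) y
  have hlin {a : ℝ} (B : Finset (Fin n)) : a • ∑ i ∈ B, u i =
      φ • (a • ∑ i ∈ B, grad (f i) y - T₀ (a • ∑ i ∈ B, grad (f i) x₀)) +
      ψ' • (a • ∑ i ∈ B, grad (f i) y - T (a • ∑ i ∈ B, grad (f i) x)) +
      (1 - φ - ψ') • a • ∑ i ∈ B, grad (f i) y := by
    simp only [u, Finset.sum_add_distrib, ← Finset.smul_sum, Finset.sum_sub_distrib, map_smul,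
      map_sum, smul_add, smul_sub, smul_smul, mul_comm a]
  -- The error splits into the transported old error, independent of `B`, and a centred batch mean.
  have key (B : Finset (Fin n)) : direction f ρ c φ ψ B x₀ x y v ξ - grad (objective f) y =
      ψ' • T (v - grad (objective f) x) + (batchMean u B - (1 / (n : ℝ)) • ∑ i, u i) := by
    rw [batchMean, hlin, hlin, ← grad_objective hf, ← grad_objective hf, ← grad_objective hf]
    simp only [direction]
    rw [← hψ', hpar, hT₀]
    simp only [batchGrad, map_sub]
    module
  simp only [key]
  refine (batchAvg_norm_sq_le hb hbn u _).trans ?_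
  have h1 : ‖ψ' • T (v - grad (objective f) x)‖ ^ 2 ≤ ‖v - grad (objective f) x‖ ^ 2 := by
    rw [norm_smul, T.norm_map, Real.norm_of_nonneg hψ0]
    refine pow_le_pow_left₀ (by positivity) (mul_le_of_le_one_left (norm_nonneg _) ?_) 2
    linarith
  have hlip {z : X} (hz : z ∈ Ω) (hzD : ‖logMap (E := E) ρ y z‖ ≤ D) :
      1 / (n : ℝ) * ∑ i, ‖grad (E := E) (f i) y - transport ρ z y (grad (f i) z)‖ ^ 2 ≤
        M ^ 2 * D ^ 2 := by
    obtain ⟨h3, h4⟩ := hΩ.logMap_spec hy hz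
    refine (hLip y hy z hz _ h3 h4).trans ?_
    gcongr
  have h2 := mean_norm_sq_le hφ hψ0 (by linarith : φ + ψ' ≤ 1) (hb.trans_le hbn)
    (fun i ↦ grad (E := E) (f i) y - T₀ (grad (f i) x₀))
    (fun i ↦ grad (E := E) (f i) y - T (grad (f i) x)) (fun i ↦ grad (E := E) (f i) y)
    (M := M) (D := D) (N := N)
    (by simpa only [hT₀] using hlip hx₀ hD₀) (by simpa only [hT] using hlip hx hD) (hN y hy)
  change _ + 1 / (n : ℝ) * ∑ i, ‖φ • (grad (E := E) (f i) y - T₀ (grad (f i) x₀)) +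
    ψ' • (grad (f i) y - T (grad (f i) x)) + (1 - φ - ψ') • grad (f i) y‖ ^ 2 ≤ _
  linarith

end Direction

/-! ### Estimates along a single trajectory. -/

section Path

variable {E : Type*} [NormedAddCommGroup E] [NormedSpace ℝ E]
  {X : Type*} [TopologicalSpace X] [T2Space X] [ChartedSpace E X] [IsManifold 𝓘(ℝ, E) ∞ X]
  [RiemannianBundle (fun x : X ↦ TangentSpace 𝓘(ℝ, E) x)]
  [FiniteDimensional ℝ E]
  {n : ℕ} {f : Fin n → X → ℝ}

/-- The squared norm of the gradient at the base point. -/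
def gradSq (f : Fin n → X → ℝ) (q : TangentBundle 𝓘(ℝ, E) X) : ℝ :=
  ‖grad (E := E) (objective f) q.proj‖ ^ 2

/-- The squared norm of a direction. -/
def dirSq (q : TangentBundle 𝓘(ℝ, E) X) : ℝ := ‖q.snd‖ ^ 2

/-- The squared error of a direction. -/
def errSq (f : Fin n → X → ℝ) (q : TangentBundle 𝓘(ℝ, E) X) : ℝ :=
  ‖q.snd - grad (E := E) (objective f) q.proj‖ ^ 2

/-- One step of the inner loop. -/
def nextIter (f : Fin n → X → ℝ) (ρ : ℝ≥0∞) (c α φ ψ : ℝ) (x₀ : X) (B : Finset (Fin n))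
    (q : TangentBundle 𝓘(ℝ, E) X) : TangentBundle 𝓘(ℝ, E) X :=
  ⟨expMap q.proj (-(α • q.snd)),
    direction f ρ c φ ψ B x₀ q.proj (expMap q.proj (-(α • q.snd))) q.snd (-(α • q.snd))⟩

/-- The geodesic segment of the step from `q` stays in `Ω`. -/
def StepIn (Ω : Set X) (α : ℝ) (q : TangentBundle 𝓘(ℝ, E) X) : Prop :=
  ∀ τ ∈ Icc (0 : ℝ) 1, expMap q.proj (-((τ * α) • q.snd)) ∈ Ω

variable [IsContMDiffRiemannianBundle 𝓘(ℝ, E) ∞ E (fun x : X ↦ TangentSpace 𝓘(ℝ, E) x)]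
  {ρ : ℝ≥0∞} {Ω : Set X} {α : ℝ}

theorem StepIn.segment {q : TangentBundle 𝓘(ℝ, E) X} (h : StepIn Ω α q) :
    ∀ τ ∈ Icc (0 : ℝ) 1, expMap q.proj (τ • (-(α • q.snd))) ∈ Ω := by
  intro τ hτ
  rw [smul_neg, smul_smul]
  exact h τ hτ

theorem StepIn.proj_mem (hX : GeodesicallyComplete (E := E) X) {q : TangentBundle 𝓘(ℝ, E) X}
    (h : StepIn Ω α q) : q.proj ∈ Ω := by
  have := h.segment 0 (left_mem_Icc.2 zero_le_one)
  rwa [zero_smul, expMap_zero hX] at this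

theorem StepIn.expMap_mem {q : TangentBundle 𝓘(ℝ, E) X} (h : StepIn Ω α q) :
    expMap q.proj (-(α • q.snd)) ∈ Ω := by
  have := h.segment 1 (right_mem_Icc.2 zero_le_one)
  rwa [one_smul] at this

theorem norm_step (hα : 0 ≤ α) (q : TangentBundle 𝓘(ℝ, E) X) : ‖-(α • q.snd)‖ = α * ‖q.snd‖ := by
  rw [norm_neg, norm_smul, Real.norm_of_nonneg hα]

/-- The single-segment estimate `norm_logMap_le`, summed over the broken geodesic. -/
theorem norm_logMap_path_le (hX : GeodesicallyComplete (E := E) X)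
    (hΩ : IsTotallyRetractive (E := E) ρ Ω) (hα : 0 ≤ α) {q : ℕ → TangentBundle 𝓘(ℝ, E) X}
    (hq : ∀ i, (q (i + 1)).proj = expMap (q i).proj (-(α • (q i).snd))) {z : X} (hz : z ∈ Ω) (t : ℕ)
    (hstay : ∀ i < t, StepIn Ω α (q i)) :
    ‖logMap (E := E) ρ z (q 0).proj‖ ≤ ‖logMap (E := E) ρ z (q t).proj‖ +
      ∑ i ∈ Finset.range t, α * ‖(q i).snd‖ := by
  induction t with
  | zero => simp
  | succ t ih =>
    refine (ih fun i hi ↦ hstay i (by omega)).trans ?_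
    have h := hΩ.norm_logMap_le hX hz (hstay t (by omega)).segment (hq t).symm
    rw [norm_step hα] at h
    rw [Finset.sum_range_succ]
    linarith

/-- Seen from the new point, the anchor and the previous point are both within the length `D` of the
path travelled in the epoch; Cauchy-Schwarz over its `t + 1` steps turns `D²` into the sum of the
squared directions. -/
theorem batchAvg_errSq_le (hX : GeodesicallyComplete (E := E) X)
    (hf : ∀ i, ContMDiff 𝓘(ℝ, E) 𝓘(ℝ, ℝ) 1 (f i))
    (hΩ : IsTotallyRetractive (E := E) ρ Ω) {M N : ℝ}
    (hLip : IsMeanSquareLipschitz (E := E) f ρ Ω M)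
    (hN : ∀ x ∈ Ω, ∀ i, ‖grad (E := E) (f i) x‖ ≤ N)
    {b : ℕ} (hb : 0 < b) (hbn : b ≤ n) {c φ ψ : ℝ} (hc : 0 ≤ c) (hφ : 0 ≤ φ) (hψ : 0 ≤ ψ)
    (hφψ : φ + ψ ≤ 1) (hα : 0 ≤ α) {q : ℕ → TangentBundle 𝓘(ℝ, E) X}
    (hq : ∀ i, (q (i + 1)).proj = expMap (q i).proj (-(α • (q i).snd))) (t : ℕ)
    (hstay : ∀ i ≤ t, StepIn Ω α (q i)) :
    batchAvg n b (fun B ↦ errSq f (nextIter f ρ c α φ ψ (q 0).proj B (q t))) ≤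
      errSq f (q t) + 2 * M ^ 2 * α ^ 2 * (t + 1) * ∑ i ∈ Finset.range (t + 1), dirSq (q i) +
        2 * (1 - φ) ^ 2 * N ^ 2 := by
  have hy : expMap (q t).proj (-(α • (q t).snd)) ∈ Ω := (hstay t le_rfl).expMap_mem
  set y := expMap (q t).proj (-(α • (q t).snd)) with hydef
  set D : ℝ := ∑ i ∈ Finset.range (t + 1), α * ‖(q i).snd‖
  have hself : logMap (E := E) ρ y y = 0 := hΩ.logMap_self hX hy
  have hD₀ : ‖logMap (E := E) ρ y (q 0).proj‖ ≤ D := by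
    have := norm_logMap_path_le hX hΩ hα hq hy (t + 1) fun i hi ↦ hstay i (by omega)
    rwa [hq t, ← hydef, hself, norm_zero, zero_add] at this
  have hD : ‖logMap (E := E) ρ y (q t).proj‖ ≤ D := by
    have h := hΩ.norm_logMap_le hX hy (hstay t le_rfl).segment hydef.symm
    rw [hself, norm_zero, zero_add, norm_step hα] at h
    refine h.trans ?_
    exact Finset.single_le_sum (f := fun i ↦ α * ‖(q i).snd‖)
      (fun i _ ↦ mul_nonneg hα (norm_nonneg _)) (Finset.self_mem_range_succ t)
  have key := batchAvg_direction_le hX hf hΩ hLip hN hb hbn hc hφ hψ hφψ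
    ((hstay 0 (Nat.zero_le t)).proj_mem hX) ((hstay t le_rfl).proj_mem hX) hy
    (v := (q t).snd) (hstay t le_rfl).segment hydef.symm hD₀ hD
  refine key.trans ?_
  have hDsq : D ^ 2 ≤ α ^ 2 * (t + 1) * ∑ i ∈ Finset.range (t + 1), dirSq (q i) := by
    have := sq_sum_le_card_mul_sum_sq (s := Finset.range (t + 1)) (f := fun i ↦ α * ‖(q i).snd‖)
    rw [Finset.card_range] at this
    refine this.trans_eq ?_
    simp only [mul_pow, ← Finset.mul_sum, dirSq]
    push_cast
    ring
  have h2 : 2 * M ^ 2 * D ^ 2 ≤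
      2 * M ^ 2 * (α ^ 2 * (t + 1) * ∑ i ∈ Finset.range (t + 1), dirSq (q i)) := by gcongr
  change ‖(q t).snd - grad (objective f) (q t).proj‖ ^ 2 + _ + _ ≤
    ‖(q t).snd - grad (objective f) (q t).proj‖ ^ 2 + _ + _
  linarith

/-- The linear term of the smoothness inequality is rewritten by `2⟨g, V⟩ = ‖g‖² + ‖V‖² - ‖V - g‖²`.
-/
theorem objective_step_le (hX : GeodesicallyComplete (E := E) X)
    (hΩ : IsTotallyRetractive (E := E) ρ Ω) {L : ℝ}
    (hsmooth : IsRetractionSmooth (E := E) (objective f) ρ Ω L)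
    {q : TangentBundle 𝓘(ℝ, E) X} (h : StepIn Ω α q) :
    objective f (expMap q.proj (-(α • q.snd))) ≤ objective f q.proj - α / 2 * gradSq f q +
      α / 2 * errSq f q - α / 2 * (1 - L * α) * dirSq q := by
  have h1 := hsmooth q.proj (h.proj_mem hX) _ h.expMap_mem (-(α • q.snd))
    (hΩ.mem_eball_of_segment hX (h.proj_mem hX) h.segment) rfl
  refine h1.trans_eq ?_
  rw [gradSq, errSq, dirSq, norm_sub_sq_real, inner_neg_right, inner_smul_right, norm_neg,
    norm_smul, mul_pow, Real.norm_eq_abs, sq_abs, real_inner_comm]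
  ring

end Path

/-! ### Expectations of functions of finitely many finite-valued variables. -/

section Sampling

variable {ι S S' : Type*} [MeasurableSpace S] [Finite S] [MeasurableSingletonClass S]
  [MeasurableSpace S'] {P : Measure S'} [IsProbabilityMeasure P] {Y : ι → S' → S}

theorem exists_eq_comp_restrict {β : Type*} [Nonempty β] {J : Finset ι} {h : (ι → S) → β}
    (hh : DependsOn h (J : Set ι)) : ∃ g : (J → S) → β, ∀ κ, h κ = g fun i ↦ κ i := by
  obtain ⟨g, hg⟩ := dependsOn_iff_exists_comp.1 hh
  exact ⟨g, fun κ ↦ congrFun hg κ⟩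

theorem aemeasurable_restrict (hY : ∀ i, AEMeasurable (Y i) P) (J : Finset ι) :
    AEMeasurable (fun z (i : J) ↦ Y i z) P :=
  aemeasurable_pi_lambda _ fun i ↦ hY i

/-- Such a function factors through the finite set `J → S`, on which every function is measurable
and bounded. -/
theorem integrable_of_dependsOn (hY : ∀ i, AEMeasurable (Y i) P) {J : Finset ι}
    {h : (ι → S) → ℝ} (hh : DependsOn h (J : Set ι)) : Integrable (fun z ↦ h fun i ↦ Y i z) P := by
  obtain ⟨g, hg⟩ := exists_eq_comp_restrict hh
  simp only [hg]
  have hm := aemeasurable_restrict hY J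
  have : IsProbabilityMeasure (P.map fun z (i : J) ↦ Y i z) := Measure.isProbabilityMeasure_map hm
  exact (Integrable.of_finite (f := g)).comp_aemeasurable hm

/-- The expectation can be taken first over a variable independent of the others. -/
theorem integral_eq_integral_integral (hY : ∀ i, AEMeasurable (Y i) P) (hind : iIndepFun Y P)
    {J : Finset ι} {k : ι} (hk : k ∉ J) {F : (ι → S) → S → ℝ}
    (hF : ∀ B, DependsOn (fun κ ↦ F κ B) (J : Set ι)) :
    ∫ z, F (fun i ↦ Y i z) (Y k z) ∂P = ∫ z, ∫ B, F (fun i ↦ Y i z) B ∂(P.map (Y k)) ∂P := by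
  choose g hg using fun B ↦ exists_eq_comp_restrict (hF B)
  simp only [hg]
  have hm := aemeasurable_restrict hY J
  have h1 : IndepFun (fun z (i : J) ↦ Y i z) (Y k) P := by
    have h2 := hind.indepFun_finset₀ J {k} (by simpa using hk) hY
    exact h2.comp (φ := id) (ψ := fun r : (({k} : Finset ι) → S) ↦ r ⟨k, by simp⟩) measurable_id
      (measurable_pi_apply _)
  have : IsProbabilityMeasure (P.map fun z (i : J) ↦ Y i z) := Measure.isProbabilityMeasure_map hm
  have : IsProbabilityMeasure (P.map (Y k)) := Measure.isProbabilityMeasure_map (hY k)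
  have h3 := (indepFun_iff_map_prod_eq_prod_map_map hm (hY k)).1 h1
  have h4 := integral_map (μ := P) (φ := fun z ↦ ((fun i : J ↦ Y i z), Y k z))
    (f := fun q : (J → S) × S ↦ g q.2 q.1) (hm.prodMk (hY k))
    (Integrable.of_finite).aestronglyMeasurable
  have h5 := integral_map (μ := P) (φ := fun z ↦ (fun i : J ↦ Y i z))
    (f := fun r : (J → S) ↦ ∫ B, g B r ∂(P.map (Y k))) hm
    (Integrable.of_finite).aestronglyMeasurable
  rw [← h4, ← h5, h3, integral_prod _ Integrable.of_finite]

theorem integral_uniformOn_finset {T : Type*} [MeasurableSpace T] [MeasurableSingletonClass T]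
    {K : Finset T} (g : T → ℝ) :
    ∫ k, g k ∂(uniformOn (K : Set T)) = 1 / (K.card : ℝ) * ∑ k ∈ K, g k := by
  rw [uniformOn, ProbabilityTheory.cond, integral_smul_measure, setIntegral_finset _ ?_,
    Measure.count_apply_finset]
  · simp [measureReal_def, one_div]
  · have : IsFiniteMeasure (Measure.count.restrict (K : Set T)) := ⟨by
      simp [Measure.count_apply_finset]⟩
    have h : IntegrableOn g K (Measure.count.restrict (K : Set T)) := IntegrableOn.finset
    rwa [IntegrableOn, Measure.restrict_restrict K.measurableSet, Set.inter_self] at h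

theorem integral_uniformOn_card {n b : ℕ} (g : Finset (Fin n) → ℝ) :
    ∫ B, g B ∂(uniformOn {B : Finset (Fin n) | B.card = b}) = batchAvg n b g := by
  have : {B : Finset (Fin n) | B.card = b} =
      ((Finset.powersetCard b Finset.univ : Finset (Finset (Fin n))) : Set (Finset (Fin n))) := by
    ext B
    simp [Finset.mem_powersetCard]
  rw [this, integral_uniformOn_finset, batchAvg, Finset.card_powersetCard, Finset.card_univ,
    Fintype.card_fin, smul_eq_mul]

/-- The expectation of an independently and uniformly sampled term. -/
theorem integral_sampled (hY : ∀ i, AEMeasurable (Y i) P) {T : Type*} [MeasurableSpace T]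
    [Countable T] [MeasurableSingletonClass T] {K : Finset T} {a : S' → T}
    (ha : HasLaw a (uniformOn (K : Set T)) P)
    (hind : IndepFun a (fun z i ↦ Y i z) P)
    {A : T → (ι → S) → ℝ} (J : T → Finset ι) (hA : ∀ k, DependsOn (A k) (J k : Set ι)) :
    Integrable (fun z ↦ A (a z) fun i ↦ Y i z) P ∧
      ∫ z, A (a z) (fun i ↦ Y i z) ∂P =
        1 / (K.card : ℝ) * ∑ k ∈ K, ∫ z, A k (fun i ↦ Y i z) ∂P := by
  classical
  let χ : T → T → ℝ := fun k j ↦ if j = k then 1 else 0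
  have hmem : ∀ᵐ z ∂P, a z ∈ K := by
    have h1 : ∀ᵐ k ∂(uniformOn (K : Set T)), k ∈ (K : Set T) := by
      rw [uniformOn]
      exact ae_cond_mem K.measurableSet
    rw [← ha.map_eq] at h1
    exact ae_of_ae_map ha.aemeasurable h1
  -- Splitting according to the sampled value gives products of an indicator of `a` and a function
  -- of `Y`, whose expectations factor by independence.
  have hsum : (fun z ↦ A (a z) fun i ↦ Y i z) =ᵐ[P]
      fun z ↦ ∑ k ∈ K, χ k (a z) * A k fun i ↦ Y i z := by
    filter_upwards [hmem] with z hz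
    simp [χ, hz]
  have hint (k : T) : Integrable (fun z ↦ A k fun i ↦ Y i z) P := integrable_of_dependsOn hY (hA k)
  have hχm (k : T) : AEStronglyMeasurable (fun z ↦ χ k (a z)) P :=
    ((measurable_of_countable (χ k)).comp_aemeasurable ha.aemeasurable).aestronglyMeasurable
  have hχ (k : T) : Integrable (fun z ↦ χ k (a z)) P := by
    refine Integrable.of_bound (hχm k) 1 (.of_forall fun z ↦ ?_)
    simp only [χ]
    split_ifs <;> simp
  have hi (k : T) : IndepFun (fun z ↦ χ k (a z)) (fun z ↦ A k fun i ↦ Y i z) P := by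
    obtain ⟨g, hg⟩ := exists_eq_comp_restrict (hA k)
    simp only [hg]
    exact hind.comp (φ := χ k) (ψ := fun κ : ι → S ↦ g fun i ↦ κ i) (measurable_of_countable _)
      ((measurable_of_countable g).comp (measurable_pi_lambda _ fun i ↦ measurable_pi_apply _))
  have hmulint (k : T) : Integrable (fun z ↦ χ k (a z) * A k fun i ↦ Y i z) P :=
    (hi k).integrable_mul (hχ k) (hint k)
  have hχval (k : T) (hk : k ∈ K) : ∫ z, χ k (a z) ∂P = 1 / (K.card : ℝ) := by
    have h1 := ha.integral_comp (f := χ k) (measurable_of_countable (χ k)).aestronglyMeasurable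
    rw [integral_uniformOn_finset] at h1
    refine h1.trans ?_
    simp [χ, hk]
  refine ⟨(integrable_finsetSum _ fun k _ ↦ hmulint k).congr hsum.symm, ?_⟩
  rw [integral_congr_ae hsum, integral_finsetSum _ fun k _ ↦ hmulint k, Finset.mul_sum]
  refine Finset.sum_congr rfl fun k hk ↦ ?_
  rw [(hi k).integral_fun_mul_eq_mul_integral (hχm k) (hint k).aestronglyMeasurable, hχval k hk]

end Sampling

/-! ### The deterministic recursion of an epoch and the step size. -/

section Descent

/-- The accumulated gradients of an epoch, from the recursion for the errors of the directions and
the descent of the objective. -/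
theorem sum_grad_le_of_descent {m : ℕ} {e v G F : ℕ → ℝ} {M L C d : ℝ} (hC : 0 < C)
    (hd : 0 ≤ d) (hv : ∀ t, 0 ≤ v t) (he0 : e 0 = 0)
    (he : ∀ t, t + 1 < m → e (t + 1) ≤
      e t + 2 * M ^ 2 * C ^ 2 * (t + 1) * ∑ i ∈ Finset.range (t + 1), v i + 2 * d)
    (hF : ∀ t < m, F (t + 1) ≤ F t - C / 2 * G t + C / 2 * e t - C / 2 * (1 - L * C) * v t)
    (hLC : 4 * (m : ℝ) ^ 3 * M ^ 2 * C ^ 2 + L * C ≤ 1) :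
    ∑ t ∈ Finset.range m, G t ≤ 2 / C * (F 0 - F m) + 2 * (m : ℝ) ^ 2 * d := by
  set W := ∑ i ∈ Finset.range m, v i
  have hW : 0 ≤ W := Finset.sum_nonneg fun i _ ↦ hv i
  -- Every increment of the error is bounded by the same quantity, with the partial sums of `v`
  -- enlarged to the full sum `W`.
  have h1 : ∀ t < m, e t ≤ t * (2 * M ^ 2 * C ^ 2 * m * W + 2 * d) := by
    intro t
    induction t with
    | zero => simp [he0]
    | succ t ih =>
      intro ht
      have h2 : ∑ i ∈ Finset.range (t + 1), v i ≤ W :=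
        Finset.sum_le_sum_of_subset_of_nonneg (Finset.range_mono ht.le) fun i _ _ ↦ hv i
      have h3 : ((t : ℝ) + 1) ≤ m := by exact_mod_cast ht.le
      have h4 : 2 * M ^ 2 * C ^ 2 * (t + 1) * ∑ i ∈ Finset.range (t + 1), v i ≤
          2 * M ^ 2 * C ^ 2 * m * W := by
        have : 0 ≤ ∑ i ∈ Finset.range (t + 1), v i := Finset.sum_nonneg fun i _ ↦ hv i
        gcongr
      have := he t ht
      have := ih (by omega)
      push_cast
      linarith
  have h2 : ∑ t ∈ Finset.range m, e t ≤ m * (m * (2 * M ^ 2 * C ^ 2 * m * W + 2 * d)) := by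
    have : ∀ t ∈ Finset.range m, e t ≤ m * (2 * M ^ 2 * C ^ 2 * m * W + 2 * d) := by
      intro t ht
      have ht' := Finset.mem_range.1 ht
      refine (h1 t ht').trans ?_
      have : (t : ℝ) ≤ m := by exact_mod_cast ht'.le
      gcongr
    refine (Finset.sum_le_sum this).trans_eq ?_
    rw [Finset.sum_const, Finset.card_range, nsmul_eq_mul]
  have h3 : F m - F 0 ≤ -(C / 2) * ∑ t ∈ Finset.range m, G t + C / 2 * ∑ t ∈ Finset.range m, e t -
      C / 2 * (1 - L * C) * W := by
    rw [← Finset.sum_range_sub, Finset.mul_sum, Finset.mul_sum, Finset.mul_sum,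
      ← Finset.sum_add_distrib, ← Finset.sum_sub_distrib]
    refine Finset.sum_le_sum fun t ht ↦ ?_
    have := hF t (Finset.mem_range.1 ht)
    linarith
  -- This is the total coefficient of `W`: the errors cost `2m³M²C²`, and the descent pays `1 - LC`.
  have h4 : 0 ≤ (1 - L * C - 2 * (m : ℝ) ^ 3 * M ^ 2 * C ^ 2) * W := by
    have : 0 ≤ (m : ℝ) ^ 3 * M ^ 2 * C ^ 2 := by positivity
    exact mul_nonneg (by linarith) hW
  have h5 : C / 2 * ∑ t ∈ Finset.range m, G t ≤
      C / 2 * (2 / C * (F 0 - F m) + 2 * (m : ℝ) ^ 2 * d) := by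
    have h6 : C / 2 * ∑ t ∈ Finset.range m, e t ≤
        C / 2 * (m * (m * (2 * M ^ 2 * C ^ 2 * m * W + 2 * d))) := by gcongr
    have h7 : C / 2 * (2 / C * (F 0 - F m)) = F 0 - F m := by field_simp
    have h8 : 0 ≤ C / 2 * ((1 - L * C - 2 * (m : ℝ) ^ 3 * M ^ 2 * C ^ 2) * W) := by positivity
    rw [mul_add, h7]
    nlinarith
  exact le_of_mul_le_mul_left h5 (by positivity)

/-- The bound on `C` is the positive root of `νC² + LC = 1`, written so that it also makes sense for
`ν = 0`. -/
theorem step_size_condition {L ν C : ℝ} (hL : 0 < L) (hν : 0 ≤ ν) (hC : 0 < C)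
    (h : C ≤ 2 / (L + √(L ^ 2 + 4 * ν))) : ν * C ^ 2 + L * C ≤ 1 := by
  set r := √(L ^ 2 + 4 * ν)
  have hr : r ^ 2 = L ^ 2 + 4 * ν := Real.sq_sqrt (by positivity)
  have hr0 : 0 ≤ r := Real.sqrt_nonneg _
  rw [le_div_iff₀ (by positivity)] at h
  have h1 : C * r ≤ 2 - C * L := by linarith
  have h2 : (C * r) ^ 2 ≤ (2 - C * L) ^ 2 := by gcongr
  rw [mul_pow, hr] at h2
  linarith

end Descent

/-! ### Which batches determine which iterates. -/

section Locality

variable {E : Type*} [NormedAddCommGroup E] [NormedSpace ℝ E]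
  {X : Type*} [TopologicalSpace X] [ChartedSpace E X] [IsManifold 𝓘(ℝ, E) ∞ X]
  [RiemannianBundle (fun x : X ↦ TangentSpace 𝓘(ℝ, E) x)]
  [FiniteDimensional ℝ E]
  {n : ℕ} {f : Fin n → X → ℝ} {ρ : ℝ≥0∞} {c : ℝ}

theorem innerLoop_congr {α φ ψ : ℕ → ℝ} {I I' : ℕ → Finset (Fin n)} {x₀ : X} {t : ℕ}
    (h : ∀ j ≤ t, I j = I' j) :
    innerLoop (E := E) f ρ c α φ ψ I x₀ t = innerLoop (E := E) f ρ c α φ ψ I' x₀ t := by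
  induction t with
  | zero => rfl
  | succ t ih =>
    simp only [innerLoop]
    rw [ih fun j hj ↦ h j (by omega), h (t + 1) le_rfl]

/-- The bound `j ≤ m` is inclusive because the pair at time `m`, of which only the base point is
kept, is formed with the batch of index `m`. -/
theorem anchor_congr {m : ℕ} {α φ ψ : ℕ → ℕ → ℝ} {I I' : ℕ → ℕ → Finset (Fin n)} {w₀ : X} {s : ℕ}
    (h : ∀ i < s, ∀ j ≤ m, I i j = I' i j) :
    anchor (E := E) f ρ c m α φ ψ I w₀ s = anchor (E := E) f ρ c m α φ ψ I' w₀ s := by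
  induction s with
  | zero => rfl
  | succ s ih =>
    simp only [anchor]
    rw [ih fun i hi ↦ h i (by omega), innerLoop_congr fun j hj ↦ h s (by omega) j hj]

/-- The batches that determine the iterate `t` of the epoch `s`. -/
def batchesUpTo (m s t : ℕ) : Finset (ℕ × ℕ) :=
  Finset.range s ×ˢ Finset.range (m + 1) ∪ {s} ×ˢ Finset.range (t + 1)

/-- The batch of the next step is fresh, hence independent of the current iterate. -/
theorem notMem_batchesUpTo (m s t : ℕ) : (s, t + 1) ∉ batchesUpTo m s t := by
  simp [batchesUpTo]

/-- The iterates as functions of all the batches. -/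
def iterOf (E : Type*) [NormedAddCommGroup E] [NormedSpace ℝ E] [FiniteDimensional ℝ E]
    [ChartedSpace E X] [IsManifold 𝓘(ℝ, E) ∞ X]
    [RiemannianBundle (fun x : X ↦ TangentSpace 𝓘(ℝ, E) x)] (f : Fin n → X → ℝ) (ρ : ℝ≥0∞) (c : ℝ)
    (m : ℕ) (α : ℝ) (φ ψ : ℕ → ℝ) (w₀ : X) (s t : ℕ) (κ : ℕ × ℕ → Finset (Fin n)) :
    TangentBundle 𝓘(ℝ, E) X :=
  iter (E := E) f ρ c m (fun _ _ ↦ α) (fun s _ ↦ φ s) (fun s _ ↦ ψ s) (fun s t ↦ κ (s, t)) w₀ s t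

variable {m : ℕ} {α : ℝ} {φ ψ : ℕ → ℝ} {w₀ : X}

theorem dependsOn_iterOf (s t : ℕ) :
    DependsOn (iterOf E f ρ c m α φ ψ w₀ s t) (batchesUpTo m s t : Set (ℕ × ℕ)) := by
  intro κ κ' h
  have h1 : ∀ i < s, ∀ j ≤ m, κ (i, j) = κ' (i, j) := fun i hi j hj ↦
    h _ (by simp [batchesUpTo]; omega)
  have h2 : ∀ j ≤ t, κ (s, j) = κ' (s, j) := fun j hj ↦ h _ (by simp [batchesUpTo]; omega)
  rw [iterOf, iterOf, iter, iter, anchor_congr h1, innerLoop_congr h2]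

/-- Every epoch restarts from the full gradient, which resets the error. -/
theorem errSq_iterOf_zero (s : ℕ) (κ : ℕ × ℕ → Finset (Fin n)) :
    errSq f (iterOf E f ρ c m α φ ψ w₀ s 0 κ) = 0 := by
  have : errSq f (iterOf E f ρ c m α φ ψ w₀ s 0 κ) =
      ‖(grad (E := E) (objective f) (iterOf E f ρ c m α φ ψ w₀ s 0 κ).proj) -
        grad (E := E) (objective f) (iterOf E f ρ c m α φ ψ w₀ s 0 κ).proj‖ ^ 2 := rfl
  rw [this, sub_self, norm_zero, zero_pow two_ne_zero]

end Locality

/-! ### The recursions in expectation and their sum over the epochs. -/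

section Expectation

variable {E : Type*} [NormedAddCommGroup E] [NormedSpace ℝ E] [FiniteDimensional ℝ E]
  {X : Type*} [TopologicalSpace X] [T2Space X] [ChartedSpace E X] [IsManifold 𝓘(ℝ, E) ∞ X]
  [RiemannianBundle (fun x : X ↦ TangentSpace 𝓘(ℝ, E) x)]
  [IsContMDiffRiemannianBundle 𝓘(ℝ, E) ∞ E (fun x : X ↦ TangentSpace 𝓘(ℝ, E) x)]
  {n : ℕ} {f : Fin n → X → ℝ} {Ω : Set X} {ρ : ℝ≥0∞} {M L N : ℝ} {m b : ℕ} {c : ℝ}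
  {φ ψ : ℕ → ℝ} {α : ℝ} {w₀ : X}
  {S' : Type*} [MeasurableSpace S'] {P : Measure S'} [IsProbabilityMeasure P]
  {Y : ℕ × ℕ → S' → Finset (Fin n)}

/-- The expectation of a function of the iterate `t` of the epoch `s`. -/
def iterMean (P : Measure S') (Y : ℕ × ℕ → S' → Finset (Fin n)) (f : Fin n → X → ℝ) (ρ : ℝ≥0∞)
    (c : ℝ) (m : ℕ) (α : ℝ) (φ ψ : ℕ → ℝ) (w₀ : X) (h : TangentBundle 𝓘(ℝ, E) X → ℝ) (s t : ℕ) : ℝ :=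
  ∫ z, h (iterOf E f ρ c m α φ ψ w₀ s t fun k ↦ Y k z) ∂P

theorem dependsOn_comp_iterOf {β : Type*} (h : TangentBundle 𝓘(ℝ, E) X → β) (s t : ℕ) :
    DependsOn (fun κ ↦ h (iterOf E f ρ c m α φ ψ w₀ s t κ)) (batchesUpTo m s t : Set (ℕ × ℕ)) :=
  fun _ _ hκ ↦ congrArg h (dependsOn_iterOf s t hκ)

theorem integrable_iterOf (hY : ∀ k, AEMeasurable (Y k) P) (h : TangentBundle 𝓘(ℝ, E) X → ℝ)
    (s t : ℕ) : Integrable (fun z ↦ h (iterOf E f ρ c m α φ ψ w₀ s t fun k ↦ Y k z)) P :=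
  integrable_of_dependsOn hY (dependsOn_comp_iterOf h s t)

/-- The expectation is taken over the next batch first, with the past frozen; the pathwise estimate
`batchAvg_errSq_le` then holds almost surely and is integrated. -/
theorem iterMean_errSq_succ_le (hX : GeodesicallyComplete (E := E) X)
    (hf : ∀ i, ContMDiff 𝓘(ℝ, E) 𝓘(ℝ, ℝ) 1 (f i))
    (hΩ : IsTotallyRetractive (E := E) ρ Ω)
    (hLip : IsMeanSquareLipschitz (E := E) f ρ Ω M)
    (hN : ∀ x ∈ Ω, ∀ i, ‖grad (E := E) (f i) x‖ ≤ N)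
    (hb : 0 < b) (hbn : b ≤ n) (hc : 0 ≤ c) {s : ℕ} (hφ : 0 ≤ φ s) (hψ : 0 ≤ ψ s)
    (hφψ : φ s + ψ s ≤ 1) (hα : 0 ≤ α)
    (hind : iIndepFun Y P)
    (hlaw : ∀ k, HasLaw (Y k) (uniformOn {B : Finset (Fin n) | B.card = b}) P) (t : ℕ)
    (hstay : ∀ᵐ z ∂P, ∀ i ≤ t, StepIn Ω α (iterOf E f ρ c m α φ ψ w₀ s i fun k ↦ Y k z)) :
    iterMean P Y f ρ c m α φ ψ w₀ (errSq (E := E) f) s (t + 1) ≤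
      iterMean P Y f ρ c m α φ ψ w₀ (errSq (E := E) f) s t +
        2 * M ^ 2 * α ^ 2 * (t + 1) *
          ∑ i ∈ Finset.range (t + 1), iterMean P Y f ρ c m α φ ψ w₀ (dirSq (E := E)) s i +
        2 * ((1 - φ s) ^ 2 * N ^ 2) := by
  have hY k : AEMeasurable (Y k) P := (hlaw k).aemeasurable
  let F : (ℕ × ℕ → Finset (Fin n)) → Finset (Fin n) → ℝ := fun κ B ↦
    errSq f (nextIter f ρ c α (φ s) (ψ s) (iterOf E f ρ c m α φ ψ w₀ s 0 κ).proj B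
      (iterOf E f ρ c m α φ ψ w₀ s t κ))
  have hF B : DependsOn (fun κ ↦ F κ B) (batchesUpTo m s t : Set (ℕ × ℕ)) := by
    intro κ κ' h
    have h0 : iterOf E f ρ c m α φ ψ w₀ s 0 κ = iterOf E f ρ c m α φ ψ w₀ s 0 κ' :=
      dependsOn_iterOf s 0 fun k hk ↦ h k <| by
        simp only [batchesUpTo, Finset.coe_union, Set.mem_union, Finset.mem_coe, Finset.mem_product,
          Finset.mem_range, Finset.mem_singleton] at hk ⊢
        omega
    simp only [F, dependsOn_iterOf s t h, h0]
  -- By definition the next iterate is `nextIter` evaluated at the fresh batch, so its law may be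
  -- integrated out separately.
  have h1 : iterMean P Y f ρ c m α φ ψ w₀ (errSq (E := E) f) s (t + 1) =
      ∫ z, batchAvg n b (F fun k ↦ Y k z) ∂P := by
    have h2 := integral_eq_integral_integral hY hind (notMem_batchesUpTo m s t) hF
    rw [(hlaw (s, t + 1)).map_eq] at h2
    simp only [integral_uniformOn_card] at h2
    exact h2
  have hint : Integrable (fun z ↦ batchAvg n b (F fun k ↦ Y k z)) P :=
    integrable_of_dependsOn hY (h := fun κ ↦ batchAvg n b (F κ)) (J := batchesUpTo m s t)
      fun κ κ' h ↦ congrArg (batchAvg n b) (funext fun B ↦ hF B h)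
  have he := integrable_iterOf (f := f) (ρ := ρ) (c := c) (m := m) (α := α) (φ := φ) (ψ := ψ)
    (w₀ := w₀) hY (errSq (E := E) f) s t
  have hv i := integrable_iterOf (f := f) (ρ := ρ) (c := c) (m := m) (α := α) (φ := φ) (ψ := ψ)
    (w₀ := w₀) hY (dirSq (E := E)) s i
  have hv' := (integrable_finsetSum (Finset.range (t + 1)) fun i _ ↦ hv i).const_mul
    (2 * M ^ 2 * α ^ 2 * (t + 1))
  have h3 : ∫ z, batchAvg n b (F fun k ↦ Y k z) ∂P ≤
      ∫ z, (errSq f (iterOf E f ρ c m α φ ψ w₀ s t fun k ↦ Y k z) +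
        2 * M ^ 2 * α ^ 2 * (t + 1) * ∑ i ∈ Finset.range (t + 1),
          dirSq (iterOf E f ρ c m α φ ψ w₀ s i fun k ↦ Y k z) +
        2 * (1 - φ s) ^ 2 * N ^ 2) ∂P := by
    refine integral_mono_ae hint ((he.add hv').add (integrable_const _)) ?_
    filter_upwards [hstay] with z hz
    exact batchAvg_errSq_le hX hf hΩ hLip hN hb hbn hc hφ hψ hφψ hα
      (q := fun i ↦ iterOf E f ρ c m α φ ψ w₀ s i fun k ↦ Y k z) (fun i ↦ rfl) t hz
  rw [h1]
  refine h3.trans_eq ?_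
  rw [integral_add (he.fun_add hv') (integrable_const _), integral_add he hv', integral_const_mul,
    integral_finsetSum _ fun i _ ↦ hv i, integral_const]
  simp only [iterMean, probReal_univ, one_smul]
  ring

theorem iterMean_objective_succ_le (hX : GeodesicallyComplete (E := E) X)
    (hΩ : IsTotallyRetractive (E := E) ρ Ω)
    (hsmooth : IsRetractionSmooth (E := E) (objective f) ρ Ω L)
    (hY : ∀ k, AEMeasurable (Y k) P) (s t : ℕ)
    (hstay : ∀ᵐ z ∂P, StepIn Ω α (iterOf E f ρ c m α φ ψ w₀ s t fun k ↦ Y k z)) :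
    iterMean P Y f ρ c m α φ ψ w₀ (fun q : TangentBundle 𝓘(ℝ, E) X ↦ objective f q.proj) s (t + 1) ≤
      iterMean P Y f ρ c m α φ ψ w₀ (fun q : TangentBundle 𝓘(ℝ, E) X ↦ objective f q.proj) s t -
        α / 2 * iterMean P Y f ρ c m α φ ψ w₀ (gradSq (E := E) f) s t +
        α / 2 * iterMean P Y f ρ c m α φ ψ w₀ (errSq (E := E) f) s t -
        α / 2 * (1 - L * α) * iterMean P Y f ρ c m α φ ψ w₀ (dirSq (E := E)) s t := by
  have hi (h : TangentBundle 𝓘(ℝ, E) X → ℝ) (t) := integrable_iterOf (f := f) (ρ := ρ) (c := c)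
    (m := m) (α := α) (φ := φ) (ψ := ψ) (w₀ := w₀) hY h s t
  have h1 := hi (fun q ↦ objective f q.proj) t
  have h2 := (hi (gradSq f) t).const_mul (α / 2)
  have h3 := (hi (errSq f) t).const_mul (α / 2)
  have h4 := (hi dirSq t).const_mul (α / 2 * (1 - L * α))
  simp only [iterMean]
  rw [← integral_const_mul, ← integral_const_mul, ← integral_const_mul, ← integral_sub h1 h2,
    ← integral_add (h1.sub' h2) h3, ← integral_sub ((h1.sub' h2).fun_add h3) h4]
  refine integral_mono_ae (hi (fun q ↦ objective f q.proj) (t + 1))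
    (((h1.sub h2).add h3).sub h4) ?_
  filter_upwards [hstay] with z hz
  exact objective_step_le hX hΩ hsmooth hz

/-- The gradients accumulated over the first `S` epochs. -/
theorem sum_iterMean_gradSq_le (hX : GeodesicallyComplete (E := E) X)
    (hf : ∀ i, ContMDiff 𝓘(ℝ, E) 𝓘(ℝ, ℝ) 1 (f i)) {wstar : X}
    (hstar : ∀ x, objective f wstar ≤ objective f x)
    (hΩ : IsTotallyRetractive (E := E) ρ Ω)
    (hLip : IsMeanSquareLipschitz (E := E) f ρ Ω M)
    (hsmooth : IsRetractionSmooth (E := E) (objective f) ρ Ω L)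
    (hN : ∀ x ∈ Ω, ∀ i, ‖grad (E := E) (f i) x‖ ≤ N)
    (hb : 0 < b) (hbn : b ≤ n) (hc : 0 ≤ c) (hφ : ∀ s, 0 ≤ φ s) (hψ : ∀ s, 0 ≤ ψ s)
    (hφψ : ∀ s, φ s + ψ s ≤ 1) (hα : 0 < α)
    (hLα : 4 * (m : ℝ) ^ 3 * M ^ 2 * α ^ 2 + L * α ≤ 1)
    (hind : iIndepFun Y P)
    (hlaw : ∀ k, HasLaw (Y k) (uniformOn {B : Finset (Fin n) | B.card = b}) P)
    (hstay : ∀ᵐ z ∂P, ∀ s, ∀ t < m, StepIn Ω α (iterOf E f ρ c m α φ ψ w₀ s t fun k ↦ Y k z))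
    (S : ℕ) :
    ∑ s ∈ Finset.range S, ∑ t ∈ Finset.range m,
        iterMean P Y f ρ c m α φ ψ w₀ (gradSq (E := E) f) s t ≤
      2 / α * (objective f w₀ - objective f wstar) +
        2 * (m : ℝ) ^ 2 * N ^ 2 * ∑ s ∈ Finset.range S, (1 - φ s) ^ 2 := by
  have hY k : AEMeasurable (Y k) P := (hlaw k).aemeasurable
  set Φ : ℕ → ℕ → ℝ :=
    iterMean P Y f ρ c m α φ ψ w₀ (fun q : TangentBundle 𝓘(ℝ, E) X ↦ objective f q.proj)
  -- The last point of an epoch is the anchor of the following one, so `Φ s m` and `Φ (s + 1) 0` are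
  -- the same by definition and the epochs telescope.
  have hepoch s : ∑ t ∈ Finset.range m,
      iterMean P Y f ρ c m α φ ψ w₀ (gradSq (E := E) f) s t ≤
      2 / α * (Φ s 0 - Φ (s + 1) 0) + 2 * (m : ℝ) ^ 2 * ((1 - φ s) ^ 2 * N ^ 2) := by
    refine sum_grad_le_of_descent (F := Φ s)
      (e := iterMean P Y f ρ c m α φ ψ w₀ (errSq (E := E) f) s)
      (v := iterMean P Y f ρ c m α φ ψ w₀ (dirSq (E := E)) s) hα (by positivity)
      (fun t ↦ integral_nonneg fun z ↦ sq_nonneg _) ?_ (fun t ht ↦ ?_) (fun t ht ↦ ?_) hLα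
    · simp [iterMean, errSq_iterOf_zero]
    · refine iterMean_errSq_succ_le hX hf hΩ hLip hN hb hbn hc (hφ s) (hψ s) (hφψ s) hα.le hind hlaw
        t ?_
      filter_upwards [hstay] with z hz i hi using hz s i (by omega)
    · refine iterMean_objective_succ_le hX hΩ hsmooth hY s t ?_
      filter_upwards [hstay] with z hz using hz s t ht
  refine (Finset.sum_le_sum fun s _ ↦ hepoch s).trans ?_
  have h0 : Φ 0 0 = objective f w₀ := by
    change ∫ _, objective f w₀ ∂P = _
    simp
  have hS : objective f wstar ≤ Φ S 0 := by
    have := integral_mono (μ := P) (integrable_const (objective f wstar))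
      (integrable_iterOf (f := f) (ρ := ρ) (c := c) (m := m) (α := α) (φ := φ) (ψ := ψ)
        (w₀ := w₀) hY (fun q : TangentBundle 𝓘(ℝ, E) X ↦ objective f q.proj) S 0)
      fun z ↦ hstar _
    rwa [integral_const, probReal_univ, one_smul] at this
  rw [Finset.sum_add_distrib, ← Finset.mul_sum, Finset.sum_range_sub', ← Finset.mul_sum,
    ← Finset.sum_mul, h0]
  have : 2 / α * (objective f w₀ - Φ S 0) ≤ 2 / α * (objective f w₀ - objective f wstar) := by
    gcongr
  linarith

end Expectation

end RSHG

end

/-! ### The convergence theorem. -/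

theorem corollary2
    {E : Type*} [NormedAddCommGroup E] [NormedSpace ℝ E] [FiniteDimensional ℝ E]
    {X : Type*} [TopologicalSpace X] [T2Space X] [ChartedSpace E X] [IsManifold 𝓘(ℝ, E) ∞ X]
    [RiemannianBundle (fun x : X ↦ TangentSpace 𝓘(ℝ, E) x)]
    [IsContMDiffRiemannianBundle 𝓘(ℝ, E) ∞ E (fun x : X ↦ TangentSpace 𝓘(ℝ, E) x)]
    (hX : RSHG.GeodesicallyComplete (E := E) X)
    -- the component functions and a global minimizer of the objective
    {n : ℕ} (hn : 0 < n) (f : Fin n → X → ℝ) (hf : ∀ i, ContMDiff 𝓘(ℝ, E) 𝓘(ℝ, ℝ) 1 (f i))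
    (wstar : X) (hstar : ∀ x, RSHG.objective f wstar ≤ RSHG.objective f x)
    -- the region; `Ω = univ` and `ρ = ∞` are allowed
    (Ω : Set X) (ρ : ℝ≥0∞) (hΩ : RSHG.IsTotallyRetractive (E := E) ρ Ω)
    (M L N : ℝ) (hM : 0 < M) (hL : 0 < L)
    (hLip : RSHG.IsMeanSquareLipschitz (E := E) f ρ Ω M)
    (hsmooth : RSHG.IsRetractionSmooth (E := E) (RSHG.objective f) ρ Ω L)
    (hN : ∀ x ∈ Ω, ∀ i, ‖RSHG.grad (E := E) (f i) x‖ ≤ N)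
    -- the parameters of the algorithm
    (m b : ℕ) (hm : 0 < m) (hb : 0 < b) (hbn : b ≤ n)
    (c : ℝ) (hc0 : 0 < c) (hc1 : c < 1)
    (φ ψ : ℕ → ℝ) (hφ : ∀ s, 0 ≤ φ s) (hψ : ∀ s, 0 ≤ ψ s) (hφψ : ∀ s, φ s + ψ s ≤ 1)
    (hsum : Summable fun s ↦ (1 - φ s) ^ 2 + ψ s ^ 2)
    (Cα ν : ℝ) (hν : ν = 4 * (m : ℝ) ^ 3 * M ^ 2)
    (hCα0 : 0 < Cα) (hCα : Cα ≤ 2 / (L + √(L ^ 2 + 4 * ν)))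
    (w₀ : X)
    -- the batches: independent and uniform among the index sets of cardinality `b`
    {S' : Type*} [MeasurableSpace S'] (P : Measure S') [IsProbabilityMeasure P]
    (I : ℕ → ℕ → S' → Finset (Fin n))
    (hIind : iIndepFun (fun k : ℕ × ℕ ↦ I k.1 k.2) P)
    (hIlaw : ∀ s t, HasLaw (I s t) (uniformOn {B : Finset (Fin n) | B.card = b}) P)
    -- the output index: uniform on the iterates of the first `S` epochs, independent of the batches
    (a : ℕ → S' → ℕ × ℕ)
    (halaw : ∀ S, 0 < S → HasLaw (a S) (uniformOn (Set.Iio S ×ˢ Set.Iio m)) P)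
    (haind : ∀ S, 0 < S → IndepFun (a S) (fun z (k : ℕ × ℕ) ↦ I k.1 k.2 z) P)
    -- the pairs `(ω_t^s, V_t^s)` produced by the algorithm
    (w : S' → ℕ → ℕ → TangentBundle 𝓘(ℝ, E) X)
    (hw : ∀ z, w z = RSHG.iter f ρ c m (fun _ _ ↦ Cα) (fun s _ ↦ φ s) (fun s _ ↦ ψ s)
      (fun s t ↦ I s t z) w₀)
    -- the iterates and the geodesic segments between them stay in the region
    (hstay : ∀ᵐ z ∂P, ∀ s, ∀ t < m, ∀ τ ∈ Set.Icc (0 : ℝ) 1,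
      RSHG.expMap (w z s t).proj (-((τ * Cα) • (w z s t).snd)) ∈ Ω) :
    (∀ S : ℕ, 0 < S →
      Integrable (fun z ↦ ‖RSHG.grad (E := E) (RSHG.objective f)
        (w z (a S z).1 (a S z).2).proj‖ ^ 2) P ∧
      ∫ z, ‖RSHG.grad (E := E) (RSHG.objective f) (w z (a S z).1 (a S z).2).proj‖ ^ 2 ∂P ≤
        2 / ((m : ℝ) * S * Cα) * (RSHG.objective f w₀ - RSHG.objective f wstar) +
          4 * m * N ^ 2 / S * ∑' s, ((1 - φ s) ^ 2 + ψ s ^ 2)) ∧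
    (fun S : ℕ ↦ ∫ z, ‖RSHG.grad (E := E) (RSHG.objective f)
        (w z (a S z).1 (a S z).2).proj‖ ^ 2 ∂P) =O[atTop] (fun S : ℕ ↦ 1 / (S : ℝ)) := by
  have hν0 : 0 ≤ ν := by rw [hν]; positivity
  have hLα : 4 * (m : ℝ) ^ 3 * M ^ 2 * Cα ^ 2 + L * Cα ≤ 1 := by
    rw [← hν]
    exact RSHG.step_size_condition hL hν0 hCα0 hCα
  have hlaw : ∀ k : ℕ × ℕ, HasLaw (I k.1 k.2) (uniformOn {B : Finset (Fin n) | B.card = b}) P :=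
    fun k ↦ hIlaw k.1 k.2
  have hY : ∀ k : ℕ × ℕ, AEMeasurable (I k.1 k.2) P := fun k ↦ (hlaw k).aemeasurable
  have hw' : ∀ z s t, w z s t = RSHG.iterOf E f ρ c m Cα φ ψ w₀ s t fun k ↦ I k.1 k.2 z :=
    fun z s t ↦ by rw [hw]; rfl
  have hstay' : ∀ᵐ z ∂P, ∀ s, ∀ t < m,
      RSHG.StepIn Ω Cα (RSHG.iterOf E f ρ c m Cα φ ψ w₀ s t fun k ↦ I k.1 k.2 z) := by
    filter_upwards [hstay] with z hz s t ht
    rw [← hw']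
    exact hz s t ht
  set T := ∑' s, ((1 - φ s) ^ 2 + ψ s ^ 2)
  have hmain : ∀ S : ℕ, 0 < S →
      Integrable (fun z ↦ ‖RSHG.grad (E := E) (RSHG.objective f)
        (w z (a S z).1 (a S z).2).proj‖ ^ 2) P ∧
      ∫ z, ‖RSHG.grad (E := E) (RSHG.objective f) (w z (a S z).1 (a S z).2).proj‖ ^ 2 ∂P ≤
        2 / ((m : ℝ) * S * Cα) * (RSHG.objective f w₀ - RSHG.objective f wstar) +
          4 * m * N ^ 2 / S * T := by
    intro S hS
    have hK : (Set.Iio S ×ˢ Set.Iio m : Set (ℕ × ℕ)) =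
        ((Finset.range S ×ˢ Finset.range m : Finset (ℕ × ℕ)) : Set (ℕ × ℕ)) := by
      ext k
      simp
    have hlawS := halaw S hS
    rw [hK] at hlawS
    have key := RSHG.integral_sampled hY hlawS (haind S hS)
      (A := fun k κ ↦ RSHG.gradSq f (RSHG.iterOf E f ρ c m Cα φ ψ w₀ k.1 k.2 κ))
      (fun k ↦ RSHG.batchesUpTo m k.1 k.2) fun k ↦ RSHG.dependsOn_comp_iterOf _ k.1 k.2
    have hfun : (fun z ↦ ‖RSHG.grad (E := E) (RSHG.objective f)
        (w z (a S z).1 (a S z).2).proj‖ ^ 2) = fun z ↦ RSHG.gradSq f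
          (RSHG.iterOf E f ρ c m Cα φ ψ w₀ (a S z).1 (a S z).2 fun k ↦ I k.1 k.2 z) := by
      funext z
      rw [hw']
      rfl
    rw [hfun]
    refine ⟨key.1, ?_⟩
    rw [key.2, Finset.card_product, Finset.card_range, Finset.card_range, Finset.sum_product]
    have hsumle := RSHG.sum_iterMean_gradSq_le hX hf hstar hΩ hLip hsmooth hN hb hbn hc0.le hφ hψ
      hφψ hCα0 hLα hIind hlaw hstay' S
    -- The epochs cost only the terms `(1 - φ s)²`; adding `ψ s ^ 2` and the tail of the series
    -- enlarges the bound.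
    have hT : ∑ s ∈ Finset.range S, (1 - φ s) ^ 2 ≤ T :=
      (Finset.sum_le_sum fun s _ ↦ le_add_of_nonneg_right (sq_nonneg (ψ s))).trans
        (hsum.sum_le_tsum _ fun s _ ↦ by positivity)
    have hT0 : 0 ≤ T := tsum_nonneg fun s ↦ by positivity
    have hm' : (0 : ℝ) < m := by exact_mod_cast hm
    have hS' : (0 : ℝ) < S := by exact_mod_cast hS
    have hle : ∑ s ∈ Finset.range S, ∑ t ∈ Finset.range m,
        RSHG.iterMean P (fun k z ↦ I k.1 k.2 z) f ρ c m Cα φ ψ w₀ (RSHG.gradSq (E := E) f) s t ≤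
        2 / Cα * (RSHG.objective f w₀ - RSHG.objective f wstar) + 4 * (m : ℝ) ^ 2 * N ^ 2 * T := by
      refine hsumle.trans ?_
      gcongr
      norm_num
    calc _ ≤ 1 / ((S * m : ℕ) : ℝ) * (2 / Cα * (RSHG.objective f w₀ - RSHG.objective f wstar) +
          4 * (m : ℝ) ^ 2 * N ^ 2 * T) := mul_le_mul_of_nonneg_left hle (by positivity)
      _ = _ := by
        push_cast
        field_simp
  -- The explicit bound equals `1 / S` times this constant, which does not depend on `S`.
  refine ⟨hmain, Asymptotics.IsBigO.of_bound
    (2 / ((m : ℝ) * Cα) * (RSHG.objective f w₀ - RSHG.objective f wstar) + 4 * m * N ^ 2 * T) ?_⟩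
  filter_upwards [eventually_gt_atTop 0] with S hS
  have hS' : (0 : ℝ) < S := by exact_mod_cast hS
  rw [Real.norm_of_nonneg (integral_nonneg fun z ↦ by positivity),
    Real.norm_of_nonneg (by positivity)]
  refine (hmain S hS).2.trans_eq ?_
  field_simp
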